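/- **Setting.** Let $V=\{x_1,\dots,x_n\}$. A $k$-SAT formula $\Phi=(\Phi_1,\dots,\Phi_m)$ is an ordered $m$-tuple of clauses $\Phi_i=(\Phi_{i1},\dots,\Phi_{ik})$, each an ordered $k$-tuple of literals from $V\cup\bar V$ (repetitions are allowed). Let $|l|$ be the variable underlying the literal $l$, let $k_1=\lceil k/2\rceil$, and for $Z\subset V$ let $\sigma_Z$ be the assignment that sets the variables in $Z$ to false and all other variables to true. **Phase 1 of Fix.** A clause $\Phi_i$ is *$Z$-unique* if there is exactly one $j$ such that $\Phi_{ij}$ is a positive literal from $V\setminus Z$ and no negative literal of $\Phi_i$ has its variable in $Z$. A variable $x\in V\setminus Z$ is *$Z$-safe* if it occurs positively in no $Z$-unique clause. Start with $Z=\emptyset$. For $i=1,\dots,m$: if $\Phi_i$ consists of negative literals only and contains no variable from $Z$, then add $|\Phi_{ij}|$ to $Z$ for the least $1\le j<k_1$ such that $|\Phi_{ij}|$ is $Z$-safe; if there is no such $j$, add $|\Phi_{ik_1}|$ to $Z$. **Phase 2 of Fix.** Let $Z$ be the outcome of Phase 1. For $Z'\subset V$, a clause $\Phi_i$ is *$(Z,Z')$-endangered*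 if there is no $j$ such that $\Phi_{ij}$ is true under $\sigma_Z$ and $|\Phi_{ij}|\notin Z'$. A variable $x$ is *$(Z,Z')$-unsafe* if $x\in Z\cup Z'$ or there are $i,l$ such that $\Phi_{il}=x$ and for all $j\ne l$ the literal $\Phi_{ij}$ is either positive with $\Phi_{ij}\in Z\cup Z'$ or negative with $|\Phi_{ij}|\notin Z$; otherwise $x$ is *$(Z,Z')$-safe*. Start with $Z'=\emptyset$ and let $Q$ be the set of all $i$ such that $\Phi_i$ is unsatisfied under $\sigma_Z$. While $Q\neq\emptyset$, do the following. - Let $i=\min Q$. - If there are $k_1<j_1<j_2<j_3\le k-5$ such that $|\Phi_{ij_1}|,|\Phi_{ij_2}|,|\Phi_{ij_3}|$ are $(Z,Z')$-safe, take the lexicographically first such triple. Otherwise take the lexicographically first triple $k-5<j_1<j_2<j_3\le k$ with $|\Phi_{ij_1}|,|\Phi_{ij_2}|,|\Phi_{ij_3}|\notin Z'$. - Add $|\Phi_{ij_1}|,|\Phi_{ij_2}|,|\Phi_{ij_3}|$ to $Z'$. - Let $Q$ be the set of all $i$ such that $\Phi_i$ is $(Z,Z')$-endangered and there are fewer than three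 $j$ with $|\Phi_{ij}|\in Z'$. **Proposition 3.2.** For every $0<\varepsilon<0.1$ there is $k_0=k_0(\varepsilon)$ such that for every fixed $k\ge k_0$ the following holds. Let $m=\lfloor(1-\varepsilon)2^kk^{-1}\ln(k)\,n\rfloor$ and let $\Phi$ be chosen uniformly at random from all $(2n)^{km}$ $k$-SAT formulas with $m$ clauses over $x_1,\dots,x_n$. Then, with probability tending to $1$ as $n\to\infty$, the set $Z'$ obtained in Phase 2 of Fix applied to $\Phi$ satisfies $|Z'|\le n\,k^{-12}$. -/

import Mathlib

open Filter Topology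

namespace FixSat

/-- A literal over the variables `Fin n`: its underlying variable, and its sign
(`true` for the positive literal, `false` for the negative one). -/
abbrev Lit (n : ℕ) : Type := Fin n × Bool

/-- A `k`-SAT formula with `m` clauses over `n` variables: an ordered `m`-tuple of ordered
`k`-tuples of literals, repetitions being allowed. The set of all of them has `(2n)^(km)` elements. -/
abbrev Formula (k n m : ℕ) : Type := Fin m → Fin k → Lit n

/-- `⌈k/2⌉`. Positions in a clause are numbered `1, …, k`; the element `j : Fin k` is
position `j + 1`. -/
def k₁ (k : ℕ) : ℕ := (k + 1) / 2

section Algorithm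

variable {k n m : ℕ}

/-- The assignment that is false exactly on `Z`. -/
def sigma (Z : Finset (Fin n)) (x : Fin n) : Bool := decide (x ∉ Z)

/-- The literal `l` is true under the assignment `σ`. -/
abbrev Lit.TrueUnder (l : Lit n) (σ : Fin n → Bool) : Prop := σ l.1 = l.2

/-! ### First phase -/

/-- All literals of clause `i` are negative. -/
abbrev AllNegative (Φ : Formula k n m) (i : Fin m) : Prop := ∀ j, (Φ i j).2 = false

/-- Clause `i` is `Z`-unique: exactly one of its literals is positive with a variable outside `Z`,
and none of its literals is negative with a variable in `Z`. -/
abbrev Unique (Φ : Formula k n m) (Z : Finset (Fin n)) (i : Fin m) : Prop :=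
  (Finset.univ.filter fun j : Fin k => (Φ i j).2 = true ∧ (Φ i j).1 ∉ Z).card = 1 ∧
    ∀ j, (Φ i j).2 = false → (Φ i j).1 ∉ Z

/-- The variable `x` lies outside `Z` and does not occur positively in any `Z`-unique clause. -/
abbrev Safe₁ (Φ : Formula k n m) (Z : Finset (Fin n)) (x : Fin n) : Prop :=
  x ∉ Z ∧ ¬ ∃ i, Unique Φ Z i ∧ ∃ j, Φ i j = (x, true)

/-- The treatment of clause `i` in the first phase. If the clause is all-negative and contains no
variable from `Z`, add to `Z` the variable in the first position `j < ⌈k/2⌉` that holds a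
`Z`-safe variable; if there is none, add the variable in position `⌈k/2⌉`. -/
def phase1Step (Φ : Formula k n m) (Z : Finset (Fin n)) (i : Fin m) : Finset (Fin n) :=
  if AllNegative Φ i ∧ ∀ j, (Φ i j).1 ∉ Z then
    match (List.finRange k).find? fun j => decide (j.val + 1 < k₁ k ∧ Safe₁ Φ Z (Φ i j).1) with
    | some j => insert (Φ i j).1 Z
    | none => Z ∪ (Finset.univ.filter fun j : Fin k => j.val + 1 = k₁ k).image fun j => (Φ i j).1
  else Z

/-- The set `Z` at the end of the first phase, which goes through the clauses in their order. -/
def phase1 (Φ : Formula k n m) : Finset (Fin n) :=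
  (List.finRange m).foldl (phase1Step Φ) ∅

/-! ### Second phase -/

/-- Clause `i` is `(Z, Z')`-endangered: no literal of it that is true under `sigma Z` has its
variable outside `Z'`. -/
abbrev Endangered (Φ : Formula k n m) (Z Z' : Finset (Fin n)) (i : Fin m) : Prop :=
  ¬ ∃ j, (Φ i j).TrueUnder (sigma Z) ∧ (Φ i j).1 ∉ Z'

/-- The variable `x` is `(Z, Z')`-unsafe: it lies in `Z ∪ Z'`, or it is the positive literal in some
position `l` of some clause `i` all of whose other positions hold a positive literal from `Z ∪ Z'`
or a negative literal whose variable is not in `Z`. -/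
abbrev Unsafe₂ (Φ : Formula k n m) (Z Z' : Finset (Fin n)) (x : Fin n) : Prop :=
  x ∈ Z ∪ Z' ∨ ∃ (i : Fin m) (l : Fin k),
    (∀ j, j ≠ l → ((Φ i j).2 = true ∧ (Φ i j).1 ∈ Z ∪ Z') ∨ ((Φ i j).2 = false ∧ (Φ i j).1 ∉ Z)) ∧
      Φ i l = (x, true)

/-- The clauses that are unsatisfied under `sigma Z`. -/
def unsatisfied (Φ : Formula k n m) (Z : Finset (Fin n)) : Finset (Fin m) :=
  Finset.univ.filter fun i => ∀ j, ¬ (Φ i j).TrueUnder (sigma Z)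

/-- The `(Z, Z')`-endangered clauses that have a variable from `Z'` in fewer than three of their
`k` positions. -/
def queue (Φ : Formula k n m) (Z Z' : Finset (Fin n)) : Finset (Fin m) :=
  Finset.univ.filter fun i =>
    Endangered Φ Z Z' i ∧ (Finset.univ.filter fun j : Fin k => (Φ i j).1 ∈ Z').card < 3

/-- The three positions of clause `i` whose variables are added to `Z'`. If at least three positions
`j` with `⌈k/2⌉ < j ≤ k - 5` hold a `(Z, Z')`-safe variable, these are the first three of them,
i.e. the lexicographically first triple. Otherwise they are the first three positions `j` with
`k - 5 < j ≤ k` that hold a variable outside `Z'`. -/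
def picks (Φ : Formula k n m) (Z Z' : Finset (Fin n)) (i : Fin m) : List (Fin k) :=
  let S := (List.finRange k).filter fun j =>
    decide (k₁ k < j.val + 1 ∧ j.val + 1 + 5 ≤ k ∧ ¬ Unsafe₂ Φ Z Z' (Φ i j).1)
  if 3 ≤ S.length then S.take 3
  else ((List.finRange k).filter fun j => decide (k < j.val + 1 + 5 ∧ (Φ i j).1 ∉ Z')).take 3

/-- One pass of the while loop of the second phase; the state consists of the set `Q` of clauses
that still have to be treated and of `Z'`. If `Q` is empty then the loop has ended and the state no
longer changes. Otherwise the least `i ∈ Q` is treated, and `Q` is computed anew. -/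
def phase2Step (Φ : Formula k n m) (Z : Finset (Fin n))
    (s : Finset (Fin m) × Finset (Fin n)) : Finset (Fin m) × Finset (Fin n) :=
  if h : s.1.Nonempty then
    let Z' := s.2 ∪ ((picks Φ Z s.2 (s.1.min' h)).map fun j => (Φ (s.1.min' h) j).1).toFinset
    (queue Φ Z Z', Z')
  else s

/-- The state after `t` passes of the while loop of the second phase. -/
def phase2State (Φ : Formula k n m) (t : ℕ) : Finset (Fin m) × Finset (Fin n) :=
  (phase2Step Φ (phase1 Φ))^[t] (unsatisfied Φ (phase1 Φ), ∅)

/-- The set `Z'` at the end of the second phase. For `k ≥ 5` every pass of the loop adds at least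
one new variable to `Z'`, so the loop has ended after at most `n` passes; this is
`phase2State_finished` below. -/
def phase2 (Φ : Formula k n m) : Finset (Fin n) := (phase2State Φ n).2

/-! ### The while loop ends within `n` passes -/

theorem phase2State_fst (Φ : Formula k n m) (t : ℕ) :
    (phase2State Φ t).1 = queue Φ (phase1 Φ) (phase2State Φ t).2 := by
  induction t with
  | zero =>
    ext i
    simp [phase2State, unsatisfied, queue]
  | succ t ih =>
    have hs : phase2State Φ (t + 1) = phase2Step Φ (phase1 Φ) (phase2State Φ t) := by
      simp only [phase2State, Function.iterate_succ_apply']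
    rw [hs]
    unfold phase2Step
    split_ifs
    · rfl
    · exact ih

theorem exists_mem_picks (hk : 5 ≤ k) (Φ : Formula k n m) (Z Z' : Finset (Fin n)) (i : Fin m)
    (hi : i ∈ queue Φ Z Z') : ∃ j ∈ picks Φ Z Z' i, (Φ i j).1 ∉ Z' := by
  unfold picks
  simp only
  split_ifs with h
  · set S := (List.finRange k).filter fun j =>
      decide (k₁ k < j.val + 1 ∧ j.val + 1 + 5 ≤ k ∧ ¬ Unsafe₂ Φ Z Z' (Φ i j).1) with hS
    have hne : S.take 3 ≠ [] := by
      intro h0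
      have := congrArg List.length h0
      simp only [List.length_take, List.length_nil] at this
      omega
    obtain ⟨j, hj⟩ := List.exists_mem_of_ne_nil _ hne
    refine ⟨j, hj, ?_⟩
    have hj' := List.mem_of_mem_take hj
    rw [hS, List.mem_filter] at hj'
    have h3 := (of_decide_eq_true hj'.2).2.2
    intro hmem
    exact h3 (Or.inl (Finset.mem_union_right _ hmem))
  · set L := (List.finRange k).filter fun j =>
      decide (k < j.val + 1 + 5 ∧ (Φ i j).1 ∉ Z') with hL
    have hne : L ≠ [] := by
      intro h0
      have hall : ∀ j : Fin k, k < j.val + 1 + 5 → (Φ i j).1 ∈ Z' := by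
        intro j hj
        by_contra hn
        have : j ∈ L := by
          rw [hL, List.mem_filter]
          exact ⟨List.mem_finRange j, decide_eq_true ⟨hj, hn⟩⟩
        simp [h0] at this
      have hc := (Finset.mem_filter.mp hi).2.2
      have hsub : (Finset.univ : Finset (Fin 3)).image
          (fun a => (⟨k - 1 - a.val, by omega⟩ : Fin k)) ⊆
          Finset.univ.filter fun j : Fin k => (Φ i j).1 ∈ Z' := by
        intro j hj
        simp only [Finset.mem_image, Finset.mem_univ, true_and] at hj
        obtain ⟨a, rfl⟩ := hj
        simp only [Finset.mem_filter, Finset.mem_univ, true_and]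
        apply hall
        have := a.isLt
        simp only
        omega
      have hcard := Finset.card_le_card hsub
      rw [Finset.card_image_of_injective] at hcard
      · simp only [Finset.card_univ, Fintype.card_fin] at hcard
        omega
      · intro a b hab
        simp only [Fin.mk.injEq] at hab
        have := a.isLt
        have := b.isLt
        exact Fin.ext (by omega)
    have hne' : L.take 3 ≠ [] := by
      intro h0
      have := congrArg List.length h0
      have := List.length_pos_iff.mpr hne
      simp only [List.length_take, List.length_nil] at *
      omega
    obtain ⟨j, hj⟩ := List.exists_mem_of_ne_nil _ hne'
    refine ⟨j, hj, ?_⟩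
    have hj' := List.mem_of_mem_take hj
    rw [hL, List.mem_filter] at hj'
    exact (of_decide_eq_true hj'.2).2

theorem phase2State_progress (hk : 5 ≤ k) (Φ : Formula k n m) (t : ℕ) :
    (phase2State Φ t).1 = ∅ ∨ t ≤ (phase2State Φ t).2.card := by
  induction t with
  | zero => right; simp
  | succ t ih =>
    have hs : phase2State Φ (t + 1) = phase2Step Φ (phase1 Φ) (phase2State Φ t) := by
      simp only [phase2State, Function.iterate_succ_apply']
    have hq := phase2State_fst Φ t
    rw [hs]
    generalize phase2State Φ t = s at ih hq
    unfold phase2Step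
    split_ifs with h
    · right
      have ht : t ≤ s.2.card := by
        rcases ih with h0 | h0
        · simp [h0] at h
        · exact h0
      obtain ⟨j, hj, hn⟩ := exists_mem_picks hk Φ (phase1 Φ) s.2 (s.1.min' h)
        (hq ▸ s.1.min'_mem h)
      refine Nat.succ_le_of_lt (lt_of_le_of_lt ht (Finset.card_lt_card ?_))
      refine Finset.ssubset_iff_subset_ne.mpr ⟨Finset.subset_union_left, fun he => hn ?_⟩
      rw [he]
      refine Finset.mem_union_right _ (List.mem_toFinset.mpr ?_)
      exact List.mem_map.mpr ⟨j, hj, rfl⟩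
    · left
      exact Finset.not_nonempty_iff_eq_empty.mp h

/-- After `n` passes the loop condition `Q ≠ ∅` fails. -/
theorem phase2State_finished (hk : 5 ≤ k) (Φ : Formula k n m) : (phase2State Φ n).1 = ∅ := by
  rcases phase2State_progress hk Φ n with h | h
  · exact h
  · have hu : (phase2State Φ n).2 = Finset.univ :=
      Finset.eq_univ_of_card _ (le_antisymm (by simpa using Finset.card_le_univ (phase2State Φ n).2)
        (by simpa using h))
    rw [phase2State_fst, hu]
    apply Finset.filter_eq_empty_iff.mpr
    intro i _ hi
    have := hi.2
    simp at this
    omega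

end Algorithm

/-- The number of clauses `⌊(1 - ε) 2^k k⁻¹ ln k · n⌋`. -/
noncomputable def numClauses (ε : ℝ) (k n : ℕ) : ℕ :=
  ⌊(1 - ε) * 2 ^ k * (k : ℝ)⁻¹ * Real.log k * n⌋₊

end FixSat

/-! The sets Z and Z' depend on the whole formula, so the clauses cannot be treated as independent
of them. The remedy is a bijection on formulas. Both phases are put on one time line: the times t <
m treat the clauses in order, the later times are the passes of the loop. `encode` replaces each
variable by its number in an enumeration that is determined by what the run has seen when this
position is first looked at. The run can be replayed from the codes, so `encode` is injective
(`encode_injective`), and the encoding of a uniform formula is uniform. Events about codes can then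
be estimated clause by clause.

The enumerations give the smallest numbers to Z ∪ Z'. Hence in a clause treated by the second phase
all positive literals but one have low codes, below a bound Θ for |Z ∪ Z'|. In the inspected part of
a treated clause the safe variables get the largest numbers, so a lack of safe variables becomes a
lack of large codes.

For fixed small Z and Z' an exponential moment bounds the number of safe variables from below; a
union bound over all pairs shows that γn variables are always safe, with γ = W²/k and W = k ^ (ε/8).
A treated clause with too few safe candidates then has, up to powers of k, probability at most 2⁻ᵏ
exp(-W²/8). So at most 6νn variables, with ν = exp(-W), are ever suspected of having been added
while unsafe; they form the set `suspects`, called Y below.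

Each pass treats a new clause. By `treated_cases` such a clause has lost two positive literals at
once (`Close`), or has a variable from Y at a literal that was true while all other positive
literals but one have low codes (`Hits`), or is an all-negative clause that put an element of Y into
Z. As Y depends on the formula, `Hits` is bounded for all small sets simultaneously. Since ν is far
below the powers of k involved, fewer than n k⁻¹²/3 passes take place, and each adds at most three
variables. -/

namespace FixSat

/-! ### Enumerations of the variables with prescribed first and last elements. -/

section Enumerations

variable {n : ℕ}

/-- A permutation that sends the elements of a list to their indices and agrees with `σ` on the
other elements wherever this is possible. -/
theorem exists_perm_idxOf_eq (w : List (Fin n)) (hw : w.Nodup) (σ : Equiv.Perm (Fin n)) :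
    ∃ e : Equiv.Perm (Fin n), (∀ x ∈ w, (e x).val = w.idxOf x) ∧
      ∀ x, x ∉ w → w.length ≤ (σ x).val → e x = σ x := by
  classical
  have hlen : w.length ≤ n := by simpa using hw.length_le_card
  -- On `w` the values are below `w.length`, on the rest of `s` at least `w.length`, so there is no
  -- collision; the remaining elements go wherever there is room.
  let s : Finset (Fin n) := Finset.univ.filter fun x => x ∈ w ∨ w.length ≤ (σ x).val
  let f : Fin n → Fin n := fun x =>
    if h : x ∈ w then ⟨w.idxOf x, (List.idxOf_lt_length_of_mem h).trans_le hlen⟩ else σ x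
  have hf : Set.InjOn f s := by
    intro x hx y hy hxy
    have hx' : x ∈ w ∨ w.length ≤ (σ x).val := by simpa [s] using hx
    have hy' : y ∈ w ∨ w.length ≤ (σ y).val := by simpa [s] using hy
    by_cases h1 : x ∈ w <;> by_cases h2 : y ∈ w
    · simp only [f, h1, h2, dif_pos, Fin.mk.injEq] at hxy
      exact (List.idxOf_inj h1).mp hxy
    · have h3 := hy'.resolve_left h2
      have h4 := List.idxOf_lt_length_of_mem h1
      simp only [f, h1, h2, dif_pos, dif_neg, not_false_eq_true] at hxy
      have := congrArg Fin.val hxy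
      simp only at this
      omega
    · have h3 := hx'.resolve_left h1
      have h4 := List.idxOf_lt_length_of_mem h2
      simp only [f, h1, h2, dif_pos, dif_neg, not_false_eq_true] at hxy
      have := congrArg Fin.val hxy
      simp only at this
      omega
    · simp only [f, h1, h2, dif_neg, not_false_eq_true] at hxy
      exact σ.injective hxy
  obtain ⟨g, hg⟩ := Finset.exists_equiv_extend_of_card_eq (t := (Finset.univ : Finset (Fin n)))
    (by simp) (s := s) (f := f) (Finset.subset_univ _) hf
  refine ⟨g.trans (Equiv.subtypeUnivEquiv fun x => Finset.mem_univ x), fun x hx => ?_,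
    fun x hx hl => ?_⟩
  · have := hg x (by simp [s, hx])
    simp [Equiv.trans_apply, this, f, hx]
  · have := hg x (by simp [s, hl])
    simp [Equiv.trans_apply, this, f, hx]

/-- A permutation that sends the elements of a list to their indices and the elements of a set
disjoint from it to the largest indices. -/
theorem exists_perm_last (w : List (Fin n)) (hw : w.Nodup) (S : Finset (Fin n))
    (hS : ∀ x ∈ S, x ∉ w) :
    ∃ e : Equiv.Perm (Fin n), (∀ x ∈ w, (e x).val = w.idxOf x) ∧
      ∀ x, n - S.card ≤ (e x).val → x ∈ S := by
  classical
  have hcard : w.length + S.card ≤ n := by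
    have h1 : (w.toFinset ∪ S).card ≤ n := by simpa using Finset.card_le_univ (w.toFinset ∪ S)
    rw [Finset.card_union_of_disjoint, List.toFinset_card_of_nodup hw] at h1
    · exact h1
    · rw [Finset.disjoint_left]
      intro x hx hx'
      exact hS x hx' (List.mem_toFinset.mp hx)
  have hSl : S.toList.length = S.card := Finset.length_toList S
  let f : Fin n → Fin n := fun x =>
    if h : x ∈ w then ⟨w.idxOf x, by have := List.idxOf_lt_length_of_mem h; omega⟩
    else if h' : x ∈ S then ⟨n - S.card + S.toList.idxOf x, by
      have := List.idxOf_lt_length_of_mem (Finset.mem_toList.mpr h'); omega⟩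
    else x
  have hfw : ∀ x ∈ w, (f x).val = w.idxOf x := fun x hx => by simp [f, hx]
  have hfS : ∀ x ∈ S, (f x).val = n - S.card + S.toList.idxOf x := fun x hx => by
    simp [f, hx, hS x hx]
  have hf : Set.InjOn f (w.toFinset ∪ S : Finset (Fin n)) := by
    intro x hx y hy hxy
    have hx' : x ∈ w ∨ x ∈ S := by simpa using hx
    have hy' : y ∈ w ∨ y ∈ S := by simpa using hy
    have hv := congrArg Fin.val hxy
    rcases hx' with h1 | h1 <;> rcases hy' with h2 | h2
    · rw [hfw x h1, hfw y h2] at hv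
      exact (List.idxOf_inj h1).mp hv
    · rw [hfw x h1, hfS y h2] at hv
      have h4 := List.idxOf_lt_length_of_mem h1
      omega
    · rw [hfS x h1, hfw y h2] at hv
      have h4 := List.idxOf_lt_length_of_mem h2
      omega
    · rw [hfS x h1, hfS y h2] at hv
      exact (List.idxOf_inj (Finset.mem_toList.mpr h1)).mp (by omega)
  obtain ⟨g, hg⟩ := Finset.exists_equiv_extend_of_card_eq (t := (Finset.univ : Finset (Fin n)))
    (by simp) (s := w.toFinset ∪ S) (f := f) (Finset.subset_univ _) hf
  have he : ∀ x, x ∈ w ∨ x ∈ S →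
      (g.trans (Equiv.subtypeUnivEquiv fun x => Finset.mem_univ x)) x = f x := by
    intro x hx
    have := hg x (by simpa using hx)
    simpa [Equiv.trans_apply] using this
  refine ⟨g.trans (Equiv.subtypeUnivEquiv fun x => Finset.mem_univ x), fun x hx => ?_,
    fun x hx => ?_⟩
  · rw [he x (Or.inl hx), hfw x hx]
  · set e := g.trans (Equiv.subtypeUnivEquiv fun x => Finset.mem_univ x) with hedef
    have hlt := (e x).isLt
    have hi : (e x).val - (n - S.card) < S.toList.length := by omega
    have hmem : S.toList[(e x).val - (n - S.card)] ∈ S :=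
      Finset.mem_toList.mp (List.getElem_mem hi)
    have h2 : e (S.toList[(e x).val - (n - S.card)]) = e x := by
      apply Fin.ext
      rw [he _ (Or.inr hmem), hfS _ hmem, (Finset.nodup_toList S).idxOf_getElem]
      omega
    rw [← e.injective h2]
    exact hmem

open Classical in
/-- The enumeration of the variables for cells that are inspected for being the only true literal
of a clause: the excluded variables `w` come first, and the others keep their place under `σ` if
possible. -/
noncomputable def stableEnum (σ : Equiv.Perm (Fin n)) (w : List (Fin n)) : Equiv.Perm (Fin n) :=
  -- The lists used below are duplicate-free, so the default 1 never matters.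
  if h : w.Nodup then (exists_perm_idxOf_eq w h σ).choose else 1

open Classical in
/-- The enumeration of the variables for the cells of a clause under treatment: the excluded
variables `w` come first, the variables in `S` last. -/
noncomputable def lastEnum (w : List (Fin n)) (S : Finset (Fin n)) : Equiv.Perm (Fin n) :=
  if h : w.Nodup ∧ ∀ x ∈ S, x ∉ w then (exists_perm_last w h.1 S h.2).choose else 1

theorem stableEnum_mem (σ : Equiv.Perm (Fin n)) {w : List (Fin n)} (hw : w.Nodup) {x : Fin n}
    (hx : x ∈ w) : (stableEnum σ w x).val = w.idxOf x := by
  rw [stableEnum, dif_pos hw]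
  exact (exists_perm_idxOf_eq w hw σ).choose_spec.1 x hx

theorem stableEnum_notMem (σ : Equiv.Perm (Fin n)) {w : List (Fin n)} (hw : w.Nodup) {x : Fin n}
    (hx : x ∉ w) (h : w.length ≤ (σ x).val) : stableEnum σ w x = σ x := by
  rw [stableEnum, dif_pos hw]
  exact (exists_perm_idxOf_eq w hw σ).choose_spec.2 x hx h

theorem lastEnum_mem {w : List (Fin n)} {S : Finset (Fin n)} (hw : w.Nodup)
    (hS : ∀ x ∈ S, x ∉ w) {x : Fin n} (hx : x ∈ w) : (lastEnum w S x).val = w.idxOf x := by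
  rw [lastEnum, dif_pos ⟨hw, hS⟩]
  exact (exists_perm_last w hw S hS).choose_spec.1 x hx

theorem mem_of_le_lastEnum {w : List (Fin n)} {S : Finset (Fin n)} (hw : w.Nodup)
    (hS : ∀ x ∈ S, x ∉ w) {x : Fin n} (hx : n - S.card ≤ (lastEnum w S x).val) : x ∈ S := by
  rw [lastEnum, dif_pos ⟨hw, hS⟩] at hx
  exact (exists_perm_last w hw S hS).choose_spec.2 x hx

/-- A permutation sending the elements of `w` to their indices sends no other element to an index
of a prefix of `w`. -/
theorem mem_of_perm_lt {e : Equiv.Perm (Fin n)} {w v : List (Fin n)} (hw : w.Nodup)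
    (he : ∀ x ∈ w, (e x).val = w.idxOf x) (hv : v <+: w) {x : Fin n}
    (hx : (e x).val < v.length) : x ∈ v := by
  have hi : (e x).val < w.length := hx.trans_le hv.length_le
  have h1 : e (w[(e x).val]) = e x := by
    apply Fin.ext
    rw [he _ (List.getElem_mem hi), hw.idxOf_getElem]
  rw [← e.injective h1, ← hv.getElem hx]
  exact List.getElem_mem hx

theorem idxOf_of_prefix {w v : List (Fin n)} (hv : v <+: w) {x : Fin n} (hx : x ∈ v) :
    w.idxOf x = v.idxOf x := by
  obtain ⟨u, rfl⟩ := hv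
  exact List.idxOf_append_of_mem hx

end Enumerations

/-! ### Both phases on one time line, and the data that determine a step. -/

section PhaseTwo

variable {k n m : ℕ}

/-- The literal is false for sure: it is positive with a variable in `Z ∪ Z'`, or negative with a
variable outside `Z`. -/
abbrev FalseLit (Z Z' : Finset (Fin n)) (l : Lit n) : Prop :=
  (l.2 = true ∧ l.1 ∈ Z ∪ Z') ∨ (l.2 = false ∧ l.1 ∉ Z)

/-- The position `j` of clause `i` holds a positive literal, and all other positions hold literals
that are false for sure. -/
abbrev Critical (Φ : Formula k n m) (Z Z' : Finset (Fin n)) (i : Fin m) (j : Fin k) : Prop :=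
  (∀ j', j' ≠ j → FalseLit Z Z' (Φ i j')) ∧ (Φ i j).2 = true

theorem unsafe₂_iff (Φ : Formula k n m) (Z Z' : Finset (Fin n)) (x : Fin n) :
    Unsafe₂ Φ Z Z' x ↔ x ∈ Z ∪ Z' ∨ ∃ i j, Critical Φ Z Z' i j ∧ (Φ i j).1 = x := by
  refine or_congr Iff.rfl (exists_congr fun i => exists_congr fun j => ?_)
  rw [Critical, and_assoc]
  refine and_congr Iff.rfl ?_
  rw [Prod.ext_iff]
  exact and_comm

/-- This lets both phases share one notion of safety. In a Z-unique clause the critical position is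
that of the only positive literal outside Z. -/
theorem safe₁_iff (Φ : Formula k n m) (Z : Finset (Fin n)) (x : Fin n) :
    Safe₁ Φ Z x ↔ ¬ Unsafe₂ Φ Z ∅ x := by
  rw [unsafe₂_iff, not_or, Safe₁, Finset.union_empty]
  refine and_congr_right fun hx => not_congr ?_
  constructor
  · rintro ⟨i, ⟨h1, h2⟩, j, hj⟩
    obtain ⟨a, ha⟩ := Finset.card_eq_one.mp h1
    have hja : j = a := by
      have : j ∈ Finset.univ.filter fun j : Fin k => (Φ i j).2 = true ∧ (Φ i j).1 ∉ Z := by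
        simp [hj, hx]
      rw [ha] at this
      simpa using this
    refine ⟨i, j, ⟨fun j' hj' => ?_, by rw [hj]⟩, by rw [hj]⟩
    rw [FalseLit, Finset.union_empty]
    rcases hs : (Φ i j').2 with _ | _
    · exact Or.inr ⟨rfl, h2 j' hs⟩
    · refine Or.inl ⟨rfl, ?_⟩
      by_contra hn
      have : j' ∈ Finset.univ.filter fun j : Fin k => (Φ i j).2 = true ∧ (Φ i j).1 ∉ Z := by
        simp [hs, hn]
      rw [ha] at this
      exact hj' ((by simpa using this : j' = a).trans hja.symm)
  · rintro ⟨i, j, ⟨h1, h2⟩, rfl⟩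
    refine ⟨i, ⟨?_, fun j' hj' => ?_⟩, j, Prod.ext rfl h2⟩
    · rw [Finset.card_eq_one]
      refine ⟨j, Finset.ext fun j' => ?_⟩
      simp only [Finset.mem_filter, Finset.mem_univ, true_and, Finset.mem_singleton]
      constructor
      · rintro ⟨h3, h4⟩
        by_contra hne
        have := h1 j' hne
        rw [FalseLit, Finset.union_empty] at this
        rcases this with h | h
        · exact h4 h.2
        · rw [h3] at h; exact absurd h.1 (by simp)
      · rintro rfl
        exact ⟨h2, hx⟩
    · by_cases hne : j' = j
      · subst hne; exact hx
      · have := h1 j' hne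
        rcases this with h | h
        · rw [hj'] at h; exact absurd h.1 (by simp)
        · exact h.2

/-- The value of `Z'` after one more pass of the second phase. -/
noncomputable def nextZ' (Φ : Formula k n m) (Z Z' : Finset (Fin n)) : Finset (Fin n) :=
  if h : (queue Φ Z Z').Nonempty then
    Z' ∪ ((picks Φ Z Z' ((queue Φ Z Z').min' h)).map
      fun j => (Φ ((queue Φ Z Z').min' h) j).1).toFinset
  else Z'

/-- The set `Z` at time `t`, where the clauses are treated by the first phase at the times
`t < m` and the passes of the second phase take place from time `m` on. -/
def stZ (Φ : Formula k n m) (t : ℕ) : Finset (Fin n) :=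
  ((List.finRange m).take t).foldl (phase1Step Φ) ∅

/-- The set `Z'` at time `t`. -/
def stZ' (Φ : Formula k n m) (t : ℕ) : Finset (Fin n) := (phase2State Φ (t - m)).2

/-- The variables in `Z` or `Z'` at time `t`. -/
def stX (Φ : Formula k n m) (t : ℕ) : Finset (Fin n) := stZ Φ t ∪ stZ' Φ t

theorem stZ_zero (Φ : Formula k n m) : stZ Φ 0 = ∅ := by simp [stZ]

theorem stZ_succ (Φ : Formula k n m) {t : ℕ} (h : t < m) :
    stZ Φ (t + 1) = phase1Step Φ (stZ Φ t) ⟨t, h⟩ := by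
  rw [stZ, List.take_add_one, List.foldl_append]
  simp [stZ, h]

theorem stZ_of_le (Φ : Formula k n m) {t : ℕ} (h : m ≤ t) : stZ Φ t = phase1 Φ := by
  rw [stZ, List.take_of_length_le (by simpa using h), phase1]

theorem stZ'_of_le (Φ : Formula k n m) {t : ℕ} (h : t ≤ m) : stZ' Φ t = ∅ := by
  rw [stZ', Nat.sub_eq_zero_of_le h]
  rfl

theorem phase2State_succ_snd (Φ : Formula k n m) (u : ℕ) :
    (phase2State Φ (u + 1)).2 = nextZ' Φ (phase1 Φ) (phase2State Φ u).2 := by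
  have hs : phase2State Φ (u + 1) = phase2Step Φ (phase1 Φ) (phase2State Φ u) := by
    simp only [phase2State, Function.iterate_succ_apply']
  have hq := phase2State_fst Φ u
  rw [hs]
  generalize phase2State Φ u = s at hq
  obtain ⟨Q, Z'⟩ := s
  simp only at hq
  subst hq
  unfold phase2Step nextZ'
  split_ifs <;> rfl

theorem stZ'_succ (Φ : Formula k n m) {t : ℕ} (h : m ≤ t) :
    stZ' Φ (t + 1) = nextZ' Φ (stZ Φ t) (stZ' Φ t) := by
  rw [stZ_of_le Φ h, stZ', stZ', Nat.succ_sub h, phase2State_succ_snd]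

theorem subset_phase1Step (Φ : Formula k n m) (Z : Finset (Fin n)) (i : Fin m) :
    Z ⊆ phase1Step Φ Z i := by
  unfold phase1Step
  split_ifs
  · split
    · exact Finset.subset_insert _ _
    · exact Finset.subset_union_left
  · exact subset_rfl

theorem subset_nextZ' (Φ : Formula k n m) (Z Z' : Finset (Fin n)) : Z' ⊆ nextZ' Φ Z Z' := by
  unfold nextZ'
  split_ifs
  · exact Finset.subset_union_left
  · exact subset_rfl

theorem stZ_mono (Φ : Formula k n m) : Monotone (stZ Φ) := by
  refine monotone_nat_of_le_succ fun t => ?_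
  by_cases h : t < m
  · rw [stZ_succ Φ h]
    exact subset_phase1Step _ _ _
  · rw [stZ_of_le Φ (by omega : m ≤ t), stZ_of_le Φ (by omega : m ≤ t + 1)]

theorem stZ'_mono (Φ : Formula k n m) : Monotone (stZ' Φ) := by
  refine monotone_nat_of_le_succ fun t => ?_
  by_cases h : t < m
  · rw [stZ'_of_le Φ h.le]
    exact Finset.empty_subset _
  · rw [stZ'_succ Φ (by omega : m ≤ t)]
    exact subset_nextZ' _ _ _

theorem stX_mono (Φ : Formula k n m) : Monotone (stX Φ) := fun _ _ h =>
  Finset.union_subset_union (stZ_mono Φ h) (stZ'_mono Φ h)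

theorem stX_zero (Φ : Formula k n m) : stX Φ 0 = ∅ := by
  rw [stX, stZ_zero, stZ'_of_le Φ (Nat.zero_le _), Finset.union_empty]

open Classical in
/-- The clause that is treated at time `t`, if any. -/
noncomputable def treated (Φ : Formula k n m) (t : ℕ) : Option (Fin m) :=
  if h : t < m then
    if AllNegative Φ ⟨t, h⟩ ∧ ∀ j, (Φ ⟨t, h⟩ j).1 ∉ stZ Φ t then some ⟨t, h⟩ else none
  else if h : (queue Φ (stZ Φ t) (stZ' Φ t)).Nonempty then
    some ((queue Φ (stZ Φ t) (stZ' Φ t)).min' h)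
  else none

/-- The positions of a treated clause that are inspected: the first `⌈k/2⌉` in the first phase,
and the other ones in the second phase. -/
abbrev Inspected (Φ : Formula k n m) (t : ℕ) (i : Fin m) (j : Fin k) : Prop :=
  treated Φ t = some i ∧ (t < m ∧ j.val + 1 ≤ k₁ k ∨ m ≤ t ∧ k₁ k < j.val + 1)

/-- The set of safe variables at time `t`. -/
def safeSet (Φ : Formula k n m) (t : ℕ) : Finset (Fin n) :=
  Finset.univ.filter fun x => ¬ Unsafe₂ Φ (stZ Φ t) (stZ' Φ t) x

/-! ### Dependence on the inspected positions only -/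

/-- The formulas have the same signs and agree wherever one of them has a variable from `X`. -/
structure Agree (Φ Ψ : Formula k n m) (X : Finset (Fin n)) : Prop where
  sign : ∀ i j, (Φ i j).2 = (Ψ i j).2
  var : ∀ i j, Φ i j = Ψ i j ∨ ((Φ i j).1 ∉ X ∧ (Ψ i j).1 ∉ X)

namespace Agree

variable {Φ Ψ : Formula k n m} {X Z Z' : Finset (Fin n)}

theorem mem_iff (h : Agree Φ Ψ X) {A : Finset (Fin n)} (hA : A ⊆ X) (i : Fin m) (j : Fin k) :
    (Φ i j).1 ∈ A ↔ (Ψ i j).1 ∈ A := by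
  rcases h.var i j with h1 | h1
  · rw [h1]
  · exact ⟨fun h2 => absurd (hA h2) h1.1, fun h2 => absurd (hA h2) h1.2⟩

theorem critical_iff (h : Agree Φ Ψ (Z ∪ Z')) (i : Fin m) (j : Fin k) :
    Critical Φ Z Z' i j ↔ Critical Ψ Z Z' i j := by
  simp only [Critical, FalseLit, h.sign, h.mem_iff subset_rfl, h.mem_iff Finset.subset_union_left]

/-- Signs and the occurrences of Z ∪ Z' decide which positions are critical, but not which variables
stand there; safety needs this additional information. -/
theorem unsafe₂_iff (h : Agree Φ Ψ (Z ∪ Z'))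
    (hc : ∀ i j, Critical Φ Z Z' i j → Φ i j = Ψ i j) (x : Fin n) :
    Unsafe₂ Φ Z Z' x ↔ Unsafe₂ Ψ Z Z' x := by
  rw [FixSat.unsafe₂_iff, FixSat.unsafe₂_iff]
  refine or_congr Iff.rfl (exists_congr fun i => exists_congr fun j => ?_)
  rw [← h.critical_iff]
  exact and_congr_right fun hcr => by rw [hc i j hcr]

theorem active_iff (h : Agree Φ Ψ Z) (i : Fin m) :
    (AllNegative Φ i ∧ ∀ j, (Φ i j).1 ∉ Z) ↔ (AllNegative Ψ i ∧ ∀ j, (Ψ i j).1 ∉ Z) := by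
  simp only [AllNegative, h.sign, h.mem_iff subset_rfl]

theorem phase1Step_eq (h : Agree Φ Ψ Z) (hs : ∀ x, Safe₁ Φ Z x ↔ Safe₁ Ψ Z x) (i : Fin m)
    (hi : (AllNegative Φ i ∧ ∀ j, (Φ i j).1 ∉ Z) → ∀ j : Fin k, j.val + 1 ≤ k₁ k → Φ i j = Ψ i j) :
    phase1Step Φ Z i = phase1Step Ψ Z i := by
  unfold phase1Step
  by_cases ha : AllNegative Φ i ∧ ∀ j, (Φ i j).1 ∉ Z
  · rw [if_pos ha, if_pos ((h.active_iff i).mp ha)]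
    have hi' := hi ha
    have hf : (fun j : Fin k => decide (j.val + 1 < k₁ k ∧ Safe₁ Φ Z (Φ i j).1)) =
        fun j : Fin k => decide (j.val + 1 < k₁ k ∧ Safe₁ Ψ Z (Ψ i j).1) := by
      funext j
      apply decide_eq_decide.mpr
      refine and_congr_right fun hj => ?_
      rw [hi' j hj.le]
      exact hs _
    rw [hf]
    rcases hfind : (List.finRange k).find?
        (fun j : Fin k => decide (j.val + 1 < k₁ k ∧ Safe₁ Ψ Z (Ψ i j).1)) with _ | j
    · simp only
      congr 1
      refine Finset.image_congr fun j hj => ?_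
      rw [hi' j (by simpa using (Finset.mem_filter.mp hj).2.le)]
    · have := List.find?_some hfind
      have := (of_decide_eq_true this).1
      simp only
      rw [hi' j this.le]
  · rw [if_neg ha, if_neg fun h' => ha ((h.active_iff i).mpr h')]

theorem queue_eq (h : Agree Φ Ψ (Z ∪ Z')) : queue Φ Z Z' = queue Ψ Z Z' := by
  have ht : ∀ i j, (Φ i j).TrueUnder (sigma Z) ↔ (Ψ i j).TrueUnder (sigma Z) := by
    intro i j
    simp only [Lit.TrueUnder, sigma, h.sign]
    rw [decide_eq_decide.mpr (not_congr (h.mem_iff Finset.subset_union_left i j))]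
  simp only [queue, Endangered, ht, h.mem_iff Finset.subset_union_right]

theorem picks_eq (h : Agree Φ Ψ (Z ∪ Z')) (hs : ∀ x, Unsafe₂ Φ Z Z' x ↔ Unsafe₂ Ψ Z Z' x)
    (i : Fin m) (hi : ∀ j : Fin k, k₁ k < j.val + 1 → Φ i j = Ψ i j) :
    picks Φ Z Z' i = picks Ψ Z Z' i := by
  have h1 : (fun j : Fin k =>
        decide (k₁ k < j.val + 1 ∧ j.val + 1 + 5 ≤ k ∧ ¬ Unsafe₂ Φ Z Z' (Φ i j).1)) =
      fun j : Fin k =>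
        decide (k₁ k < j.val + 1 ∧ j.val + 1 + 5 ≤ k ∧ ¬ Unsafe₂ Ψ Z Z' (Ψ i j).1) := by
    funext j
    apply decide_eq_decide.mpr
    refine and_congr_right fun hj => and_congr_right fun _ => ?_
    rw [hi j hj]
    exact not_congr (hs _)
  have h2 : (fun j : Fin k => decide (k < j.val + 1 + 5 ∧ (Φ i j).1 ∉ Z')) =
      fun j : Fin k => decide (k < j.val + 1 + 5 ∧ (Ψ i j).1 ∉ Z') := by
    funext j
    apply decide_eq_decide.mpr
    rw [h.mem_iff Finset.subset_union_right]
  unfold picks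
  rw [h1, h2]

end Agree

theorem lt_of_mem_picks (hk : 10 ≤ k) {Φ : Formula k n m} {Z Z' : Finset (Fin n)} {i : Fin m}
    {j : Fin k} (hj : j ∈ picks Φ Z Z' i) : k₁ k < j.val + 1 := by
  unfold picks at hj
  simp only at hj
  split_ifs at hj
  · have := List.mem_of_mem_take hj
    exact (of_decide_eq_true (List.mem_filter.mp this).2).1
  · have := List.mem_of_mem_take hj
    have := (of_decide_eq_true (List.mem_filter.mp this).2).1
    unfold k₁
    omega

theorem Agree.nextZ'_eq (hk : 10 ≤ k) {Φ Ψ : Formula k n m} {Z Z' : Finset (Fin n)}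
    (h : Agree Φ Ψ (Z ∪ Z')) (hs : ∀ x, Unsafe₂ Φ Z Z' x ↔ Unsafe₂ Ψ Z Z' x)
    (hi : ∀ hQ : (queue Φ Z Z').Nonempty, ∀ j : Fin k, k₁ k < j.val + 1 →
      Φ ((queue Φ Z Z').min' hQ) j = Ψ ((queue Φ Z Z').min' hQ) j) :
    nextZ' Φ Z Z' = nextZ' Ψ Z Z' := by
  unfold nextZ'
  by_cases hQ : (queue Φ Z Z').Nonempty
  · have hQ' : (queue Ψ Z Z').Nonempty := h.queue_eq ▸ hQ
    rw [dif_pos hQ, dif_pos hQ']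
    have hmin : (queue Φ Z Z').min' hQ = (queue Ψ Z Z').min' hQ' := by
      congr 1
      exact h.queue_eq
    rw [← hmin, ← h.picks_eq hs _ (hi hQ)]
    congr 2
    refine List.map_congr_left fun j hj => ?_
    rw [hi hQ j (lt_of_mem_picks hk hj)]
  · rw [dif_neg hQ, dif_neg (by rwa [← h.queue_eq])]

theorem treated_eq_of_agree {Φ Ψ : Formula k n m} {t : ℕ} (hZ : stZ Φ t = stZ Ψ t)
    (hZ' : stZ' Φ t = stZ' Ψ t) (h : Agree Φ Ψ (stX Φ t)) : treated Φ t = treated Ψ t := by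
  classical
  unfold treated
  by_cases ht : t < m
  · rw [dif_pos ht, dif_pos ht]
    have h' : Agree Φ Ψ (stZ Φ t) := by
      have := stZ'_of_le Φ ht.le
      rw [stX, this, Finset.union_empty] at h
      exact h
    simp only [← hZ]
    exact if_congr (h'.active_iff _) rfl rfl
  · rw [dif_neg ht, dif_neg ht]
    have hq : queue Φ (stZ Φ t) (stZ' Φ t) = queue Ψ (stZ Ψ t) (stZ' Ψ t) := by
      rw [h.queue_eq, hZ, hZ']
    simp only [hq]

/-- A step uses three things only: the signs together with the occurrences of Z ∪ Z', the literals
in critical positions, which decide safety, and the inspected part of the treated clause. -/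
theorem state_succ_eq_of_agree (hk : 10 ≤ k) {Φ Ψ : Formula k n m} {t : ℕ}
    (hZ : stZ Φ t = stZ Ψ t) (hZ' : stZ' Φ t = stZ' Ψ t) (h : Agree Φ Ψ (stX Φ t))
    (hc : ∀ i j, Critical Φ (stZ Φ t) (stZ' Φ t) i j → Φ i j = Ψ i j)
    (hT : ∀ i j, Inspected Φ t i j → Φ i j = Ψ i j) :
    stZ Φ (t + 1) = stZ Ψ (t + 1) ∧ stZ' Φ (t + 1) = stZ' Ψ (t + 1) := by
  classical
  by_cases ht : t < m
  · refine ⟨?_, by rw [stZ'_of_le _ ht, stZ'_of_le _ ht]⟩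
    have h0 := stZ'_of_le Φ ht.le
    rw [stX, h0] at h
    rw [h0] at hc
    have hs := h.unsafe₂_iff hc
    rw [Finset.union_empty] at h
    rw [stZ_succ Φ ht, stZ_succ Ψ ht, ← hZ]
    refine h.phase1Step_eq (fun x => ?_) _ fun ha j hj => hT _ j ⟨?_, Or.inl ⟨ht, hj⟩⟩
    · rw [safe₁_iff, safe₁_iff, hs]
    · rw [treated, dif_pos ht, if_pos ha]
  · have ht' : m ≤ t := by omega
    refine ⟨by rw [stZ_of_le Φ (by omega), stZ_of_le Ψ (by omega), ← stZ_of_le Φ ht',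
      ← stZ_of_le Ψ ht', hZ], ?_⟩
    rw [stZ'_succ Φ ht', stZ'_succ Ψ ht', ← hZ, ← hZ']
    refine h.nextZ'_eq hk (h.unsafe₂_iff hc) fun hQ j hj => hT _ j ⟨?_, Or.inr ⟨ht', hj⟩⟩
    rw [treated, dif_neg ht, dif_pos hQ]

end PhaseTwo

/-! ### The encoding of a formula and its injectivity. -/

section Encoding

variable {k n m : ℕ}

/-- The variables in `Z ∪ Z'` at time `t` in the order in which they entered. -/
noncomputable def excluded (Φ : Formula k n m) : ℕ → List (Fin n)
  | 0 => []
  -- The order within a batch is arbitrary but depends on the set only, so two runs with the same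
  -- sets produce the same list.
  | t + 1 => excluded Φ t ++ (stX Φ (t + 1) \ stX Φ t).toList

theorem excluded_spec (Φ : Formula k n m) (t : ℕ) :
    (excluded Φ t).Nodup ∧ ∀ x, x ∈ excluded Φ t ↔ x ∈ stX Φ t := by
  induction t with
  | zero => simp [excluded, stX_zero]
  | succ t ih =>
    refine ⟨?_, fun x => ?_⟩
    · rw [excluded, List.nodup_append']
      refine ⟨ih.1, Finset.nodup_toList _, fun x hx hx' => ?_⟩
      exact (Finset.mem_sdiff.mp (Finset.mem_toList.mp hx')).2 ((ih.2 x).mp hx)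
    · have := @stX_mono k n m Φ t (t + 1) (Nat.le_succ t) x
      rw [excluded, List.mem_append, ih.2, Finset.mem_toList, Finset.mem_sdiff]
      tauto

theorem excluded_nodup (Φ : Formula k n m) (t : ℕ) : (excluded Φ t).Nodup := (excluded_spec Φ t).1

theorem mem_excluded {Φ : Formula k n m} {t : ℕ} {x : Fin n} : x ∈ excluded Φ t ↔ x ∈ stX Φ t :=
  (excluded_spec Φ t).2 x

theorem length_excluded (Φ : Formula k n m) (t : ℕ) :
    (excluded Φ t).length = (stX Φ t).card := by
  rw [← List.toFinset_card_of_nodup (excluded_nodup Φ t)]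
  congr 1
  ext x
  rw [List.mem_toFinset, mem_excluded]

theorem excluded_prefix (Φ : Formula k n m) {s t : ℕ} (h : s ≤ t) :
    excluded Φ s <+: excluded Φ t := by
  induction t, h using Nat.le_induction with
  | base => exact List.prefix_rfl
  | succ t _ ih => exact ih.trans (List.prefix_append _ _)

theorem excluded_congr {Φ Ψ : Formula k n m} {t : ℕ} (h : ∀ s ≤ t, stX Φ s = stX Ψ s) :
    excluded Φ t = excluded Ψ t := by
  induction t with
  | zero => rfl
  | succ t ih =>
    rw [excluded, excluded, ih fun s hs => h s (by omega), h t (by omega), h (t + 1) le_rfl]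

/-- The variable in position `j` of clause `i` is looked at, at time `t`. -/
abbrev Revealed (Φ : Formula k n m) (t : ℕ) (i : Fin m) (j : Fin k) : Prop :=
  Critical Φ (stZ Φ t) (stZ' Φ t) i j ∨ Inspected Φ t i j

open Classical in
/-- The first time at which the variable in position `j` of clause `i` is looked at, but at
most `N`. -/
noncomputable def revealTime (Φ : Formula k n m) (N : ℕ) (i : Fin m) (j : Fin k) : ℕ :=
  Nat.find (⟨N, Or.inr le_rfl⟩ : ∃ t, Revealed Φ t i j ∨ N ≤ t)

theorem revealTime_spec (Φ : Formula k n m) (N : ℕ) (i : Fin m) (j : Fin k) :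
    Revealed Φ (revealTime Φ N i j) i j ∨ N ≤ revealTime Φ N i j := by
  classical
  exact Nat.find_spec (⟨N, Or.inr le_rfl⟩ : ∃ t, Revealed Φ t i j ∨ N ≤ t)

theorem le_revealTime_iff {Φ : Formula k n m} {N t : ℕ} {i : Fin m} {j : Fin k} :
    t ≤ revealTime Φ N i j ↔ t ≤ N ∧ ∀ s < t, ¬ Revealed Φ s i j := by
  classical
  rw [revealTime, Nat.le_find_iff]
  constructor
  · intro h
    refine ⟨?_, fun s hs hr => h s hs (Or.inl hr)⟩
    by_contra hlt
    exact h N (by omega) (Or.inr le_rfl)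
  · rintro ⟨h1, h2⟩ s hs (h3 | h3)
    · exact h2 s hs h3
    · omega

open Classical in
/-- The enumeration of the variables that is used for a position looked at, at time `t`. -/
noncomputable def enumAt (σ : Equiv.Perm (Fin n)) (Φ : Formula k n m) (t : ℕ) (i : Fin m)
    (j : Fin k) : Equiv.Perm (Fin n) :=
  -- `lastEnum` needs the safe set, which is known only after the critical positions have been
  -- decoded. These must therefore use `stableEnum`, which needs the excluded list only.
  if Inspected Φ t i j ∧ ¬ Critical Φ (stZ Φ t) (stZ' Φ t) i j then
    lastEnum (excluded Φ t) (safeSet Φ t)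
  else stableEnum σ (excluded Φ t)

/-- The formula with the same signs in which every variable is replaced by its number in the
enumeration that belongs to the time when it is looked at first. -/
noncomputable def encode (σ : Equiv.Perm (Fin n)) (N : ℕ) (Φ : Formula k n m) : Formula k n m :=
  fun i j => (enumAt σ Φ (revealTime Φ N i j) i j (Φ i j).1, (Φ i j).2)

theorem notMem_excluded_of_mem_safeSet (Φ : Formula k n m) (t : ℕ) :
    ∀ x ∈ safeSet Φ t, x ∉ excluded Φ t := by
  intro x hx hx'
  exact (Finset.mem_filter.mp hx).2 (Or.inl (mem_excluded.mp hx'))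

theorem enumAt_mem (σ : Equiv.Perm (Fin n)) (Φ : Formula k n m) (t : ℕ) (i : Fin m) (j : Fin k) :
    ∀ x ∈ excluded Φ t, (enumAt σ Φ t i j x).val = (excluded Φ t).idxOf x := by
  intro x hx
  unfold enumAt
  split_ifs
  · exact lastEnum_mem (excluded_nodup Φ t) (notMem_excluded_of_mem_safeSet Φ t) hx
  · exact stableEnum_mem σ (excluded_nodup Φ t) hx

theorem encode_snd (σ : Equiv.Perm (Fin n)) (N : ℕ) (Φ : Formula k n m) (i : Fin m) (j : Fin k) :
    (encode σ N Φ i j).2 = (Φ i j).2 := rfl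

/-- Later excluded lists extend earlier ones, so a variable of `stX Φ t` has the same number in
every enumeration used from time t on. -/
theorem encode_eq_idxOf {σ : Equiv.Perm (Fin n)} {N t : ℕ} {Φ : Formula k n m} {i : Fin m}
    {j : Fin k} (ht : t ≤ revealTime Φ N i j) (hx : (Φ i j).1 ∈ stX Φ t) :
    (encode σ N Φ i j).1.val = (excluded Φ t).idxOf (Φ i j).1 := by
  have hp := excluded_prefix Φ ht
  have hx' := mem_excluded.mpr hx
  rw [encode, enumAt_mem σ Φ _ i j _ (hp.subset hx'), idxOf_of_prefix hp hx']

theorem encode_lt_of_mem {σ : Equiv.Perm (Fin n)} {N t : ℕ} {Φ : Formula k n m} {i : Fin m}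
    {j : Fin k} (ht : t ≤ revealTime Φ N i j) (hx : (Φ i j).1 ∈ stX Φ t) :
    (encode σ N Φ i j).1.val < (stX Φ t).card := by
  rw [encode_eq_idxOf ht hx, ← length_excluded]
  exact List.idxOf_lt_length_of_mem (mem_excluded.mpr hx)

/-- The numbers below `(stX Φ t).card` are used up by the variables of `stX Φ t`. -/
theorem mem_of_encode_lt {σ : Equiv.Perm (Fin n)} {N t : ℕ} {Φ : Formula k n m} {i : Fin m}
    {j : Fin k} (ht : t ≤ revealTime Φ N i j)
    (hx : (encode σ N Φ i j).1.val < (stX Φ t).card) : (Φ i j).1 ∈ stX Φ t := by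
  rw [← length_excluded] at hx
  exact mem_excluded.mp (mem_of_perm_lt (excluded_nodup Φ _)
    (enumAt_mem σ Φ (revealTime Φ N i j) i j) (excluded_prefix Φ ht) hx)

/-- The states up to time `t` coincide, and so do the positions looked at before time `t` and their
contents. -/
structure SameUpTo (Φ Ψ : Formula k n m) (t : ℕ) : Prop where
  stZ_eq : ∀ s ≤ t, stZ Φ s = stZ Ψ s
  stZ'_eq : ∀ s ≤ t, stZ' Φ s = stZ' Ψ s
  revealed_iff : ∀ s < t, ∀ i j, Revealed Φ s i j ↔ Revealed Ψ s i j
  eq_of_revealed : ∀ s < t, ∀ i j, Revealed Φ s i j → Φ i j = Ψ i j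

namespace SameUpTo

variable {Φ Ψ : Formula k n m} {t N : ℕ} {σ : Equiv.Perm (Fin n)}

theorem stX_eq (h : SameUpTo Φ Ψ t) {s : ℕ} (hs : s ≤ t) : stX Φ s = stX Ψ s := by
  rw [stX, stX, h.stZ_eq s hs, h.stZ'_eq s hs]

theorem excluded_eq (h : SameUpTo Φ Ψ t) : excluded Φ t = excluded Ψ t :=
  excluded_congr fun _ hs => h.stX_eq hs

theorem le_revealTime (h : SameUpTo Φ Ψ t) {i : Fin m} {j : Fin k} :
    t ≤ revealTime Φ N i j ↔ t ≤ revealTime Ψ N i j := by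
  rw [le_revealTime_iff, le_revealTime_iff]
  refine and_congr_right fun _ => forall_congr' fun s => forall_congr' fun hs => ?_
  rw [h.revealed_iff s hs]

theorem eq_of_revealTime_lt (h : SameUpTo Φ Ψ t) (ht : t ≤ N) {i : Fin m} {j : Fin k}
    (hr : revealTime Φ N i j < t) : Φ i j = Ψ i j := by
  rcases revealTime_spec Φ N i j with h1 | h1
  · exact h.eq_of_revealed _ hr i j h1
  · omega

/-- At a position not yet looked at, a code below the length of the common excluded list determines
the variable, and any other code says that the variable is not excluded, in both formulas. -/
theorem agree (h : SameUpTo Φ Ψ t) (ht : t ≤ N) (he : encode σ N Φ = encode σ N Ψ) :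
    Agree Φ Ψ (stX Φ t) := by
  have hsign : ∀ i j, (Φ i j).2 = (Ψ i j).2 := fun i j => by
    rw [← encode_snd σ N Φ, he, encode_snd]
  refine ⟨hsign, fun i j => ?_⟩
  rcases lt_or_ge (revealTime Φ N i j) t with hr | hr
  · exact Or.inl (h.eq_of_revealTime_lt ht hr)
  · have hr' := h.le_revealTime.mp hr
    by_cases hx : (Φ i j).1 ∈ stX Φ t
    · left
      have h1 := encode_eq_idxOf (σ := σ) hr hx
      have h2 := encode_lt_of_mem (σ := σ) hr hx
      rw [he, h.stX_eq le_rfl] at h2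
      have h3 := mem_of_encode_lt hr' h2
      have h4 := encode_eq_idxOf (σ := σ) hr' h3
      rw [he, h4, ← h.excluded_eq] at h1
      refine Prod.ext ?_ (hsign i j)
      refine ((List.idxOf_inj ?_).mp h1).symm
      rw [mem_excluded, h.stX_eq le_rfl]
      exact h3
    · refine Or.inr ⟨hx, fun hx' => hx ?_⟩
      have h2 := encode_lt_of_mem (σ := σ) hr' (h.stX_eq le_rfl ▸ hx')
      rw [← he, ← h.stX_eq le_rfl] at h2
      exact mem_of_encode_lt hr h2

theorem critical_iff (h : SameUpTo Φ Ψ t) (ht : t ≤ N) (he : encode σ N Φ = encode σ N Ψ)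
    (i : Fin m) (j : Fin k) :
    Critical Φ (stZ Φ t) (stZ' Φ t) i j ↔ Critical Ψ (stZ Ψ t) (stZ' Ψ t) i j := by
  rw [(h.agree ht he).critical_iff, h.stZ_eq t le_rfl, h.stZ'_eq t le_rfl]

theorem inspected_iff (h : SameUpTo Φ Ψ t) (ht : t ≤ N) (he : encode σ N Φ = encode σ N Ψ)
    (i : Fin m) (j : Fin k) : Inspected Φ t i j ↔ Inspected Ψ t i j := by
  rw [Inspected, treated_eq_of_agree (h.stZ_eq t le_rfl) (h.stZ'_eq t le_rfl) (h.agree ht he)]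

/-- Two positions agree if the same enumeration is used for them. -/
theorem eq_of_enumAt_eq (h : SameUpTo Φ Ψ t) (ht : t ≤ N) (he : encode σ N Φ = encode σ N Ψ)
    {i : Fin m} {j : Fin k} (hr : Revealed Φ t i j ∨ t = N)
    (hE : enumAt σ Φ t i j = enumAt σ Ψ t i j) : Φ i j = Ψ i j := by
  rcases lt_or_ge (revealTime Φ N i j) t with hlt | hge
  · exact h.eq_of_revealTime_lt ht hlt
  · have hr' : Revealed Ψ t i j ∨ t = N := by
      rcases hr with hr | hr
      · rw [Revealed, h.critical_iff ht he, h.inspected_iff ht he] at hr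
        exact Or.inl hr
      · exact Or.inr hr
    have hge' := h.le_revealTime.mp hge
    have key : ∀ Θ : Formula k n m, t ≤ revealTime Θ N i j → (Revealed Θ t i j ∨ t = N) →
        revealTime Θ N i j = t := by
      intro Θ h1 h2
      refine le_antisymm ?_ h1
      by_contra h3
      have h4 := (le_revealTime_iff (t := t + 1)).mp (by omega : t + 1 ≤ revealTime Θ N i j)
      rcases h2 with h2 | h2
      · exact h4.2 t (Nat.lt_succ_self t) h2
      · omega
    have e1 := congrFun (congrFun he i) j
    simp only [encode, key Φ hge hr, key Ψ hge' hr', hE, Prod.mk.injEq,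
      EmbeddingLike.apply_eq_iff_eq] at e1
    exact Prod.ext e1.1 e1.2

/-- First stage of decoding a time step: the enumeration of a critical position depends on σ and the
excluded list alone. -/
theorem eq_of_critical (h : SameUpTo Φ Ψ t) (ht : t ≤ N) (he : encode σ N Φ = encode σ N Ψ)
    {i : Fin m} {j : Fin k} (hc : Critical Φ (stZ Φ t) (stZ' Φ t) i j) : Φ i j = Ψ i j := by
  refine h.eq_of_enumAt_eq ht he (Or.inl (Or.inl hc)) ?_
  rw [enumAt, enumAt, if_neg fun h' => h'.2 hc,
    if_neg fun h' => h'.2 ((h.critical_iff ht he i j).mp hc), h.excluded_eq]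

/-- Second stage: with the critical positions decoded, the safe sets coincide and so do all
enumerations. The case t = N decodes the positions not looked at before time N. -/
theorem eq_of_revealed_or (h : SameUpTo Φ Ψ t) (ht : t ≤ N) (he : encode σ N Φ = encode σ N Ψ)
    {i : Fin m} {j : Fin k} (hr : Revealed Φ t i j ∨ t = N) : Φ i j = Ψ i j := by
  refine h.eq_of_enumAt_eq ht he hr ?_
  have hs : safeSet Φ t = safeSet Ψ t := by
    unfold safeSet
    refine Finset.filter_congr fun x _ => not_congr ?_
    rw [(h.agree ht he).unsafe₂_iff fun i j => h.eq_of_critical ht he, h.stZ_eq t le_rfl,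
      h.stZ'_eq t le_rfl]
  rw [enumAt, enumAt, h.excluded_eq, hs]
  exact if_congr (and_congr (h.inspected_iff ht he i j)
    (not_congr (h.critical_iff ht he i j))) rfl rfl

theorem succ (hk : 10 ≤ k) (h : SameUpTo Φ Ψ t) (ht : t ≤ N)
    (he : encode σ N Φ = encode σ N Ψ) : SameUpTo Φ Ψ (t + 1) := by
  have hs := state_succ_eq_of_agree hk (h.stZ_eq t le_rfl) (h.stZ'_eq t le_rfl) (h.agree ht he)
    (fun i j => h.eq_of_critical ht he)
    (fun i j hT => h.eq_of_revealed_or ht he (Or.inl (Or.inr hT)))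
  refine ⟨fun s hs' => ?_, fun s hs' => ?_, fun s hs' i j => ?_, fun s hs' i j hr => ?_⟩
  · rcases Nat.le_succ_iff.mp hs' with h1 | rfl
    · exact h.stZ_eq s h1
    · exact hs.1
  · rcases Nat.le_succ_iff.mp hs' with h1 | rfl
    · exact h.stZ'_eq s h1
    · exact hs.2
  · rcases Nat.lt_succ_iff_lt_or_eq.mp hs' with h1 | rfl
    · exact h.revealed_iff s h1 i j
    · rw [Revealed, h.critical_iff ht he, h.inspected_iff ht he]
  · rcases Nat.lt_succ_iff_lt_or_eq.mp hs' with h1 | rfl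
    · exact h.eq_of_revealed s h1 i j hr
    · exact h.eq_of_revealed_or ht he (Or.inl hr)

end SameUpTo

/-- A formula can be recovered from its encoding. -/
theorem encode_injective (hk : 10 ≤ k) (σ : Equiv.Perm (Fin n)) (N : ℕ) :
    Function.Injective (encode σ N : Formula k n m → Formula k n m) := by
  intro Φ Ψ he
  have h : ∀ t ≤ N, SameUpTo Φ Ψ t := by
    intro t
    induction t with
    | zero =>
      intro _
      refine ⟨fun s hs => ?_, fun s hs => ?_, fun s hs => by omega, fun s hs => by omega⟩
      · obtain rfl : s = 0 := by omega
        rw [stZ_zero, stZ_zero]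
      · obtain rfl : s = 0 := by omega
        rw [stZ'_of_le _ (Nat.zero_le _), stZ'_of_le _ (Nat.zero_le _)]
    | succ t ih => exact fun ht => (ih (by omega)).succ hk (by omega) he
  funext i j
  exact (h N le_rfl).eq_of_revealed_or le_rfl he (Or.inr rfl)

end Encoding

/-! ### Consequences of the run for the codes of treated clauses. -/

section Structure

variable {k n m : ℕ}

/-! ### What happens at one time step -/

theorem treated_of_lt {Φ : Formula k n m} {t : ℕ} {i : Fin m} (ht : t < m)
    (h : treated Φ t = some i) :
    i.val = t ∧ AllNegative Φ i ∧ ∀ j, (Φ i j).1 ∉ stZ Φ t := by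
  classical
  rw [treated, dif_pos ht] at h
  split_ifs at h with ha
  cases h
  exact ⟨rfl, ha⟩

theorem treated_of_ge {Φ : Formula k n m} {t : ℕ} {i : Fin m} (ht : m ≤ t)
    (h : treated Φ t = some i) : i ∈ queue Φ (stZ Φ t) (stZ' Φ t) ∧
      stZ' Φ (t + 1) = stZ' Φ t ∪
        ((picks Φ (stZ Φ t) (stZ' Φ t) i).map fun j => (Φ i j).1).toFinset := by
  classical
  rw [treated, dif_neg (by omega)] at h
  split_ifs at h with ha
  cases h
  exact ⟨Finset.min'_mem _ _, by rw [stZ'_succ Φ ht, nextZ', dif_pos ha]⟩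

theorem stZ'_succ_of_none {Φ : Formula k n m} {t : ℕ} (ht : m ≤ t) (h : treated Φ t = none) :
    stZ' Φ (t + 1) = stZ' Φ t := by
  classical
  rw [treated, dif_neg (by omega)] at h
  split_ifs at h with ha
  rw [stZ'_succ Φ ht, nextZ', dif_neg ha]

theorem length_picks_le (Φ : Formula k n m) (Z Z' : Finset (Fin n)) (i : Fin m) :
    (picks Φ Z Z' i).length ≤ 3 := by
  unfold picks
  simp only
  split_ifs <;> exact List.length_take_le _ _

theorem nodup_picks (Φ : Formula k n m) (Z Z' : Finset (Fin n)) (i : Fin m) :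
    (picks Φ Z Z' i).Nodup := by
  unfold picks
  simp only
  split_ifs <;>
    exact ((List.nodup_finRange k).filter _).sublist (List.take_sublist _ _)

/-- A clause in the queue has at most two positions with variables from Z', so at least three of its
last five positions qualify. -/
theorem length_picks (hk : 5 ≤ k) {Φ : Formula k n m} {Z Z' : Finset (Fin n)} {i : Fin m}
    (hi : i ∈ queue Φ Z Z') : (picks Φ Z Z' i).length = 3 := by
  unfold picks
  simp only
  split_ifs with h
  · rw [List.length_take]
    exact min_eq_left h
  · rw [List.length_take]
    refine min_eq_left ?_
    have hc := (Finset.mem_filter.mp hi).2.2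
    rw [← List.toFinset_card_of_nodup ((List.nodup_finRange k).filter _)]
    have h5 : 5 ≤ (Finset.univ.filter fun j : Fin k => k < j.val + 1 + 5).card := by
      have : ((Finset.univ : Finset (Fin 5)).image
          fun a => (⟨k - 1 - a.val, by omega⟩ : Fin k)).card = 5 := by
        rw [Finset.card_image_of_injective]
        · simp
        · intro a b hab
          simp only [Fin.mk.injEq] at hab
          have := a.isLt
          have := b.isLt
          exact Fin.ext (by omega)
      rw [← this]
      refine Finset.card_le_card fun j hj => ?_
      simp only [Finset.mem_image, Finset.mem_univ, true_and] at hj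
      obtain ⟨a, rfl⟩ := hj
      have := a.isLt
      simp only [Finset.mem_filter, Finset.mem_univ, true_and]
      omega
    have hsub : (Finset.univ.filter fun j : Fin k => k < j.val + 1 + 5) ⊆
        ((List.finRange k).filter fun j =>
          decide (k < j.val + 1 + 5 ∧ (Φ i j).1 ∉ Z')).toFinset ∪
        Finset.univ.filter fun j : Fin k => (Φ i j).1 ∈ Z' := by
      intro j hj
      have hj' := (Finset.mem_filter.mp hj).2
      by_cases hz : (Φ i j).1 ∈ Z'
      · simp [hz]
      · simp [hz, hj']
    have h1 := (Finset.card_le_card hsub).trans (Finset.card_union_le _ _)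
    omega

/-- The bound 3 on the growth is what brings the codes of literals lost simultaneously within
distance 2. -/
theorem card_stX_succ_le (Φ : Formula k n m) (t : ℕ) :
    (stX Φ (t + 1)).card ≤ (stX Φ t).card + 3 := by
  by_cases ht : t < m
  · rw [stX, stX, stZ'_of_le Φ ht, stZ'_of_le Φ ht.le, Finset.union_empty, Finset.union_empty,
      stZ_succ Φ ht]
    unfold phase1Step
    split_ifs
    · split
      · have := Finset.card_insert_le (Φ ⟨t, ht⟩ ‹Fin k›).1 (stZ Φ t)
        omega
      · refine (Finset.card_union_le _ _).trans (Nat.add_le_add_left ?_ _)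
        refine Finset.card_image_le.trans ((Finset.card_le_one.mpr ?_).trans (by norm_num))
        intro a ha b hb
        have h1 := (Finset.mem_filter.mp ha).2
        have h2 := (Finset.mem_filter.mp hb).2
        exact Fin.ext (by omega)
    · omega
  · have ht' : m ≤ t := by omega
    have hZ : stZ Φ (t + 1) = stZ Φ t := by rw [stZ_of_le Φ ht', stZ_of_le Φ (by omega)]
    rcases h : treated Φ t with _ | i
    · rw [stX, hZ, stZ'_succ_of_none ht' h]
      exact Nat.le_add_right _ _
    · rw [stX, hZ, (treated_of_ge ht' h).2, ← Finset.union_assoc]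
      refine (Finset.card_union_le _ _).trans (Nat.add_le_add_left ?_ _)
      refine (List.toFinset_card_le _).trans ?_
      rw [List.length_map]
      exact length_picks_le _ _ _ _

/-- Only an all-negative clause can enlarge Z, and by one variable at most. This bounds |Z| by a
count over independent clauses. -/
theorem card_phase1_le (Φ : Formula k n m) {t : ℕ} (ht : t ≤ m) :
    (stZ Φ t).card ≤ (Finset.univ.filter fun i : Fin m => AllNegative Φ i ∧ i.val < t).card := by
  classical
  induction t with
  | zero => simp [stZ_zero]
  | succ t ih =>
    have ih := ih (by omega)
    have hlt : t < m := ht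
    rw [stZ_succ Φ hlt]
    by_cases ha : AllNegative Φ ⟨t, hlt⟩
    · have h1 : (phase1Step Φ (stZ Φ t) ⟨t, hlt⟩).card ≤ (stZ Φ t).card + 1 := by
        unfold phase1Step
        split_ifs
        · split
          · exact Finset.card_insert_le _ _
          · refine (Finset.card_union_le _ _).trans (Nat.add_le_add_left ?_ _)
            refine Finset.card_image_le.trans (Finset.card_le_one.mpr ?_)
            intro a ha b hb
            have h1 := (Finset.mem_filter.mp ha).2
            have h2 := (Finset.mem_filter.mp hb).2
            exact Fin.ext (by omega)
        · omega
      have h2 : insert ⟨t, hlt⟩ (Finset.univ.filter fun i : Fin m => AllNegative Φ i ∧ i.val < t) ⊆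
          Finset.univ.filter fun i : Fin m => AllNegative Φ i ∧ i.val < t + 1 := by
        intro i hi
        rcases Finset.mem_insert.mp hi with rfl | hi
        · exact Finset.mem_filter.mpr ⟨Finset.mem_univ _, ha, Nat.lt_succ_self t⟩
        · have := (Finset.mem_filter.mp hi).2
          exact Finset.mem_filter.mpr ⟨Finset.mem_univ _, this.1, by omega⟩
      have h3 := Finset.card_le_card h2
      rw [Finset.card_insert_of_notMem (by simp)] at h3
      omega
    · have h1 : phase1Step Φ (stZ Φ t) ⟨t, hlt⟩ = stZ Φ t := by
        unfold phase1Step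
        rw [if_neg fun h => ha h.1]
      rw [h1]
      refine ih.trans (Finset.card_le_card fun i hi => ?_)
      have := (Finset.mem_filter.mp hi).2
      exact Finset.mem_filter.mpr ⟨Finset.mem_univ _, this.1, by omega⟩

theorem card_stZ'_le (Φ : Formula k n m) (u : ℕ) : (stZ' Φ (m + u)).card ≤ 3 * u := by
  induction u with
  | zero => rw [Nat.add_zero, stZ'_of_le Φ le_rfl]; simp
  | succ u ih =>
    rw [← Nat.add_assoc]
    rcases h : treated Φ (m + u) with _ | i
    · rw [stZ'_succ_of_none (by omega) h]
      omega
    · rw [(treated_of_ge (by omega) h).2]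
      refine (Finset.card_union_le _ _).trans ?_
      have h1 := List.toFinset_card_le
        ((picks Φ (stZ Φ (m + u)) (stZ' Φ (m + u)) i).map fun j => (Φ i j).1)
      rw [List.length_map] at h1
      have := length_picks_le Φ (stZ Φ (m + u)) (stZ' Φ (m + u)) i
      omega

/-- A clause is treated at most once in the second phase. -/
theorem treated_ne {Φ : Formula k n m} (hk : 5 ≤ k) {s t : ℕ} {i : Fin m} (hs : m ≤ s)
    (hst : s < t) (h : treated Φ s = some i) : treated Φ t ≠ some i := by
  intro h'
  have h1 := treated_of_ge hs h
  have h2 := (Finset.mem_filter.mp (treated_of_ge (by omega) h').1).2.2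
  have h3 : stZ' Φ (s + 1) ⊆ stZ' Φ t := stZ'_mono Φ hst
  have h4 : (picks Φ (stZ Φ s) (stZ' Φ s) i).toFinset ⊆
      Finset.univ.filter fun j : Fin k => (Φ i j).1 ∈ stZ' Φ t := by
    intro j hj
    refine Finset.mem_filter.mpr ⟨Finset.mem_univ _, h3 ?_⟩
    rw [h1.2]
    refine Finset.mem_union_right _ (List.mem_toFinset.mpr (List.mem_map.mpr ⟨j, ?_, rfl⟩))
    exact List.mem_toFinset.mp hj
  have h5 := Finset.card_le_card h4
  rw [List.toFinset_card_of_nodup (nodup_picks _ _ _ _), length_picks hk h1.1] at h5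
  omega

/-- The positive literals of a clause that is treated in the second phase have variables from
`Z ∪ Z'`, and its negative literals with variables from `Z` have variables from `Z'`. -/
theorem mem_of_treated {Φ : Formula k n m} {t : ℕ} {i : Fin m} (ht : m ≤ t)
    (h : treated Φ t = some i) (j : Fin k) :
    ((Φ i j).2 = true → (Φ i j).1 ∈ stX Φ t) ∧
      ((Φ i j).2 = false → (Φ i j).1 ∈ stZ Φ t → (Φ i j).1 ∈ stZ' Φ t) := by
  have h1 := (Finset.mem_filter.mp (treated_of_ge ht h).1).2.1
  rw [Endangered, not_exists] at h1
  have h2 := h1 j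
  rw [not_and_not_right] at h2
  constructor
  · intro hs
    by_cases hz : (Φ i j).1 ∈ stZ Φ t
    · exact Finset.mem_union_left _ hz
    · refine Finset.mem_union_right _ (h2 ?_)
      simp [Lit.TrueUnder, sigma, hs, hz]
  · intro hs hz
    apply h2
    simp [Lit.TrueUnder, sigma, hs, hz]

/-- An all-negative clause treated in the first phase puts one of its variables into `Z`. -/
theorem exists_mem_of_treated (hk : 1 ≤ k) {Φ : Formula k n m} {t : ℕ} {i : Fin m} (ht : t < m)
    (h : treated Φ t = some i) : ∃ j, (Φ i j).1 ∈ stZ Φ (t + 1) := by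
  obtain ⟨hi, ha⟩ := treated_of_lt ht h
  obtain rfl : i = ⟨t, ht⟩ := Fin.ext hi
  rw [stZ_succ Φ ht]
  unfold phase1Step
  rw [if_pos ha]
  split
  · exact ⟨_, Finset.mem_insert_self _ _⟩
  · refine ⟨⟨k₁ k - 1, by unfold k₁; omega⟩, Finset.mem_union_right _ ?_⟩
    refine Finset.mem_image_of_mem _ (Finset.mem_filter.mpr ⟨Finset.mem_univ _, ?_⟩)
    unfold k₁
    simp only
    omega

/-! ### Codes of the positions of a clause -/

variable {σ : Equiv.Perm (Fin n)} {N : ℕ}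

theorem not_inspected {Φ : Formula k n m} {i : Fin m} {t : ℕ}
    (h : ∀ s < t, treated Φ s ≠ some i) {s : ℕ} (hs : s < t) (j : Fin k) : ¬ Inspected Φ s i j :=
  fun h' => h s hs h'.1

/-- Before an untreated clause has lost all but one of its positive literals, none of these has
been looked at. -/
theorem le_revealTime_of_ne {Φ : Formula k n m} {i : Fin m} {t u : ℕ}
    (hT : ∀ s < t, treated Φ s ≠ some i) (ht : t ≤ N) {l l' : Fin k} (hl : (Φ i l).2 = true)
    (hne : l ≠ l') (hx : (Φ i l).1 ∉ stX Φ u) (htu : t ≤ u + 1) : t ≤ revealTime Φ N i l' := by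
  refine le_revealTime_iff.mpr ⟨ht, fun s hs hr => ?_⟩
  rcases hr with hc | hc
  · rcases hc.1 l hne with h1 | h1
    · exact hx (stX_mono Φ (by omega : s ≤ u) h1.2)
    · rw [hl] at h1
      exact absurd h1.1 (by simp)
  · exact not_inspected hT hs l' hc

/-- If two positive literals of an untreated clause are lost at the same time, then their codes
are close to each other. -/
theorem encode_close {Φ : Formula k n m} {i : Fin m} {t : ℕ}
    (hT : ∀ s < t + 1, treated Φ s ≠ some i) (ht : t + 1 ≤ N) {l l' : Fin k}
    (hl : (Φ i l).2 = true) (hl' : (Φ i l').2 = true) (hne : l ≠ l')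
    (hx : (Φ i l).1 ∉ stX Φ t) (hx' : (Φ i l').1 ∉ stX Φ t)
    (hxt : (Φ i l).1 ∈ stX Φ (t + 1)) :
    (encode σ N Φ i l).1.val ≤ (encode σ N Φ i l').1.val + 2 := by
  have r := le_revealTime_of_ne hT ht hl' hne.symm hx' le_rfl
  have r' := le_revealTime_of_ne hT ht hl hne hx le_rfl
  have h1 := encode_lt_of_mem (σ := σ) r hxt
  have h2 : (stX Φ t).card ≤ (encode σ N Φ i l').1.val := by
    by_contra hlt
    exact hx' (mem_of_encode_lt (σ := σ) (by omega) (not_le.mp hlt))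
  have := card_stX_succ_le Φ t
  omega

/-- While position l holds a variable outside Z ∪ Z', no other position of the clause can be
critical, so the other positive literals were not looked at before their variables were excluded. -/
theorem encode_lt_of_critical {Φ : Formula k n m} {i : Fin m} {t : ℕ}
    (hT : ∀ s < t, treated Φ s ≠ some i) (ht : t ≤ N) {l l' : Fin k}
    (hc : Critical Φ (stZ Φ t) (stZ' Φ t) i l) (hx : (Φ i l).1 ∉ stX Φ t) (hne : l' ≠ l)
    (hl' : (Φ i l').2 = true) : (encode σ N Φ i l').1.val < (stX Φ t).card := by
  refine encode_lt_of_mem (le_revealTime_of_ne hT ht hc.2 hne.symm hx (Nat.le_succ t)) ?_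
  rcases hc.1 l' hne with h1 | h1
  · exact h1.2
  · rw [hl'] at h1
    exact absurd h1.1 (by simp)

/-- The first look at position l was as a critical one, because the clause is untreated. The
variable was not excluded then and its place under σ lies beyond the excluded list, so `stableEnum`
left it there. The code thus does not depend on the run. -/
theorem encode_eq_of_critical {Φ : Formula k n m} {i : Fin m} {t : ℕ}
    (hT : ∀ s < t, treated Φ s ≠ some i) (ht : t ≤ N) {l : Fin k}
    (hc : Critical Φ (stZ Φ t) (stZ' Φ t) i l) (hx : (Φ i l).1 ∉ stX Φ t)
    (hσ : (stX Φ t).card ≤ (σ (Φ i l).1).val) : (encode σ N Φ i l).1 = σ (Φ i l).1 := by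
  have hr : revealTime Φ N i l ≤ t := by
    by_contra hlt
    exact (le_revealTime_iff.mp (not_le.mp hlt)).2 t (Nat.lt_succ_self t) (Or.inl hc)
  have hcr : Critical Φ (stZ Φ (revealTime Φ N i l)) (stZ' Φ (revealTime Φ N i l)) i l := by
    rcases hr.eq_or_lt with h1 | h1
    · rw [h1]; exact hc
    · rcases revealTime_spec Φ N i l with h2 | h2
      · exact h2.resolve_right (not_inspected hT h1 l)
      · omega
  have hsub := stX_mono Φ hr
  simp only [encode, enumAt]
  rw [if_neg fun h => h.2 hcr]
  refine stableEnum_notMem σ (excluded_nodup Φ _) (fun h => hx (hsub (mem_excluded.mp h))) ?_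
  rw [length_excluded]
  exact (Finset.card_le_card hsub).trans hσ

/-- When an untreated clause has lost its positive literals, then all but one of these have small
codes. -/
theorem encode_lt_of_ne {Φ : Formula k n m} {i : Fin m} {t : ℕ}
    (hT : ∀ s < t, treated Φ s ≠ some i) (ht : t ≤ N) {l l' : Fin k} (hne : l ≠ l')
    (hl : (Φ i l).2 = true) (hl' : (Φ i l').2 = true) (hx : (Φ i l).1 ∈ stX Φ t)
    (hx' : (Φ i l').1 ∈ stX Φ t) : (encode σ N Φ i l).1.val < (stX Φ t).card ∨
      (encode σ N Φ i l').1.val < (stX Φ t).card := by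
  -- If a is looked at no later than b, then a was critical at that moment, so the variable at b was
  -- already excluded and its code is small.
  have key : ∀ a b : Fin k, a ≠ b → (Φ i b).2 = true → revealTime Φ N i a < t →
      revealTime Φ N i b < t → revealTime Φ N i a ≤ revealTime Φ N i b →
      (encode σ N Φ i b).1.val < (stX Φ t).card := by
    intro a b hab hb hra hrb hle
    have hca : Critical Φ (stZ Φ (revealTime Φ N i a)) (stZ' Φ (revealTime Φ N i a)) i a := by
      rcases revealTime_spec Φ N i a with h2 | h2
      · exact h2.resolve_right (not_inspected hT hra a)
      · omega
    have hmem : (Φ i b).1 ∈ stX Φ (revealTime Φ N i a) := by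
      rcases hca.1 b hab.symm with h1 | h1
      · exact h1.2
      · rw [hb] at h1
        exact absurd h1.1 (by simp)
    exact (encode_lt_of_mem hle hmem).trans_le (Finset.card_le_card (stX_mono Φ hra.le))
  rcases lt_or_ge (revealTime Φ N i l) t with h1 | h1
  · rcases lt_or_ge (revealTime Φ N i l') t with h2 | h2
    · rcases le_total (revealTime Φ N i l) (revealTime Φ N i l') with h3 | h3
      · exact Or.inr (key l l' hne hl' h1 h2 h3)
      · exact Or.inl (key l' l hne.symm hl h2 h1 h3)
    · exact Or.inr (encode_lt_of_mem h2 hx')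
  · exact Or.inl (encode_lt_of_mem h1 hx)

/-- A negative literal of a clause that is inspected for the first time has a large code only if
its variable is safe. -/
theorem mem_safeSet_of_le_encode {Φ : Formula k n m} {i : Fin m} {t : ℕ} {j : Fin k}
    (ht : t ≤ N) (hj : (Φ i j).2 = false) (hi : Inspected Φ t i j)
    (hT : ∀ s < t, ¬ Inspected Φ s i j)
    (hB : n - (safeSet Φ t).card ≤ (encode σ N Φ i j).1.val) : (Φ i j).1 ∈ safeSet Φ t := by
  -- A critical position is positive, so this one is coded by `lastEnum` at its first inspection.
  have hnc : ∀ s, ¬ Critical Φ (stZ Φ s) (stZ' Φ s) i j := by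
    intro s hc
    exact absurd (hj.symm.trans hc.2) (by simp)
  have hr : revealTime Φ N i j = t := by
    refine le_antisymm ?_ (le_revealTime_iff.mpr ⟨ht, fun s hs h => ?_⟩)
    · by_contra hlt
      exact (le_revealTime_iff.mp (not_le.mp hlt)).2 t (Nat.lt_succ_self t) (Or.inr hi)
    · exact h.elim (hnc s) (hT s hs)
  simp only [encode, enumAt] at hB
  rw [hr, if_pos ⟨hi, hnc t⟩] at hB
  exact mem_of_le_lastEnum (excluded_nodup Φ t) (notMem_excluded_of_mem_safeSet Φ t) hB

end Structure

/-! ### Clause patterns in the codes, and the bound on the number of passes. -/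

section Patterns

variable {k n m : ℕ}

/-- All literals are negative, and the first `⌈k/2⌉ - 1` have variables below `B`. -/
def NoneLarge (B : ℕ) (a : Fin k → Lit n) : Prop :=
  (∀ j, (a j).2 = false) ∧ ∀ j : Fin k, j.val + 1 < k₁ k → (a j).1.val < B

/-- All positive literals but one have variables below `Θ`, and fewer than three of the positions
`j` with `⌈k/2⌉ < j ≤ k - 5` hold a negative literal with a variable from `B` on. -/
def FewLarge (Θ B : ℕ) (a : Fin k → Lit n) : Prop :=
  (∃ l, ∀ j, j ≠ l → (a j).2 = true → (a j).1.val < Θ) ∧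
    (Finset.univ.filter fun j : Fin k => k₁ k < j.val + 1 ∧ j.val + 1 + 5 ≤ k ∧
      (a j).2 = false ∧ B ≤ (a j).1.val).card < 3

/-- Some literal has a variable in `P`, and all other positive literals but one have variables
below `Θ`. -/
def Hits (Θ : ℕ) (P : Finset (Fin n)) (a : Fin k → Lit n) : Prop :=
  ∃ c l, (a c).1 ∈ P ∧ ∀ j, j ≠ c → j ≠ l → (a j).2 = true → (a j).1.val < Θ

/-- There are two positions whose variables have almost the same number. -/
def Close (a : Fin k → Lit n) : Prop :=
  ∃ l l', l ≠ l' ∧ (a l).1.val ≤ (a l').1.val + 2 ∧ (a l').1.val ≤ (a l).1.val + 2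

open Classical in
/-- The clauses with a given property. -/
noncomputable def clausesWith (Q : (Fin k → Lit n) → Prop) (Φ : Formula k n m) : Finset (Fin m) :=
  Finset.univ.filter fun i => Q (Φ i)

theorem mem_clausesWith {Q : (Fin k → Lit n) → Prop} {Φ : Formula k n m} {i : Fin m} :
    i ∈ clausesWith Q Φ ↔ Q (Φ i) := by
  simp [clausesWith]

variable {σ : Equiv.Perm (Fin n)} {N Θ B : ℕ} {Φ : Formula k n m}

/-- A clause of the first phase none of whose inspected variables is safe. -/
theorem noneLarge_of_treated (hN : m ≤ N) (hB : ∀ t < N, n - (safeSet Φ t).card ≤ B) {t : ℕ}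
    (ht : t < m) {i : Fin m} (h : treated Φ t = some i)
    (hs : ∀ j : Fin k, j.val + 1 < k₁ k → (Φ i j).1 ∉ safeSet Φ t) :
    NoneLarge B (encode σ N Φ i) := by
  have hneg := (treated_of_lt ht h).2.1
  refine ⟨fun j => hneg j, fun j hj => ?_⟩
  by_contra hlt
  refine hs j hj (mem_safeSet_of_le_encode (σ := σ) (N := N) (by omega) (hneg j)
    ⟨h, Or.inl ⟨ht, hj.le⟩⟩ (fun s hs' hi => ?_) ((hB t (by omega)).trans (not_lt.mp hlt)))
  have h1 := (treated_of_lt (by omega) hi.1).1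
  have h2 := (treated_of_lt ht h).1
  omega

/-- A clause with a positive literal is not treated by the first phase, and so not before it is
treated by the second phase. -/
theorem not_treated_of_pos (hk : 5 ≤ k) {t : ℕ} {i : Fin m}
    (h : treated Φ t = some i) {l : Fin k} (hl : (Φ i l).2 = true) :
    ∀ s < t, treated Φ s ≠ some i := by
  intro s hs hs'
  rcases lt_or_ge s m with h1 | h1
  · have := (treated_of_lt h1 hs').2.1 l
    rw [hl] at this
    exact absurd this (by simp)
  · exact treated_ne hk h1 hs hs' h

/-- A clause of the second phase in which fewer than three of the inspected variables are safe. -/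
theorem fewLarge_of_treated (hk : 5 ≤ k) (hB : ∀ t < N, n - (safeSet Φ t).card ≤ B)
    (hΘ : ∀ t ≤ N, (stX Φ t).card ≤ Θ) {t : ℕ} (ht : m ≤ t) (htN : t < N) {i : Fin m}
    (h : treated Φ t = some i)
    (hs : ¬ 3 ≤ ((List.finRange k).filter fun j => decide (k₁ k < j.val + 1 ∧ j.val + 1 + 5 ≤ k ∧
      ¬ Unsafe₂ Φ (stZ Φ t) (stZ' Φ t) (Φ i j).1)).length) :
    FewLarge Θ B (encode σ N Φ i) := by
  classical
  constructor
  · by_contra hcon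
    push Not at hcon
    obtain ⟨l, -, hl, hl'⟩ := hcon ⟨0, by omega⟩
    obtain ⟨j, hjl, hj, hj'⟩ := hcon l
    rw [encode_snd] at hl hj
    have := encode_lt_of_ne (σ := σ) (not_treated_of_pos hk h hl) htN.le hjl.symm hl hj
      ((mem_of_treated ht h l).1 hl) ((mem_of_treated ht h j).1 hj)
    have := hΘ t htN.le
    omega
  · rw [← List.toFinset_card_of_nodup ((List.nodup_finRange k).filter _)] at hs
    refine lt_of_le_of_lt (Finset.card_le_card fun j hj => ?_) (not_le.mp hs)
    have hj' := (Finset.mem_filter.mp hj).2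
    rw [encode_snd] at hj'
    have h1 := mem_safeSet_of_le_encode (σ := σ) htN.le hj'.2.2.1 ⟨h, Or.inr ⟨ht, hj'.1⟩⟩
      (fun s hs' hi => ?_) ((hB t htN).trans hj'.2.2.2)
    · have h2 := (Finset.mem_filter.mp h1).2
      rw [List.mem_toFinset, List.mem_filter]
      exact ⟨List.mem_finRange j, decide_eq_true ⟨hj'.1, hj'.2.1, h2⟩⟩
    · rcases hi.2 with h2 | h2
      · omega
      · exact treated_ne hk h2.1 hs' hi.1 h

/-- The variables that may have been added although they were not safe: those in position `⌈k/2⌉`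
of a clause of the first kind, and those in the last five positions of a clause of the second
kind. -/
noncomputable def suspects (Θ B : ℕ) (Φ Ψ : Formula k n m) : Finset (Fin n) :=
  ((clausesWith (NoneLarge B) Ψ).biUnion fun i =>
      (Finset.univ.filter fun j : Fin k => j.val + 1 = k₁ k).image fun j => (Φ i j).1) ∪
    (clausesWith (FewLarge Θ B) Ψ).biUnion fun i =>
      (Finset.univ.filter fun j : Fin k => k < j.val + 1 + 5).image fun j => (Φ i j).1

theorem card_suspects_le (Θ B : ℕ) (Φ Ψ : Formula k n m) :
    (suspects Θ B Φ Ψ).card ≤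
      (clausesWith (NoneLarge B) Ψ).card + 5 * (clausesWith (FewLarge Θ B) Ψ).card := by
  refine (Finset.card_union_le _ _).trans (Nat.add_le_add ?_ ?_)
  · refine (Finset.card_biUnion_le_card_mul _ _ 1 fun i _ => ?_).trans (by omega)
    refine Finset.card_image_le.trans (Finset.card_le_one.mpr ?_)
    intro a ha b hb
    have h1 := (Finset.mem_filter.mp ha).2
    have h2 := (Finset.mem_filter.mp hb).2
    exact Fin.ext (by omega)
  · refine (Finset.card_biUnion_le_card_mul _ _ 5 fun i _ => ?_).trans (by omega)
    refine Finset.card_image_le.trans ?_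
    have : ((Finset.univ.filter fun j : Fin k => k < j.val + 1 + 5).image
        fun j => k - 1 - j.val) ⊆ Finset.range 5 := by
      intro a ha
      obtain ⟨j, hj, rfl⟩ := Finset.mem_image.mp ha
      have := (Finset.mem_filter.mp hj).2
      exact Finset.mem_range.mpr (by omega)
    have h5 := Finset.card_le_card this
    rw [Finset.card_image_of_injOn, Finset.card_range] at h5
    · exact h5
    · intro a _ b _ hab
      simp only at hab
      have := a.isLt
      have := b.isLt
      exact Fin.ext (by omega)

/-- A variable that is picked in the second phase is suspect if it was not safe. -/
theorem mem_suspects_of_picks (hk : 5 ≤ k) (hB : ∀ t < N, n - (safeSet Φ t).card ≤ B)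
    (hΘ : ∀ t ≤ N, (stX Φ t).card ≤ Θ) {t : ℕ} (ht : m ≤ t) (htN : t < N) {x : Fin n}
    (hx : x ∈ stZ' Φ (t + 1)) (hx' : x ∉ stZ' Φ t)
    (hu : Unsafe₂ Φ (stZ Φ t) (stZ' Φ t) x) : x ∈ suspects Θ B Φ (encode σ N Φ) := by
  rcases h : treated Φ t with _ | i
  · rw [stZ'_succ_of_none ht h] at hx
    exact absurd hx hx'
  · rw [(treated_of_ge ht h).2, Finset.mem_union, List.mem_toFinset, List.mem_map] at hx
    obtain ⟨j, hj, rfl⟩ := hx.resolve_left hx'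
    unfold picks at hj
    simp only at hj
    split_ifs at hj with h3
    · have := List.mem_of_mem_take hj
      exact absurd hu (of_decide_eq_true (List.mem_filter.mp this).2).2.2
    · have := List.mem_of_mem_take hj
      have h4 := (of_decide_eq_true (List.mem_filter.mp this).2).1
      refine Finset.mem_union_right _ (Finset.mem_biUnion.mpr ⟨i, ?_, ?_⟩)
      · exact mem_clausesWith.mpr (fewLarge_of_treated hk hB hΘ ht htN h h3)
      · exact Finset.mem_image_of_mem _ (Finset.mem_filter.mpr ⟨Finset.mem_univ _, h4⟩)

/-- An unsafe variable enters only by default, from position ⌈k/2⌉ in the first phase and from the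
last five positions in the second; then the inspected positions held too few safe variables, hence
too few large codes. -/
theorem mem_suspects (hk : 5 ≤ k) (hN : m ≤ N) (hB : ∀ t < N, n - (safeSet Φ t).card ≤ B)
    (hΘ : ∀ t ≤ N, (stX Φ t).card ≤ Θ) {t : ℕ} (htN : t < N) {x : Fin n}
    (hx : x ∈ stX Φ (t + 1)) (hx' : x ∉ stX Φ t)
    (hu : Unsafe₂ Φ (stZ Φ t) (stZ' Φ t) x) : x ∈ suspects Θ B Φ (encode σ N Φ) := by
  classical
  rcases lt_or_ge t m with ht | ht
  · have h0 := stZ'_of_le Φ ht.le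
    rw [stX, stZ'_of_le Φ ht, Finset.union_empty, stZ_succ Φ ht] at hx
    rw [stX, h0, Finset.union_empty] at hx'
    rw [h0] at hu
    unfold phase1Step at hx
    split_ifs at hx with ha
    · have htr : treated Φ t = some ⟨t, ht⟩ := by rw [treated, dif_pos ht, if_pos ha]
      split at hx
      · rename_i j hj
        have h1 := (of_decide_eq_true (List.find?_some hj :)).2
        obtain rfl := (Finset.mem_insert.mp hx).resolve_right hx'
        exact absurd hu ((safe₁_iff _ _ _).mp h1)
      · rename_i hnone
        have h1 := (Finset.mem_union.mp hx).resolve_left hx'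
        refine Finset.mem_union_left _ (Finset.mem_biUnion.mpr ⟨⟨t, ht⟩, ?_, h1⟩)
        refine mem_clausesWith.mpr (noneLarge_of_treated hN hB ht htr fun j hj hs => ?_)
        have h2 := List.find?_eq_none.mp hnone j (List.mem_finRange j)
        refine h2 (decide_eq_true ⟨hj, (safe₁_iff _ _ _).mpr ?_⟩)
        have h3 := (Finset.mem_filter.mp hs).2
        rwa [h0] at h3
    · exact absurd hx hx'
  · have hZ : stZ Φ (t + 1) = stZ Φ t := by rw [stZ_of_le Φ ht, stZ_of_le Φ (by omega)]
    rw [stX, Finset.mem_union, not_or] at hx'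
    rw [stX, hZ, Finset.mem_union] at hx
    exact mem_suspects_of_picks hk hB hΘ ht htN (hx.resolve_left hx'.1) hx'.2 hu

/-- A variable in Z is unsafe for that reason alone, so its arrival in Z' makes it suspect. -/
theorem mem_suspects_of_mem_inter (hk : 5 ≤ k) (hB : ∀ t < N, n - (safeSet Φ t).card ≤ B)
    (hΘ : ∀ t ≤ N, (stX Φ t).card ≤ Θ) {t : ℕ} (htN : t ≤ N) {x : Fin n}
    (hx : x ∈ stZ Φ t) (hx' : x ∈ stZ' Φ t) : x ∈ suspects Θ B Φ (encode σ N Φ) := by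
  induction t with
  | zero =>
    rw [stZ_zero] at hx
    exact absurd hx (Finset.notMem_empty x)
  | succ t ih =>
    rcases lt_or_ge t m with ht | ht
    · rw [stZ'_of_le Φ ht] at hx'
      exact absurd hx' (Finset.notMem_empty x)
    · rw [stZ_of_le Φ (by omega), ← stZ_of_le Φ ht] at hx
      by_cases h : x ∈ stZ' Φ t
      · exact ih (by omega) hx h
      · exact mem_suspects_of_picks hk hB hΘ ht htN hx' h
          (Or.inl (Finset.mem_union_left _ hx))

/-- The clauses of the first phase that have put a variable from `Y` into `Z`. -/
noncomputable def chargedTo (Φ : Formula k n m) (Y : Finset (Fin n)) : Finset (Fin m) :=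
  Finset.univ.filter fun i => ∃ x ∈ Y, x ∈ stX Φ (i.val + 1) ∧ x ∉ stX Φ i.val

/-- By monotonicity each variable enters Z ∪ Z' at one time only. -/
theorem card_chargedTo_le (Φ : Formula k n m) (Y : Finset (Fin n)) :
    (chargedTo Φ Y).card ≤ Y.card := by
  classical
  have h : chargedTo Φ Y ⊆ Y.biUnion fun x =>
      Finset.univ.filter fun i : Fin m => x ∈ stX Φ (i.val + 1) ∧ x ∉ stX Φ i.val := by
    intro i hi
    obtain ⟨x, hx, h1⟩ := (Finset.mem_filter.mp hi).2
    exact Finset.mem_biUnion.mpr ⟨x, hx, Finset.mem_filter.mpr ⟨Finset.mem_univ _, h1⟩⟩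
  refine (Finset.card_le_card h).trans
    ((Finset.card_biUnion_le_card_mul _ _ 1 fun x _ => ?_).trans (by omega))
  refine Finset.card_le_one.mpr fun a ha b hb => ?_
  have h1 := (Finset.mem_filter.mp ha).2
  have h2 := (Finset.mem_filter.mp hb).2
  have key : ∀ a b : Fin m, x ∈ stX Φ (a.val + 1) → x ∉ stX Φ b.val → b ≤ a := by
    intro a b h3 h4
    by_contra hlt
    exact h4 (stX_mono Φ (by simpa using hlt : a.val + 1 ≤ b.val) h3)
  exact le_antisymm (key b a h2.1 h1.2) (key a b h1.1 h2.2)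

/-- Why a clause is treated in the second phase, in terms of the codes. -/
theorem treated_cases (hk : 5 ≤ k) (hN : m ≤ N)
    (hΘ : ∀ t ≤ N, (stX Φ t).card ≤ Θ) {Y : Finset (Fin n)}
    (hY : ∀ t < N, ∀ x ∈ stX Φ (t + 1), x ∉ stX Φ t → Unsafe₂ Φ (stZ Φ t) (stZ' Φ t) x → x ∈ Y)
    (hY' : ∀ t ≤ N, ∀ x ∈ stZ Φ t, x ∈ stZ' Φ t → x ∈ Y)
    {σ' : Equiv.Perm (Fin n)} (hσ : ∀ x, Θ ≤ (σ x).val ∨ Θ ≤ (σ' x).val)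
    {t : ℕ} (ht : m ≤ t) (htN : t < N) {i : Fin m} (h : treated Φ t = some i) :
    Close (encode σ N Φ i) ∨ Hits Θ (Y.image σ) (encode σ N Φ i) ∨
      Hits Θ (Y.image σ') (encode σ' N Φ i) ∨
      Hits Θ (Y.image (stableEnum 1 (excluded Φ m))) (encode σ N Φ i) ∨ i ∈ chargedTo Φ Y := by
  classical
  have hcharge : ∀ s < m, treated Φ s = some i → i ∈ chargedTo Φ Y := by
    intro s hs h1
    obtain ⟨h2, h3, h4⟩ := treated_of_lt hs h1
    obtain ⟨j, hj⟩ := exists_mem_of_treated (by omega) hs h1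
    have hj' : (Φ i j).1 ∈ stZ Φ t := stZ_mono Φ (by omega) hj
    refine Finset.mem_filter.mpr ⟨Finset.mem_univ _, (Φ i j).1, ?_, ?_, ?_⟩
    · exact hY' t htN.le _ hj' ((mem_of_treated ht h j).2 (h3 j) hj')
    · rw [h2]; exact Finset.mem_union_left _ hj
    · rw [h2, stX, stZ'_of_le Φ hs.le, Finset.union_empty]
      exact h4 j
  by_cases hT' : ∃ s < m, treated Φ s = some i
  · obtain ⟨s, hs, hs'⟩ := hT'
    exact Or.inr (Or.inr (Or.inr (Or.inr (hcharge s hs hs'))))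
  push Not at hT'
  have hT : ∀ s < t, treated Φ s ≠ some i := by
    intro s hs hs'
    rcases lt_or_ge s m with h1 | h1
    · exact hT' s h1 hs'
    · exact treated_ne hk h1 hs hs' h
  have hpos : ∀ j, (Φ i j).2 = true → (Φ i j).1 ∈ stX Φ t := fun j => (mem_of_treated ht h j).1
  by_cases hneg : ∃ j, (Φ i j).2 = false ∧ (Φ i j).1 ∈ stZ Φ t
  · -- a true negative literal
    obtain ⟨c, hc, hcZ⟩ := hneg
    refine Or.inr (Or.inr (Or.inr (Or.inl ?_)))
    have hcY : (Φ i c).1 ∈ Y := hY' t htN.le _ hcZ ((mem_of_treated ht h c).2 hc hcZ)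
    have hcm : (Φ i c).1 ∈ stX Φ m := by
      rw [stZ_of_le Φ ht, ← stZ_of_le Φ le_rfl] at hcZ
      exact Finset.mem_union_left _ hcZ
    -- A negative literal is never critical, and the clause was not treated in the first phase. So
    -- the code is the index in the excluded list of time m, which already contains all of Z.
    have hrev : m ≤ revealTime Φ N i c := by
      refine le_revealTime_iff.mpr ⟨hN, fun s hs hr => ?_⟩
      rcases hr with h1 | h1
      · exact absurd (hc.symm.trans h1.2) (by simp)
      · exact hT' s hs h1.1
    have hcode : (encode σ N Φ i c).1 = stableEnum 1 (excluded Φ m) (Φ i c).1 := by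
      apply Fin.ext
      rw [encode_eq_idxOf hrev hcm,
        stableEnum_mem 1 (excluded_nodup Φ m) (mem_excluded.mpr hcm)]
    by_contra hcon
    simp only [Hits] at hcon
    push Not at hcon
    have hmem : (encode σ N Φ i c).1 ∈ Y.image (stableEnum 1 (excluded Φ m)) := by
      rw [hcode]
      exact Finset.mem_image_of_mem _ hcY
    -- Taking c itself as the exceptional position yields a positive literal with a code of at least
    -- Θ; taking that literal as the exception yields a second one.
    obtain ⟨l, -, -, hl, hl'⟩ := hcon c c hmem
    obtain ⟨j, -, hjl, hj, hj'⟩ := hcon c l hmem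
    rw [encode_snd] at hl hj
    have := encode_lt_of_ne (σ := σ) hT htN.le hjl.symm hl hj (hpos l hl) (hpos j hj)
    have := hΘ t htN.le
    omega
  · push Not at hneg
    -- the clause has a positive literal
    have hex : ∃ j, (Φ i j).2 = true := by
      by_contra hcon
      push Not at hcon
      have hall : AllNegative Φ i := fun j => by simpa using hcon j
      refine hT' i.val i.isLt ?_
      rw [treated, dif_pos i.isLt, if_pos]
      exact ⟨hall, fun j hj => hneg j (hall j) (stZ_mono Φ (by omega) hj)⟩
    obtain ⟨j₀, hj₀⟩ := hex
    -- The time of interest is the last s at which some positive literal has its variable outside Z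
    -- ∪ Z'.
    have hP : ∃ s, ∀ j, (Φ i j).2 = true → (Φ i j).1 ∈ stX Φ s := ⟨t, hpos⟩
    have hs1 := Nat.find_spec hP
    have hs0 : Nat.find hP ≠ 0 := by
      intro h0
      have := hs1 j₀ hj₀
      rw [h0, stX_zero] at this
      exact absurd this (Finset.notMem_empty _)
    obtain ⟨s, hs⟩ := Nat.exists_eq_succ_of_ne_zero hs0
    have hst : s + 1 ≤ t := by
      have := Nat.find_min' hP hpos
      omega
    have hs2 := Nat.find_min hP (by omega : s < Nat.find hP)
    rw [hs] at hs1
    push Not at hs2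
    obtain ⟨l, hl, hlx⟩ := hs2
    -- Either two positive literals are lost between s and s + 1 and their codes are close, or only
    -- one, which was critical at time s, so that its variable was added while unsafe.
    by_cases htwo : ∃ l', l' ≠ l ∧ (Φ i l').2 = true ∧ (Φ i l').1 ∉ stX Φ s
    · obtain ⟨l', hne, hl', hlx'⟩ := htwo
      have hT2 : ∀ r < s + 1, treated Φ r ≠ some i := fun r hr => hT r (by omega)
      exact Or.inl ⟨l, l', hne.symm,
        encode_close hT2 (by omega) hl hl' hne.symm hlx hlx' (hs1 l hl),
        encode_close hT2 (by omega) hl' hl hne hlx' hlx (hs1 l' hl')⟩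
    · push Not at htwo
      have hcrit : Critical Φ (stZ Φ s) (stZ' Φ s) i l := by
        refine ⟨fun j hj => ?_, hl⟩
        rcases hsj : (Φ i j).2 with _ | _
        · exact Or.inr ⟨hsj, fun hz => hneg j hsj (stZ_mono Φ (by omega) hz)⟩
        · exact Or.inl ⟨hsj, htwo j hj hsj⟩
      have hxY : (Φ i l).1 ∈ Y := hY s (by omega) _ (hs1 l hl) hlx
        ((unsafe₂_iff _ _ _ _).mpr (Or.inr ⟨i, l, hcrit, rfl⟩))
      have hTs : ∀ r < s, treated Φ r ≠ some i := fun r hr => hT r (by omega)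
      have hΘs := hΘ s (by omega)
      have key : ∀ τ : Equiv.Perm (Fin n), Θ ≤ (τ (Φ i l).1).val →
          Hits Θ (Y.image τ) (encode τ N Φ i) := by
        intro τ hτ
        refine ⟨l, l, ?_, fun j hj _ hj' => ?_⟩
        · rw [encode_eq_of_critical hTs (by omega) hcrit hlx (hΘs.trans hτ)]
          exact Finset.mem_image_of_mem _ hxY
        · exact (encode_lt_of_critical hTs (by omega) hcrit hlx hj hj').trans_le hΘs
      rcases hσ (Φ i l).1 with h1 | h1
      · exact Or.inr (Or.inl (key σ h1))
      · exact Or.inr (Or.inr (Or.inl (key σ' h1)))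

/-- The number of passes of the second phase is small if the encodings of the formula have few
clauses of certain kinds. -/
theorem passes_le (hk : 5 ≤ k) {t₀ : ℕ} (hΘn : 2 * Θ ≤ n)
    (hB : ∀ t < m + t₀, n - (safeSet Φ t).card ≤ B) (hΘ : ∀ t ≤ m + t₀, (stX Φ t).card ≤ Θ)
    (hQ : ∀ u < t₀, (phase2State Φ u).1.Nonempty) {b : ℕ}
    (hb : (clausesWith (NoneLarge B) (encode 1 (m + t₀) Φ)).card +
      5 * (clausesWith (FewLarge Θ B) (encode 1 (m + t₀) Φ)).card ≤ b) :
    ∃ P₁ P₂ P₃ : Finset (Fin n), P₁.card ≤ b ∧ P₂.card ≤ b ∧ P₃.card ≤ b ∧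
      t₀ ≤ (clausesWith Close (encode 1 (m + t₀) Φ)).card +
        (clausesWith (Hits Θ P₁) (encode 1 (m + t₀) Φ)).card +
        (clausesWith (Hits Θ P₂) (encode Fin.revPerm (m + t₀) Φ)).card +
        (clausesWith (Hits Θ P₃) (encode 1 (m + t₀) Φ)).card + b := by
  classical
  set N := m + t₀ with hN
  set Y := suspects Θ B Φ (encode 1 N Φ) with hYdef
  have hYc : Y.card ≤ b := (card_suspects_le Θ B Φ _).trans hb
  refine ⟨Y.image (1 : Equiv.Perm (Fin n)), Y.image Fin.revPerm,
    Y.image (stableEnum 1 (excluded Φ m)), Finset.card_image_le.trans hYc,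
    Finset.card_image_le.trans hYc, Finset.card_image_le.trans hYc, ?_⟩
  have htr : ∀ u : Fin t₀, ∃ i, treated Φ (m + u.val) = some i := by
    intro u
    have h1 := hQ u.val u.isLt
    rw [phase2State_fst, ← stZ_of_le Φ (Nat.le_add_right m u.val)] at h1
    have h2 : (phase2State Φ u.val).2 = stZ' Φ (m + u.val) := by
      rw [stZ', Nat.add_sub_cancel_left]
    rw [h2] at h1
    exact ⟨_, by rw [treated, dif_neg (by omega), dif_pos h1]⟩
  choose f hf using htr
  have hinj : Function.Injective f := by
    intro u v huv
    have hu := hf u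
    have hv := hf v
    rw [huv] at hu
    rcases lt_trichotomy u.val v.val with h1 | h1 | h1
    · exact absurd hv (treated_ne hk (by omega) (by omega) hu)
    · exact Fin.ext h1
    · exact absurd hu (treated_ne hk (by omega) (by omega) hv)
  -- `stableEnum` is known to keep x in place only if the number of x is at least the length of the
  -- excluded list, hence the use of two permutations: as 2Θ ≤ n, the identity or the reversal gives
  -- x a number of at least Θ.
  have hσ : ∀ x : Fin n, Θ ≤ ((1 : Equiv.Perm (Fin n)) x).val ∨ Θ ≤ (Fin.revPerm x).val := by
    intro x
    have := x.isLt
    rw [Equiv.Perm.coe_one, id, Fin.revPerm_apply, Fin.val_rev]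
    omega
  have hsub : Finset.univ.image f ⊆ clausesWith Close (encode 1 N Φ) ∪
      clausesWith (Hits Θ (Y.image (1 : Equiv.Perm (Fin n)))) (encode 1 N Φ) ∪
      clausesWith (Hits Θ (Y.image Fin.revPerm)) (encode Fin.revPerm N Φ) ∪
      clausesWith (Hits Θ (Y.image (stableEnum 1 (excluded Φ m)))) (encode 1 N Φ) ∪
      chargedTo Φ Y := by
    intro i hi
    obtain ⟨u, -, rfl⟩ := Finset.mem_image.mp hi
    have := u.isLt
    have hc := treated_cases (σ := 1) (N := N) (Y := Y) hk (by omega) hΘ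
      (fun t ht x hx hx' hu => mem_suspects hk (by omega) hB hΘ ht hx hx' hu)
      (fun t ht x hx hx' => mem_suspects_of_mem_inter hk hB hΘ ht hx hx') hσ
      (by omega) (by omega) (hf u)
    simp only [Finset.mem_union, mem_clausesWith]
    tauto
  have hcard := Finset.card_le_card hsub
  rw [Finset.card_image_of_injective _ hinj, Finset.card_univ, Fintype.card_fin] at hcard
  refine hcard.trans ((Finset.card_union_le _ _).trans (Nat.add_le_add ?_
    ((card_chargedTo_le Φ Y).trans hYc)))
  refine (Finset.card_union_le _ _).trans (Nat.add_le_add_right ?_ _)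
  refine (Finset.card_union_le _ _).trans (Nat.add_le_add_right ?_ _)
  exact Finset.card_union_le _ _

/-- If `Z'` ends up large, then the second phase makes many passes. -/
theorem nonempty_of_lt_card {t₀ : ℕ} (h : 3 * t₀ < (phase2 Φ).card) :
    ∀ u ≤ t₀, (phase2State Φ u).1.Nonempty := by
  intro u hu
  by_contra hcon
  have hstep : ∀ v, phase2State Φ (u + v) = phase2State Φ u := by
    intro v
    induction v with
    | zero => rfl
    | succ v ih =>
      have hs : phase2State Φ (u + v + 1) = phase2Step Φ (phase1 Φ) (phase2State Φ (u + v)) := by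
        simp only [phase2State, Function.iterate_succ_apply']
      rw [← Nat.add_assoc, hs, ih]
      unfold phase2Step
      rw [dif_neg hcon]
  have hcard := fun v => card_stZ'_le Φ v
  simp only [stZ', Nat.add_sub_cancel_left] at hcard
  rcases le_total u n with h1 | h1
  · have h2 := hstep (n - u)
    rw [Nat.add_sub_cancel' h1] at h2
    rw [phase2, h2] at h
    have := hcard u
    omega
  · have := hcard n
    rw [phase2] at h
    omega

theorem card_stX_le (Φ : Formula k n m) (t₀ : ℕ) {t : ℕ} (ht : t ≤ m + t₀) :
    (stZ Φ t).card ≤ (clausesWith (fun a => ∀ j, (a j).2 = false) Φ).card ∧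
      (stZ' Φ t).card ≤ 3 * t₀ := by
  constructor
  · have h1 : stZ Φ t ⊆ stZ Φ m := by
      rcases le_total t m with h | h
      · exact stZ_mono Φ h
      · rw [stZ_of_le Φ h, stZ_of_le Φ le_rfl]
    refine (Finset.card_le_card h1).trans ((card_phase1_le Φ le_rfl).trans
      (Finset.card_le_card fun i hi => ?_))
    exact mem_clausesWith.mpr (Finset.mem_filter.mp hi).2.1
  · exact (Finset.card_le_card (stZ'_mono Φ ht)).trans (card_stZ'_le Φ t₀)

end Patterns

/-! ### Uniform probability: union bound, exponential moments, small subsets. -/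

section Probability

open Classical in
/-- The proportion of elements with the property `p`. -/
noncomputable def pr {α : Type*} [Fintype α] (p : α → Prop) : ℝ :=
  ((Finset.univ.filter p).card : ℝ) / Fintype.card α

variable {α : Type*} [Fintype α]

theorem pr_eq (p : α → Prop) [DecidablePred p] :
    pr p = ((Finset.univ.filter p).card : ℝ) / Fintype.card α := by
  unfold pr
  congr!

theorem pr_nonneg (p : α → Prop) : 0 ≤ pr p := by
  unfold pr
  positivity

theorem pr_mono {p q : α → Prop} (h : ∀ a, p a → q a) : pr p ≤ pr q := by
  classical
  rw [pr_eq, pr_eq]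
  have : Finset.univ.filter p ⊆ Finset.univ.filter q :=
    Finset.monotone_filter_right _ fun a _ => h a
  gcongr

theorem pr_or_le (p q : α → Prop) : pr (fun a => p a ∨ q a) ≤ pr p + pr q := by
  classical
  rw [pr_eq, pr_eq, pr_eq, ← add_div]
  gcongr
  rw [Finset.filter_or]
  exact_mod_cast Finset.card_union_le _ _

theorem pr_exists_le {β : Type*} (s : Finset β) (p : β → α → Prop) :
    pr (fun a => ∃ b ∈ s, p b a) ≤ ∑ b ∈ s, pr (p b) := by
  classical
  rw [pr_eq]
  simp only [pr_eq]
  rw [← Finset.sum_div]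
  gcongr
  have : (Finset.univ.filter fun a => ∃ b ∈ s, p b a) ⊆
      s.biUnion fun b => Finset.univ.filter (p b) := by
    intro a ha
    obtain ⟨b, hb, h⟩ := (Finset.mem_filter.mp ha).2
    exact Finset.mem_biUnion.mpr ⟨b, hb, Finset.mem_filter.mpr ⟨Finset.mem_univ _, h⟩⟩
  exact_mod_cast (Finset.card_le_card this).trans Finset.card_biUnion_le

theorem pr_exists_le_card_mul {β : Type*} (s : Finset β) (p : β → α → Prop) {q : ℝ}
    (h : ∀ b ∈ s, pr (p b) ≤ q) : pr (fun a => ∃ b ∈ s, p b a) ≤ s.card * q := by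
  refine (pr_exists_le s p).trans ((Finset.sum_le_sum h).trans ?_)
  rw [Finset.sum_const, nsmul_eq_mul]

/-- An injective self-map of a finite set is a bijection and preserves the uniform distribution.
Applied to `encode`, this reduces events about codes to independent clauses. -/
theorem pr_comp_of_injective {f : α → α} (hf : Function.Injective f) (p : α → Prop) :
    pr (fun a => p (f a)) = pr p := by
  classical
  rw [pr_eq, pr_eq]
  congr 2
  let e : α ≃ α := Equiv.ofBijective f (Finite.injective_iff_bijective.mp hf)
  refine Finset.card_bij (fun a _ => f a) (fun a ha => ?_) (fun a _ b _ h => hf h) fun b hb => ?_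
  · simpa using ha
  · obtain ⟨a, rfl⟩ := e.surjective b
    exact ⟨a, Finset.mem_filter.mpr ⟨Finset.mem_univ _, (Finset.mem_filter.mp hb).2⟩, rfl⟩

/-- Markov's inequality. -/
theorem pr_le_sum_div {p : α → Prop} {g : α → ℝ} (hg : ∀ a, 0 ≤ g a) (h : ∀ a, p a → 1 ≤ g a) :
    pr p ≤ (∑ a, g a) / Fintype.card α := by
  classical
  rw [pr_eq]
  gcongr
  rw [Finset.card_eq_sum_ones, Nat.cast_sum, Finset.sum_filter]
  refine Finset.sum_le_sum fun a _ => ?_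
  split_ifs with ha
  · simpa using h a ha
  · exact hg a

/-- An upper bound for the probability that many of `m` independent objects have a given
property. -/
theorem pr_count_le [Nonempty α] (Q : α → Prop) {q : ℝ} (hq : pr Q ≤ q) (m : ℕ) (s : ℝ) :
    pr (fun Φ : Fin m → α => s ≤ ((@Finset.filter (Fin m) (fun i => Q (Φ i))
      (Classical.decPred _) Finset.univ).card : ℝ)) ≤ Real.exp (m * q * Real.exp 1 - s) := by
  classical
  have h0 : (0 : ℝ) < Fintype.card α := by exact_mod_cast Fintype.card_pos
  -- Exponential moment with parameter 1, which factors over the independent coordinates.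
  refine (pr_le_sum_div (g := fun Φ : Fin m → α =>
    Real.exp (-s) * ∏ i, (if Q (Φ i) then Real.exp 1 else 1)) (fun Φ => ?_) fun Φ h => ?_).trans ?_
  · refine mul_nonneg (Real.exp_nonneg _) (Finset.prod_nonneg fun i _ => ?_)
    split_ifs
    · exact Real.exp_nonneg _
    · exact zero_le_one
  · have hprod : ∏ i, (if Q (Φ i) then Real.exp 1 else 1) =
        Real.exp ((Finset.univ.filter fun i => Q (Φ i)).card : ℝ) := by
      rw [Finset.prod_ite, Finset.prod_const, Finset.prod_const_one, mul_one, ← Real.exp_nat_mul,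
        mul_one]
    rw [hprod, ← Real.exp_add]
    refine Real.one_le_exp ?_
    have h' : s ≤ ((Finset.univ.filter fun i => Q (Φ i)).card : ℝ) := by convert h
    linarith
  · rw [← Finset.mul_sum]
    have hpow : ∑ Φ : Fin m → α, ∏ i, (if Q (Φ i) then Real.exp 1 else 1) =
        (∑ a : α, if Q a then Real.exp 1 else 1) ^ m := by
      rw [← Fin.prod_const m, Finset.prod_univ_sum, Fintype.piFinset_univ]
    rw [hpow, Fintype.card_fun, Fintype.card_fin, Nat.cast_pow, mul_div_assoc, ← div_pow]
    have hsum : (∑ a : α, if Q a then Real.exp 1 else 1) / Fintype.card α ≤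
        Real.exp (q * Real.exp 1) := by
      have h1 : (∑ a : α, if Q a then Real.exp 1 else 1) / Fintype.card α =
          1 + pr Q * (Real.exp 1 - 1) := by
        have h2 : ∀ a : α, (if Q a then Real.exp 1 else 1) =
            1 + (if Q a then 1 else 0) * (Real.exp 1 - 1) := by
          intro a
          split_ifs <;> ring
        rw [Finset.sum_congr rfl fun a _ => h2 a, Finset.sum_add_distrib, ← Finset.sum_mul,
          Finset.sum_boole, Finset.sum_const, Finset.card_univ, nsmul_eq_mul, mul_one, add_div,
          div_self h0.ne', pr]
        ring_nf
      rw [h1]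
      have h3 := Real.add_one_le_exp (q * Real.exp 1)
      have h4 := Real.exp_pos 1
      have h5 := pr_nonneg Q
      nlinarith
    have hnn : 0 ≤ (∑ a : α, if Q a then Real.exp 1 else 1) / Fintype.card α := by
      refine div_nonneg (Finset.sum_nonneg fun a _ => ?_) h0.le
      split_ifs
      · exact Real.exp_nonneg _
      · exact zero_le_one
    refine (mul_le_mul_of_nonneg_left (pow_le_pow_left₀ hnn hsum m)
      (Real.exp_nonneg _)).trans (le_of_eq ?_)
    rw [← Real.exp_nat_mul, ← Real.exp_add]
    ring_nf

/-- The number of small subsets. -/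
theorem card_small_subsets_le (n : ℕ) {b x : ℝ} (hx : 0 < x) (hx1 : x ≤ 1) :
    ((Finset.univ.filter fun P : Finset (Fin n) => (P.card : ℝ) ≤ b).card : ℝ) ≤
      Real.exp (n * x - b * Real.log x) := by
  -- Since x ≤ 1, every P with at most b elements contributes at least x ^ b to this generating sum.
  have h1 : ∑ P : Finset (Fin n), x ^ P.card = (x + 1) ^ n := by
    have := Finset.sum_pow_mul_eq_add_pow x 1 (Finset.univ : Finset (Fin n))
    simpa using this
  have h2 : ((Finset.univ.filter fun P : Finset (Fin n) => (P.card : ℝ) ≤ b).card : ℝ) *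
      Real.exp (b * Real.log x) ≤ ∑ P : Finset (Fin n), x ^ P.card := by
    rw [← nsmul_eq_mul, ← Finset.sum_const]
    refine (Finset.sum_le_sum fun P hP => ?_).trans
      (Finset.sum_le_sum_of_subset_of_nonneg (Finset.filter_subset _ _) fun P _ _ => by positivity)
    rw [← Real.exp_log (pow_pos hx P.card), Real.log_pow]
    exact Real.exp_le_exp.mpr
      (mul_le_mul_of_nonpos_right (Finset.mem_filter.mp hP).2 (Real.log_nonpos hx.le hx1))
  have h3 : (x + 1) ^ n ≤ Real.exp (n * x) := by
    rw [Real.exp_nat_mul]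
    exact pow_le_pow_left₀ (by positivity) (Real.add_one_le_exp x) n
  rw [Real.exp_sub, le_div_iff₀ (Real.exp_pos _)]
  exact h2.trans (h1.le.trans h3)

end Probability

/-! ### Probabilities of the patterns for one random clause. -/

section ClauseProbabilities

variable {k n : ℕ}

theorem card_clause : Fintype.card (Fin k → Lit n) = (2 * n) ^ k := by
  simp [mul_comm]

theorem pr_forall_mem_le (hn : 0 < n) (S : Fin k → Finset (Lit n)) (u : Fin k → ℝ)
    (h : ∀ j, ((S j).card : ℝ) ≤ u j * (2 * n)) :
    pr (fun a : Fin k → Lit n => ∀ j, a j ∈ S j) ≤ ∏ j, u j := by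
  classical
  have hn' : (0 : ℝ) < 2 * n := by positivity
  have h1 : (Finset.univ.filter fun a : Fin k → Lit n => ∀ j, a j ∈ S j) = Fintype.piFinset S := by
    ext a
    simp
  rw [pr_eq, h1, Fintype.card_piFinset, card_clause, Nat.cast_prod, div_le_iff₀ (by positivity)]
  push_cast
  rw [← Fin.prod_const k, ← Finset.prod_mul_distrib]
  exact Finset.prod_le_prod (fun j _ => Nat.cast_nonneg _) fun j _ => h j

/-- The literals that are negative with a variable below `b`, or positive with a variable
below `c`. -/
def litsBelow (n b c : ℕ) : Finset (Lit n) :=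
  Finset.univ.filter fun l => (l.2 = false → l.1.val < b) ∧ (l.2 = true → l.1.val < c)

theorem card_litsBelow_le (n b c : ℕ) : (litsBelow n b c).card ≤ b + c := by
  classical
  have h : litsBelow n b c ⊆
      (Finset.univ.filter fun x : Fin n => x.val < b).map
        ⟨fun x => (x, false), fun x y h => (Prod.ext_iff.mp h).1⟩ ∪
      (Finset.univ.filter fun x : Fin n => x.val < c).map
        ⟨fun x => (x, true), fun x y h => (Prod.ext_iff.mp h).1⟩ := by
    rintro ⟨x, s⟩ hl
    have hl' := (Finset.mem_filter.mp hl).2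
    rw [Finset.mem_union, Finset.mem_map, Finset.mem_map]
    rcases s with _ | _
    · exact Or.inl ⟨x, Finset.mem_filter.mpr ⟨Finset.mem_univ _, hl'.1 rfl⟩, rfl⟩
    · exact Or.inr ⟨x, Finset.mem_filter.mpr ⟨Finset.mem_univ _, hl'.2 rfl⟩, rfl⟩
  have hc : ∀ b : ℕ, (Finset.univ.filter fun x : Fin n => x.val < b).card ≤ b := by
    intro b
    have : (Finset.univ.filter fun x : Fin n => x.val < b).card ≤ (Finset.range b).card :=
      Finset.card_le_card_of_injOn Fin.val (fun x hx => by simpa using hx)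
        (fun x _ y _ h => Fin.ext h)
    simpa using this
  refine (Finset.card_le_card h).trans ((Finset.card_union_le _ _).trans ?_)
  rw [Finset.card_map, Finset.card_map]
  exact Nat.add_le_add (hc b) (hc c)

theorem pr_allNegative_le (hn : 0 < n) :
    pr (fun a : Fin k → Lit n => ∀ j, (a j).2 = false) ≤ (1 / 2) ^ k := by
  have h := pr_forall_mem_le (k := k) hn (fun _ => litsBelow n n 0) (fun _ => 1 / 2) fun j => by
    have : ((litsBelow n n 0).card : ℝ) ≤ ((n + 0 : ℕ) : ℝ) := by
      exact_mod_cast card_litsBelow_le n n 0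
    push_cast at this
    linarith
  rw [Fin.prod_const] at h
  refine (pr_mono fun a ha j => ?_).trans h
  simp [litsBelow, ha j]

theorem pr_noneLarge_le (hn : 0 < n) {B : ℕ} {β : ℝ} (hB : (B : ℝ) ≤ β * n) :
    pr (NoneLarge B : (Fin k → Lit n) → Prop) ≤ (1 / 2) ^ k * β ^ (k₁ k - 1) := by
  have hn' : (0 : ℝ) < n := by exact_mod_cast hn
  have h := pr_forall_mem_le (k := k) hn
    (fun j => if j.val + 1 < k₁ k then litsBelow n B 0 else litsBelow n n 0)
    (fun j => 1 / 2 * if j.val + 1 < k₁ k then β else 1) fun j => by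
      split_ifs
      · have : ((litsBelow n B 0).card : ℝ) ≤ ((B + 0 : ℕ) : ℝ) := by
          exact_mod_cast card_litsBelow_le n B 0
        push_cast at this
        linarith
      · have : ((litsBelow n n 0).card : ℝ) ≤ ((n + 0 : ℕ) : ℝ) := by
          exact_mod_cast card_litsBelow_le n n 0
        push_cast at this
        linarith
  have hcard : (Finset.univ.filter fun j : Fin k => j.val + 1 < k₁ k).card = k₁ k - 1 := by
    have h1 : (Finset.univ.filter fun j : Fin k => j.val + 1 < k₁ k).map Fin.valEmbedding =
        Finset.range (k₁ k - 1) := by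
      ext x
      simp only [Finset.mem_map, Finset.mem_filter, Finset.mem_univ, true_and, Finset.mem_range,
        Fin.valEmbedding_apply]
      constructor
      · rintro ⟨j, hj, rfl⟩
        omega
      · intro hx
        refine ⟨⟨x, ?_⟩, by simp only; omega, rfl⟩
        unfold k₁ at hx
        omega
    rw [← Finset.card_map Fin.valEmbedding, h1, Finset.card_range]
  rw [Finset.prod_mul_distrib, Fin.prod_const, Finset.prod_ite, Finset.prod_const,
    Finset.prod_const_one, mul_one, hcard] at h
  refine (pr_mono fun a ha j => ?_).trans h
  have h1 := ha.1 j
  have h2 := ha.2 j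
  split_ifs with hj
  · simp [litsBelow, h1, h2 hj]
  · simp [litsBelow, h1]

/-- Union over the k² choices of c and l. Compared with a factor 1/2 for each position, c costs a
factor 2δ and the unconstrained l a factor 2. -/
theorem pr_hits_le (hn : 0 < n) {Θ : ℕ} {θ δ : ℝ} (hΘ : (Θ : ℝ) ≤ θ * n) (hθ : 0 ≤ θ)
    {P : Finset (Fin n)} (hP : (P.card : ℝ) ≤ δ * n) :
    pr (Hits Θ P : (Fin k → Lit n) → Prop) ≤ (1 / 2) ^ k * (k ^ 2 * (4 * δ) * (1 + θ) ^ k) := by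
  classical
  have hn' : (0 : ℝ) < n := by exact_mod_cast hn
  have hδ : 0 ≤ δ := by
    have h1 : (0 : ℝ) ≤ δ * n := (Nat.cast_nonneg _).trans hP
    exact nonneg_of_mul_nonneg_left h1 hn'
  have hlit : ((litsBelow n n Θ).card : ℝ) ≤ n + Θ := by
    exact_mod_cast card_litsBelow_le n n Θ
  have h := pr_exists_le_card_mul (α := Fin k → Lit n) (Finset.univ : Finset (Fin k × Fin k))
    (fun cl a => ∀ j, a j ∈ if j = cl.1 then P ×ˢ Finset.univ else if j = cl.2 then Finset.univ
      else litsBelow n n Θ) (q := (1 / 2) ^ k * ((4 * δ) * (1 + θ) ^ k)) fun cl _ => by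
    refine (pr_forall_mem_le hn _ (fun j => 1 / 2 * ((if j = cl.1 then 2 * δ else 1) *
      (if j = cl.2 then 2 else 1) * (1 + θ))) fun j => ?_).trans (le_of_eq ?_)
    · have e1 : (0 : ℝ) ≤ δ * n := by positivity
      have e2 : (0 : ℝ) ≤ δ * n * θ := by positivity
      have e3 : (0 : ℝ) ≤ θ * n := by positivity
      split_ifs
      · rw [Finset.card_product]
        simp only [Finset.card_univ, Fintype.card_bool]
        push_cast
        nlinarith
      · rw [Finset.card_product]
        simp only [Finset.card_univ, Fintype.card_bool]
        push_cast
        nlinarith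
      · simp only [Finset.card_univ, Fintype.card_prod, Fintype.card_fin, Fintype.card_bool]
        push_cast
        nlinarith
      · nlinarith
    · rw [Finset.prod_mul_distrib, Finset.prod_mul_distrib, Finset.prod_mul_distrib,
        Fin.prod_const, Fin.prod_const, Finset.prod_ite_eq' , Finset.prod_ite_eq']
      simp only [Finset.mem_univ, if_true]
      ring
  rw [Finset.card_univ, Fintype.card_prod, Fintype.card_fin] at h
  refine (pr_mono fun a ha => ?_).trans (h.trans (le_of_eq ?_))
  · obtain ⟨c, l, hc, hl⟩ := ha
    refine ⟨(c, l), Finset.mem_univ _, fun j => ?_⟩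
    split_ifs with h1 h2
    · subst h1
      simpa using hc
    · exact Finset.mem_univ _
    · simpa [litsBelow] using hl j h1 h2
  · push_cast
    ring

theorem card_window (k : ℕ) :
    (Finset.univ.filter fun j : Fin k => k₁ k < j.val + 1 ∧ j.val + 1 + 5 ≤ k).card =
      k - 5 - k₁ k := by
  have h1 : (Finset.univ.filter fun j : Fin k =>
      k₁ k < j.val + 1 ∧ j.val + 1 + 5 ≤ k).map Fin.valEmbedding =
      Finset.Ico (k₁ k) (k - 5) := by
    ext x
    simp only [Finset.mem_map, Finset.mem_filter, Finset.mem_univ, true_and, Finset.mem_Ico,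
      Fin.valEmbedding_apply]
    constructor
    · rintro ⟨j, hj, rfl⟩
      omega
    · intro hx
      exact ⟨⟨x, by omega⟩, by simp only; omega, rfl⟩
  rw [← Finset.card_map Fin.valEmbedding, h1, Nat.card_Ico]

/-- Union over the k³ choices of l and of two positions covering the large negative literals of the
window. Every other window position is confined to at most B + Θ of the 2n literals. -/
theorem pr_fewLarge_le (hn : 0 < n) {Θ B : ℕ} {θ β : ℝ} (hΘ : (Θ : ℝ) ≤ θ * n) (hθ : 0 ≤ θ)
    (hB : (B : ℝ) ≤ β * n) (hβ : 0 ≤ β) (hβθ : β + θ ≤ 1) :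
    pr (FewLarge Θ B : (Fin k → Lit n) → Prop) ≤
      (1 / 2) ^ k * (k ^ 3 * 8 * (1 + θ) ^ k * (β + θ) ^ (k - 5 - k₁ k - 3)) := by
  classical
  have hn' : (0 : ℝ) < n := by exact_mod_cast hn
  have hlit : ((litsBelow n n Θ).card : ℝ) ≤ n + Θ := by
    exact_mod_cast card_litsBelow_le n n Θ
  have hlit' : ((litsBelow n B Θ).card : ℝ) ≤ B + Θ := by
    exact_mod_cast card_litsBelow_le n B Θ
  let W : Finset (Fin k) :=
    Finset.univ.filter fun j : Fin k => k₁ k < j.val + 1 ∧ j.val + 1 + 5 ≤ k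
  have h := pr_exists_le_card_mul (α := Fin k → Lit n)
    (Finset.univ : Finset (Fin k × Fin k × Fin k))
    (fun e a => ∀ j, a j ∈ if j ∈ ({e.1, e.2.1, e.2.2} : Finset (Fin k)) then Finset.univ else
      if j ∈ W then litsBelow n B Θ else litsBelow n n Θ)
    (q := (1 / 2) ^ k * (8 * (1 + θ) ^ k * (β + θ) ^ (k - 5 - k₁ k - 3))) fun e _ => by
    set E : Finset (Fin k) := {e.1, e.2.1, e.2.2} with hE
    have hEc : E.card ≤ 3 := Finset.card_le_three
    refine (pr_forall_mem_le hn _ (fun j => 1 / 2 * ((if j ∈ E then 2 else 1) *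
      (if j ∈ W \ E then β + θ else 1) * (1 + θ))) fun j => ?_).trans ?_
    · by_cases h1 : j ∈ E
      · rw [if_pos h1, if_pos h1, if_neg (by simp [h1])]
        simp only [Finset.card_univ, Fintype.card_prod, Fintype.card_fin, Fintype.card_bool]
        push_cast
        have : 0 ≤ θ * n := by positivity
        nlinarith
      · rw [if_neg h1, if_neg h1]
        by_cases h2 : j ∈ W
        · rw [if_pos h2, if_pos (by simp [h1, h2])]
          have : 0 ≤ (β + θ) * θ * n := by positivity
          nlinarith
        · rw [if_neg h2, if_neg (by simp [h2])]
          nlinarith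
    · rw [Finset.prod_mul_distrib, Finset.prod_mul_distrib, Finset.prod_mul_distrib,
        Fin.prod_const, Fin.prod_const, Finset.prod_ite_mem, Finset.prod_ite_mem,
        Finset.univ_inter, Finset.univ_inter, Finset.prod_const, Finset.prod_const]
      have h8 : (2 : ℝ) ^ E.card ≤ 8 := by
        calc (2 : ℝ) ^ E.card ≤ 2 ^ 3 := pow_le_pow_right₀ (by norm_num) hEc
          _ = 8 := by norm_num
      have hW : (β + θ) ^ (W \ E).card ≤ (β + θ) ^ (k - 5 - k₁ k - 3) := by
        refine pow_le_pow_of_le_one (by positivity) hβθ ?_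
        have h3 := Finset.le_card_sdiff E W
        have h4 : W.card = k - 5 - k₁ k := card_window k
        omega
      have hmul : (2 : ℝ) ^ E.card * (β + θ) ^ (W \ E).card ≤
          8 * (β + θ) ^ (k - 5 - k₁ k - 3) := by gcongr
      calc (1 / 2 : ℝ) ^ k * (2 ^ E.card * (β + θ) ^ (W \ E).card * (1 + θ) ^ k)
          ≤ (1 / 2) ^ k * (8 * (β + θ) ^ (k - 5 - k₁ k - 3) * (1 + θ) ^ k) := by gcongr
        _ = _ := by ring
  rw [Finset.card_univ, Fintype.card_prod, Fintype.card_prod, Fintype.card_fin] at h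
  refine (pr_mono fun a ha => ?_).trans (h.trans (le_of_eq ?_))
  · obtain ⟨⟨l, hl⟩, hlt⟩ := ha
    obtain ⟨j₁, j₂, hj⟩ : ∃ j₁ j₂ : Fin k, (Finset.univ.filter fun j : Fin k => k₁ k < j.val + 1 ∧
        j.val + 1 + 5 ≤ k ∧ (a j).2 = false ∧ B ≤ (a j).1.val) ⊆ {j₁, j₂} := by
      generalize (Finset.univ.filter fun j : Fin k => k₁ k < j.val + 1 ∧
        j.val + 1 + 5 ≤ k ∧ (a j).2 = false ∧ B ≤ (a j).1.val) = F at hlt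
      have hc : F.card = 0 ∨ F.card = 1 ∨ F.card = 2 := by omega
      rcases hc with h0 | h0 | h0
      · rw [Finset.card_eq_zero] at h0
        exact ⟨l, l, by simp [h0]⟩
      · obtain ⟨x, hx⟩ := Finset.card_eq_one.mp h0
        exact ⟨x, x, by simp [hx]⟩
      · obtain ⟨x, y, -, hx⟩ := Finset.card_eq_two.mp h0
        exact ⟨x, y, by simp [hx]⟩
    refine ⟨(l, j₁, j₂), Finset.mem_univ _, fun j => ?_⟩
    split_ifs with h1 h2
    · exact Finset.mem_univ _
    · simp only [Finset.mem_insert, Finset.mem_singleton, not_or] at h1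
      refine Finset.mem_filter.mpr ⟨Finset.mem_univ _, fun hs => ?_, hl j h1.1⟩
      by_contra hge
      have hw := (Finset.mem_filter.mp h2).2
      have := hj (Finset.mem_filter.mpr ⟨Finset.mem_univ j, hw.1, hw.2, hs, not_lt.mp hge⟩)
      simp only [Finset.mem_insert, Finset.mem_singleton] at this
      tauto
    · simp only [Finset.mem_insert, Finset.mem_singleton, not_or] at h1
      simpa [litsBelow] using hl j h1.1
  · push_cast
    ring

/-- Given the variable in one position, five are possible in the other. For m linear in n the
expected number of such clauses thus stays bounded. -/
theorem pr_close_le (hn : 0 < n) :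
    pr (Close : (Fin k → Lit n) → Prop) ≤ k ^ 2 * 5 / n := by
  classical
  have hn' : (0 : ℝ) < n := by exact_mod_cast hn
  let F : Fin n → Finset (Fin n) := fun v =>
    Finset.univ.filter fun x => x.val ≤ v.val + 2 ∧ v.val ≤ x.val + 2
  have hF : ∀ v, ((F v).card : ℝ) ≤ 5 := by
    intro v
    have h1 : (F v).card ≤ (Finset.Icc (v.val - 2) (v.val + 2)).card := by
      refine Finset.card_le_card_of_injOn Fin.val (fun x hx => ?_) (fun x _ y _ h => Fin.ext h)
      have := (Finset.mem_filter.mp hx).2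
      rw [Finset.mem_coe, Finset.mem_Icc]
      omega
    rw [Nat.card_Icc] at h1
    exact_mod_cast (by omega : (F v).card ≤ 5)
  have h := pr_exists_le_card_mul (α := Fin k → Lit n)
    (Finset.univ.filter fun e : Fin k × Fin k × Fin n => e.1 ≠ e.2.1)
    (fun e a => ∀ j, a j ∈ if j = e.1 then {e.2.2} ×ˢ Finset.univ else
      if j = e.2.1 then F e.2.2 ×ˢ Finset.univ else Finset.univ)
    (q := 1 / n * (5 / n)) fun e he => by
    have hne := (Finset.mem_filter.mp he).2
    refine (pr_forall_mem_le hn _ (fun j => (if j = e.1 then 1 / (n : ℝ) else 1) *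
      (if j = e.2.1 then 5 / (n : ℝ) else 1)) fun j => ?_).trans (le_of_eq ?_)
    · split_ifs with h1 h2 h2
      · exact absurd (h1.symm.trans h2) hne
      · rw [Finset.card_product]
        simp only [Finset.card_singleton, Finset.card_univ, Fintype.card_bool]
        push_cast
        rw [mul_one]
        field_simp
        norm_num
      · rw [Finset.card_product]
        simp only [Finset.card_univ, Fintype.card_bool]
        push_cast
        have := hF e.2.2
        have h3 : (1 : ℝ) * (5 / n) * (2 * n) = 10 := by field_simp; norm_num
        rw [h3]
        linarith
      · simp only [Finset.card_univ, Fintype.card_prod, Fintype.card_fin, Fintype.card_bool]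
        push_cast
        linarith
    · rw [Finset.prod_mul_distrib, Finset.prod_ite_eq', Finset.prod_ite_eq']
      simp
  refine (pr_mono fun a ha => ?_).trans (h.trans ?_)
  · obtain ⟨l, l', hne, h1, h2⟩ := ha
    refine ⟨(l, l', (a l).1), Finset.mem_filter.mpr ⟨Finset.mem_univ _, hne⟩, fun j => ?_⟩
    split_ifs with hj hj'
    · subst hj
      exact Finset.mem_product.mpr ⟨Finset.mem_singleton_self _, Finset.mem_univ _⟩
    · subst hj'
      exact Finset.mem_product.mpr
        ⟨Finset.mem_filter.mpr ⟨Finset.mem_univ _, h2, h1⟩, Finset.mem_univ _⟩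
    · exact Finset.mem_univ _
  · have hc : ((Finset.univ.filter fun e : Fin k × Fin k × Fin n => e.1 ≠ e.2.1).card : ℝ) ≤
        k * (k * n) := by
      have := Finset.card_filter_le (Finset.univ : Finset (Fin k × Fin k × Fin n))
        (fun e => e.1 ≠ e.2.1)
      rw [Finset.card_univ, Fintype.card_prod, Fintype.card_prod, Fintype.card_fin,
        Fintype.card_fin] at this
      exact_mod_cast this
    refine (mul_le_mul_of_nonneg_right hc (by positivity)).trans (le_of_eq ?_)
    field_simp

end ClauseProbabilities

/-! ### The number of safe variables for fixed Z and Z'. -/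

section SafeVariables

variable {k n m : ℕ}

/-- The variables that are `(Z, Z')`-safe. -/
def safeVars (Z Z' : Finset (Fin n)) (Φ : Formula k n m) : Finset (Fin n) :=
  Finset.univ.filter fun x => ¬ Unsafe₂ Φ Z Z' x

open Classical in
/-- The variables outside `Z ∪ Z'` that a clause makes unsafe. -/
noncomputable def covered (Z Z' : Finset (Fin n)) (a : Fin k → Lit n) : Finset (Fin n) :=
  Finset.univ.filter fun x => x ∉ Z ∪ Z' ∧
    ∃ l, (∀ j, j ≠ l → FalseLit Z Z' (a j)) ∧ a l = (x, true)

/-- A second critical position would hold a positive literal outside Z ∪ Z', which is not false for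
sure. -/
theorem card_covered_le_one (Z Z' : Finset (Fin n)) (a : Fin k → Lit n) :
    (covered Z Z' a).card ≤ 1 := by
  refine Finset.card_le_one.mpr fun x hx y hy => ?_
  obtain ⟨hx0, l, hl, hlx⟩ := (Finset.mem_filter.mp hx).2
  obtain ⟨-, l', -, hly⟩ := (Finset.mem_filter.mp hy).2
  by_cases h : l = l'
  · subst h
    rw [hlx] at hly
    exact (Prod.ext_iff.mp hly).1
  · obtain ⟨hy0, -⟩ := (Finset.mem_filter.mp hy).2
    have := hl l' (Ne.symm h)
    rw [hly] at this
    simp only [FalseLit] at this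
    rcases this with h1 | h1
    · exact absurd h1.2 hy0
    · exact absurd h1.1 (by simp)

/-- Each clause removes its own covered set, whatever the other clauses are; this is what allows an
induction over independent clauses. -/
theorem safeVars_cons (Z Z' : Finset (Fin n)) (a : Fin k → Lit n) (Φ : Formula k n m) :
    safeVars Z Z' (Fin.cons a Φ : Formula k n (m + 1)) = safeVars Z Z' Φ \ covered Z Z' a := by
  classical
  ext x
  simp only [safeVars, covered, Unsafe₂, Finset.mem_filter, Finset.mem_univ, true_and,
    Finset.mem_sdiff, Fin.exists_fin_succ, Fin.cons_zero, Fin.cons_succ, FalseLit]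
  have key : ∀ p q r : Prop, ¬ (p ∨ q ∨ r) ↔ ¬ (p ∨ r) ∧ ¬ (¬ p ∧ q) := by tauto
  exact key _ _ _

/-- The positive literals that Z makes false are balanced by the negative ones that it makes true,
so only |Z'| matters. With |Z'| ≤ n k⁻¹² the k-th power of the correction stays close to 1. -/
theorem card_falseLits_le (Z Z' : Finset (Fin n)) :
    (Finset.univ.filter fun l : Lit n => FalseLit Z Z' l).card ≤ n + Z'.card := by
  classical
  have h : (Finset.univ.filter fun l : Lit n => FalseLit Z Z' l) ⊆
      (Z ∪ Z').map ⟨fun x => (x, true), fun x y h => (Prod.ext_iff.mp h).1⟩ ∪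
      Zᶜ.map ⟨fun x => (x, false), fun x y h => (Prod.ext_iff.mp h).1⟩ := by
    rintro ⟨x, s⟩ hl
    have hl' := (Finset.mem_filter.mp hl).2
    rw [Finset.mem_union, Finset.mem_map, Finset.mem_map]
    rcases hl' with h1 | h1
    · exact Or.inl ⟨x, h1.2, Prod.ext rfl h1.1.symm⟩
    · exact Or.inr ⟨x, Finset.mem_compl.mpr h1.2, Prod.ext rfl h1.1.symm⟩
  have h1 := (Finset.card_le_card h).trans (Finset.card_union_le _ _)
  rw [Finset.card_map, Finset.card_map, Finset.card_compl, Fintype.card_fin] at h1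
  have h2 := Finset.card_union_le Z Z'
  have h3 := Finset.card_le_univ Z
  rw [Fintype.card_fin] at h3
  omega

theorem pr_mem_covered_le (hn : 0 < n) {Z Z' : Finset (Fin n)} {ζ : ℝ} (hζ : 0 ≤ ζ)
    (hZ' : (Z'.card : ℝ) ≤ ζ * n) (x : Fin n) :
    pr (fun a : Fin k → Lit n => x ∈ covered Z Z' a) ≤
      k * ((1 / 2) ^ k * (1 + ζ) ^ k * (1 / n)) := by
  classical
  have hn' : (0 : ℝ) < n := by exact_mod_cast hn
  have hF : ((Finset.univ.filter fun l : Lit n => FalseLit Z Z' l).card : ℝ) ≤ n + Z'.card := by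
    exact_mod_cast card_falseLits_le Z Z'
  have h := pr_exists_le_card_mul (α := Fin k → Lit n) (Finset.univ : Finset (Fin k))
    (fun l a => ∀ j, a j ∈ if j = l then {(x, true)} else
      Finset.univ.filter fun l : Lit n => FalseLit Z Z' l)
    (q := (1 / 2) ^ k * (1 + ζ) ^ k * (1 / n)) fun l _ => by
    refine (pr_forall_mem_le hn _ (fun j => 1 / 2 * (1 + ζ) *
      (if j = l then 1 / (n : ℝ) else 1)) fun j => ?_).trans (le_of_eq ?_)
    · split_ifs
      · rw [Finset.card_singleton]
        have h3 : 1 / 2 * (1 + ζ) * (1 / (n : ℝ)) * (2 * n) = 1 + ζ := by field_simp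
        rw [h3]
        push_cast
        linarith
      · linarith
    · rw [Finset.prod_mul_distrib, Finset.prod_mul_distrib, Fin.prod_const, Fin.prod_const,
        Finset.prod_ite_eq', if_pos (Finset.mem_univ _)]
  rw [Finset.card_univ, Fintype.card_fin] at h
  refine (pr_mono fun a ha => ?_).trans h
  obtain ⟨-, l, hl, hlx⟩ := (Finset.mem_filter.mp ha).2
  refine ⟨l, Finset.mem_univ _, fun j => ?_⟩
  split_ifs with hj
  · rw [hj, hlx]
    exact Finset.mem_singleton_self _
  · exact Finset.mem_filter.mpr ⟨Finset.mem_univ _, hl j hj⟩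

/-- A random clause removes at most one element of D, and any given one with probability at most q.
Since exp(b) - 1 ≤ b(1 + c) for 0 ≤ b ≤ c ≤ 1, averaging multiplies the exponent b by 1 - q(1 + c).
-/
theorem sum_exp_sdiff_covered_le (hn : 0 < n) {Z Z' D : Finset (Fin n)} {q b c : ℝ}
    (hq : ∀ x, pr (fun a : Fin k → Lit n => x ∈ covered Z Z' a) ≤ q) (hq0 : 0 ≤ q)
    (hb : 0 ≤ b) (hbc : b ≤ c) (hc : c ≤ 1) :
    ∑ a : Fin k → Lit n, Real.exp (-b * (D \ covered Z Z' a).card) ≤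
      Fintype.card (Fin k → Lit n) * Real.exp (-b * (1 - q * (1 + c)) * D.card) := by
  classical
  have hA : (0 : ℝ) < Fintype.card (Fin k → Lit n) := by
    rw [card_clause]
    positivity
  have h1 : ∀ a : Fin k → Lit n, Real.exp (-b * (D \ covered Z Z' a).card) ≤
      Real.exp (-b * D.card) * (1 + (Real.exp b - 1) * (D ∩ covered Z Z' a).card) := by
    intro a
    have h2 := Finset.card_sdiff_add_card_inter D (covered Z Z' a)
    have h3 : (D ∩ covered Z Z' a).card ≤ 1 :=
      (Finset.card_le_card Finset.inter_subset_right).trans (card_covered_le_one Z Z' a)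
    have h4 : (D ∩ covered Z Z' a).card = 0 ∨ (D ∩ covered Z Z' a).card = 1 := by omega
    rw [← h2]
    rcases h4 with h4 | h4
    · rw [h4]
      simp
    · rw [h4]
      push_cast
      rw [mul_one, add_sub_cancel, ← Real.exp_add]
      exact Real.exp_le_exp.mpr (by linarith)
  have h5 : ∑ a : Fin k → Lit n, ((D ∩ covered Z Z' a).card : ℝ) ≤
      D.card * (q * Fintype.card (Fin k → Lit n)) := by
    have h6 : ∀ a : Fin k → Lit n, ((D ∩ covered Z Z' a).card : ℝ) =
        ∑ x ∈ D, if x ∈ covered Z Z' a then 1 else 0 := by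
      intro a
      rw [Finset.sum_boole]
      congr 2
    rw [Finset.sum_congr rfl fun a _ => h6 a, Finset.sum_comm, ← nsmul_eq_mul]
    refine Finset.sum_le_card_nsmul _ _ _ fun x _ => ?_
    have := hq x
    rw [pr_eq, div_le_iff₀ hA] at this
    rw [Finset.sum_boole]
    exact this
  refine (Finset.sum_le_sum fun a _ => h1 a).trans ?_
  rw [← Finset.mul_sum, Finset.sum_add_distrib, ← Finset.mul_sum, Finset.sum_const,
    Finset.card_univ, nsmul_eq_mul, mul_one]
  have hexp : Real.exp b - 1 ≤ b * (1 + c) := by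
    have := (abs_le.mp (Real.abs_exp_sub_one_sub_id_le
      (by rw [abs_of_nonneg hb]; linarith : |b| ≤ 1))).2
    nlinarith
  have hexp0 : 0 ≤ Real.exp b - 1 := by
    have := Real.add_one_le_exp b
    linarith
  have h7 : (Fintype.card (Fin k → Lit n) : ℝ) +
      (Real.exp b - 1) * ∑ a : Fin k → Lit n, ((D ∩ covered Z Z' a).card : ℝ) ≤
      Fintype.card (Fin k → Lit n) * Real.exp (b * (1 + c) * q * D.card) := by
    have h8 := Real.add_one_le_exp (b * (1 + c) * q * D.card)
    have h9 : (Real.exp b - 1) * (D.card * (q * Fintype.card (Fin k → Lit n))) ≤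
        b * (1 + c) * (D.card * (q * Fintype.card (Fin k → Lit n))) :=
      mul_le_mul_of_nonneg_right hexp (by positivity)
    have h10 := mul_le_mul_of_nonneg_left h5 hexp0
    have h11 := mul_le_mul_of_nonneg_left h8 hA.le
    linarith
  refine (mul_le_mul_of_nonneg_left h7 (Real.exp_nonneg _)).trans (le_of_eq ?_)
  rw [mul_left_comm, ← Real.exp_add]
  congr 2
  ring

/-- Each further clause shrinks b by the factor 1 - q(1 + c), so the induction needs all b in [0, c]
at once. -/
theorem sum_exp_safeVars_le (hn : 0 < n) {Z Z' : Finset (Fin n)} {q c : ℝ}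
    (hq : ∀ x, pr (fun a : Fin k → Lit n => x ∈ covered Z Z' a) ≤ q) (hq0 : 0 ≤ q)
    (hr : 0 ≤ 1 - q * (1 + c)) (hc0 : 0 ≤ c) (hc : c ≤ 1) (m : ℕ) :
    ∀ b : ℝ, 0 ≤ b → b ≤ c → ∑ Φ : Formula k n m, Real.exp (-b * (safeVars Z Z' Φ).card) ≤
      (Fintype.card (Fin k → Lit n) : ℝ) ^ m *
        Real.exp (-b * (1 - q * (1 + c)) ^ m * (n - (Z ∪ Z').card)) := by
  classical
  induction m with
  | zero =>
    intro b _ _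
    have h : ∀ Φ : Formula k n 0, safeVars Z Z' Φ = (Z ∪ Z')ᶜ := by
      intro Φ
      ext x
      simp [safeVars, Unsafe₂]
    have h1 : (((Z ∪ Z')ᶜ).card : ℝ) = n - (Z ∪ Z').card := by
      have h2 := Finset.card_add_card_compl (Z ∪ Z')
      rw [Fintype.card_fin] at h2
      have h3 : ((Z ∪ Z').card : ℝ) + ((Z ∪ Z')ᶜ).card = n := by exact_mod_cast h2
      linarith
    simp only [h, h1]
    simp
  | succ m ih =>
    intro b hb hbc
    have hr1 : 1 - q * (1 + c) ≤ 1 := by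
      have : 0 ≤ q * (1 + c) := by positivity
      linarith
    rw [← (Fin.consEquiv fun _ : Fin (m + 1) => Fin k → Lit n).sum_comp, Fintype.sum_prod_type,
      Finset.sum_comm]
    have h1 : ∀ Φ : Formula k n m, ∑ a : Fin k → Lit n, Real.exp (-b *
        (safeVars Z Z' ((Fin.consEquiv fun _ : Fin (m + 1) => Fin k → Lit n) (a, Φ))).card) ≤
        Fintype.card (Fin k → Lit n) *
          Real.exp (-(b * (1 - q * (1 + c))) * (safeVars Z Z' Φ).card) := by
      intro Φ
      have h2 := sum_exp_sdiff_covered_le hn (D := safeVars Z Z' Φ) hq hq0 hb hbc hc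
      rw [neg_mul b] at h2
      refine le_trans (le_of_eq (Finset.sum_congr rfl fun a _ => ?_)) h2
      rw [← safeVars_cons]
      rfl
    refine (Finset.sum_le_sum fun Φ _ => h1 Φ).trans ?_
    rw [← Finset.mul_sum, pow_succ']
    refine (mul_le_mul_of_nonneg_left (ih (b * (1 - q * (1 + c))) (mul_nonneg hb hr)
      ((mul_le_of_le_one_right hb hr1).trans hbc)) (Nat.cast_nonneg _)).trans (le_of_eq ?_)
    rw [show -(b * (1 - q * (1 + c))) * (1 - q * (1 + c)) ^ m * ((n : ℝ) - (Z ∪ Z').card) =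
      -b * (1 - q * (1 + c)) ^ (m + 1) * (n - (Z ∪ Z').card) by ring]
    ring

/-- For given `Z` and `Z'`, it is very unlikely that there are few safe variables. -/
theorem pr_card_safeVars_le (hn : 0 < n) {Z Z' : Finset (Fin n)} {ζ q c g : ℝ} (hζ : 0 ≤ ζ)
    (hZ' : (Z'.card : ℝ) ≤ ζ * n) (hq : k * ((1 / 2) ^ k * (1 + ζ) ^ k * (1 / n)) ≤ q)
    (hr : 0 ≤ 1 - q * (1 + c)) (hc0 : 0 ≤ c) (hc : c ≤ 1)
    (m : ℕ) : pr (fun Φ : Formula k n m => ((safeVars Z Z' Φ).card : ℝ) ≤ g) ≤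
      Real.exp (c * g - c * (1 - q * (1 + c)) ^ m * (n - (Z ∪ Z').card)) := by
  classical
  have hA : (0 : ℝ) < Fintype.card (Fin k → Lit n) := by
    rw [card_clause]
    positivity
  have hq0 : 0 ≤ q := le_trans (by positivity) hq
  have h := sum_exp_safeVars_le hn (fun x => (pr_mem_covered_le (Z := Z) hn hζ hZ' x).trans hq) hq0 hr hc0
    hc m c hc0 le_rfl
  refine (pr_le_sum_div (g := fun Φ : Formula k n m =>
    Real.exp (c * g) * Real.exp (-c * (safeVars Z Z' Φ).card)) (fun Φ => by positivity)
    fun Φ hΦ => ?_).trans ?_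
  · rw [← Real.exp_add]
    refine Real.one_le_exp ?_
    nlinarith
  · rw [← Finset.mul_sum, Fintype.card_fun, Fintype.card_fin, Nat.cast_pow,
      div_le_iff₀ (by positivity)]
    refine (mul_le_mul_of_nonneg_left h (Real.exp_nonneg _)).trans (le_of_eq ?_)
    rw [mul_left_comm, ← Real.exp_add, mul_comm]
    congr 2
    ring

end SafeVariables

/-! ### Rare events for the whole formula, and their union. -/

section Events

variable {k n m : ℕ}

theorem pr_clausesWith_le (hn : 0 < n) {μ w s : ℝ} (hm : (m : ℝ) * (1 / 2) ^ k ≤ μ * n)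
    {Q : (Fin k → Lit n) → Prop} (hw : 0 ≤ w) (hQ : pr Q ≤ (1 / 2) ^ k * w) :
    pr (fun Φ : Formula k n m => s * n ≤ (clausesWith Q Φ).card) ≤
      Real.exp (n * (μ * w * Real.exp 1 - s)) := by
  classical
  have : Nonempty (Fin k → Lit n) := ⟨fun _ => (⟨0, hn⟩, true)⟩
  have h := pr_count_le Q hQ m (s * n)
  refine le_trans (le_of_eq ?_) (h.trans (Real.exp_le_exp.mpr ?_))
  · congr! 4
  · have h1 : (m : ℝ) * (1 / 2) ^ k * (w * Real.exp 1) ≤ μ * n * (w * Real.exp 1) :=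
      mul_le_mul_of_nonneg_right hm (by positivity)
    linarith

/-- The relevant P is produced by the run, hence the union over all small sets; its cost is the
entropy term x - δ log x. -/
theorem pr_exists_hits_le (hn : 0 < n) {μ θ δ η x : ℝ} (hm : (m : ℝ) * (1 / 2) ^ k ≤ μ * n)
    {Θ : ℕ} (hΘ : (Θ : ℝ) ≤ θ * n) (hθ : 0 ≤ θ) (hδ : 0 ≤ δ) (hx : 0 < x) (hx1 : x ≤ 1) :
    pr (fun Φ : Formula k n m => ∃ P : Finset (Fin n), (P.card : ℝ) ≤ δ * n ∧
      η * n ≤ (clausesWith (Hits Θ P) Φ).card) ≤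
      Real.exp (n * (x - δ * Real.log x +
        (μ * (k ^ 2 * (4 * δ) * (1 + θ) ^ k) * Real.exp 1 - η))) := by
  classical
  have h := pr_exists_le_card_mul (α := Formula k n m)
    (Finset.univ.filter fun P : Finset (Fin n) => (P.card : ℝ) ≤ δ * n)
    (fun P Φ => η * n ≤ (clausesWith (Hits Θ P) Φ).card)
    (q := Real.exp (n * (μ * (k ^ 2 * (4 * δ) * (1 + θ) ^ k) * Real.exp 1 - η))) fun P hP =>
      pr_clausesWith_le hn hm (by positivity)
        (pr_hits_le hn hΘ hθ (Finset.mem_filter.mp hP).2)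
  refine (pr_mono fun Φ hΦ => ?_).trans (h.trans ?_)
  · obtain ⟨P, hP, hP'⟩ := hΦ
    exact ⟨P, Finset.mem_filter.mpr ⟨Finset.mem_univ _, hP⟩, hP'⟩
  · refine (mul_le_mul_of_nonneg_right (card_small_subsets_le n hx hx1)
      (Real.exp_nonneg _)).trans (le_of_eq ?_)
    rw [← Real.exp_add]
    congr 1
    ring

/-- The sets Z and Z' are produced by the run, hence the union over all small pairs. At least half
of the variables lie outside Z ∪ Z', which gives the factor 1/2 at κ. -/
theorem pr_exists_few_safe_le (hn : 0 < n) {ζ z q c γ κ x : ℝ} (hζ : 0 ≤ ζ)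
    (hz : z + ζ ≤ 1 / 2) (hq : k * ((1 / 2) ^ k * (1 + ζ) ^ k * (1 / n)) ≤ q)
    (hr : 0 ≤ 1 - q * (1 + c)) (hc0 : 0 ≤ c) (hc : c ≤ 1)
    (hκ : κ ≤ (1 - q * (1 + c)) ^ m) (hx : 0 < x) (hx1 : x ≤ 1) :
    pr (fun Φ : Formula k n m => ∃ Z Z' : Finset (Fin n), (Z.card : ℝ) ≤ z * n ∧
      (Z'.card : ℝ) ≤ ζ * n ∧ ((safeVars Z Z' Φ).card : ℝ) ≤ γ * n) ≤
      Real.exp (n * (2 * x - (z + ζ) * Real.log x + (c * γ - c * κ / 2))) := by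
  classical
  have hn' : (0 : ℝ) < n := by exact_mod_cast hn
  have h := pr_exists_le_card_mul (α := Formula k n m)
    ((Finset.univ.filter fun P : Finset (Fin n) => (P.card : ℝ) ≤ z * n) ×ˢ
      (Finset.univ.filter fun P : Finset (Fin n) => (P.card : ℝ) ≤ ζ * n))
    (fun P Φ => ((safeVars P.1 P.2 Φ).card : ℝ) ≤ γ * n)
    (q := Real.exp (n * (c * γ - c * κ / 2))) fun P hP => by
      obtain ⟨h1, h2⟩ := Finset.mem_product.mp hP
      have h1' := (Finset.mem_filter.mp h1).2
      have h2' := (Finset.mem_filter.mp h2).2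
      refine (pr_card_safeVars_le hn hζ h2' hq hr hc0 hc m).trans (Real.exp_le_exp.mpr ?_)
      have h3 : ((P.1 ∪ P.2).card : ℝ) ≤ P.1.card + P.2.card := by
        exact_mod_cast Finset.card_union_le _ _
      have h4 : (n : ℝ) / 2 ≤ n - (P.1 ∪ P.2).card := by nlinarith
      have h5 : c * κ * (n / 2) ≤ c * (1 - q * (1 + c)) ^ m * (n - (P.1 ∪ P.2).card) := by
        gcongr
      linarith
  refine (pr_mono fun Φ hΦ => ?_).trans (h.trans ?_)
  · obtain ⟨Z, Z', hZ, hZ', hs⟩ := hΦ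
    exact ⟨(Z, Z'), Finset.mem_product.mpr ⟨Finset.mem_filter.mpr ⟨Finset.mem_univ _, hZ⟩,
      Finset.mem_filter.mpr ⟨Finset.mem_univ _, hZ'⟩⟩, hs⟩
  · rw [Finset.card_product, Nat.cast_mul]
    refine (mul_le_mul_of_nonneg_right (mul_le_mul (card_small_subsets_le n hx hx1)
      (card_small_subsets_le n hx hx1) (Nat.cast_nonneg _) (Real.exp_nonneg _))
      (Real.exp_nonneg _)).trans (le_of_eq ?_)
    rw [← Real.exp_add, ← Real.exp_add]
    congr 1
    ring

/-- If `Z'` is large, then some rare event has occurred. -/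
theorem rare_event_of_lt_card (hk : 5 ≤ k) {ρ z γ ν η : ℝ} (hρ : 0 ≤ ρ) (hν : 0 ≤ ν)
    (hzρ : z + ρ ≤ 1 / 2) (hn : 1 ≤ n * (ρ / 3 - 4 * η - 6 * ν))
    {t₀ Θ B : ℕ} (ht₀ : t₀ = ⌊ρ * n / 3⌋₊) (hΘ : Θ = ⌊(z + ρ) * n⌋₊) (hB : B = ⌊(1 - γ) * n⌋₊)
    (Φ : Formula k n m) (h : ρ * n < (phase2 Φ).card) :
    z * n ≤ (clausesWith (fun a => ∀ j, (a j).2 = false) Φ).card ∨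
    (∃ Z Z' : Finset (Fin n), (Z.card : ℝ) ≤ z * n ∧
      (Z'.card : ℝ) ≤ ρ * n ∧ ((safeVars Z Z' Φ).card : ℝ) ≤ γ * n) ∨
    ν * n ≤ (clausesWith (NoneLarge B) (encode 1 (m + t₀) Φ)).card ∨
    ν * n ≤ (clausesWith (FewLarge Θ B) (encode 1 (m + t₀) Φ)).card ∨
    η * n ≤ (clausesWith Close (encode 1 (m + t₀) Φ)).card ∨
    (∃ P : Finset (Fin n), (P.card : ℝ) ≤ 6 * ν * n ∧
      η * n ≤ (clausesWith (Hits Θ P) (encode 1 (m + t₀) Φ)).card) ∨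
    (∃ P : Finset (Fin n), (P.card : ℝ) ≤ 6 * ν * n ∧
      η * n ≤ (clausesWith (Hits Θ P) (encode Fin.revPerm (m + t₀) Φ)).card) := by
  by_contra hcon
  push Not at hcon
  obtain ⟨h0, hS, h1, h2, h3, h4, h5⟩ := hcon
  have hn0 : (0 : ℝ) ≤ n := Nat.cast_nonneg n
  have ht₀' : (t₀ : ℝ) ≤ ρ * n / 3 := by
    rw [ht₀]; exact Nat.floor_le (by positivity)
  have ht₀'' : ρ * n / 3 < t₀ + 1 := by
    rw [ht₀]; exact Nat.lt_floor_add_one _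
  have hstate : ∀ t ≤ m + t₀, ((stZ Φ t).card : ℝ) ≤ z * n ∧ ((stZ' Φ t).card : ℝ) ≤ ρ * n := by
    intro t ht
    obtain ⟨h6, h7⟩ := card_stX_le Φ t₀ ht
    have h6' : ((stZ Φ t).card : ℝ) ≤
        (clausesWith (fun a => ∀ j, (a j).2 = false) Φ).card := by exact_mod_cast h6
    have h7' : ((stZ' Φ t).card : ℝ) ≤ 3 * t₀ := by exact_mod_cast h7
    constructor <;> linarith
  -- Each clause of the first kind yields one suspect and each of the second kind five, hence 6ν.
  have hb : (clausesWith (NoneLarge B) (encode 1 (m + t₀) Φ)).card +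
      5 * (clausesWith (FewLarge Θ B) (encode 1 (m + t₀) Φ)).card ≤ ⌊6 * ν * n⌋₊ := by
    refine Nat.le_floor ?_
    push_cast
    linarith
  have hb' : ((⌊6 * ν * n⌋₊ : ℕ) : ℝ) ≤ 6 * ν * n := Nat.floor_le (by positivity)
  have hΘn : 2 * Θ ≤ n := by
    have hz0 : 0 ≤ (z + ρ) * n := by
      have := (hstate 0 (Nat.zero_le _)).1
      have h8 : (0 : ℝ) ≤ (stZ Φ 0).card := Nat.cast_nonneg _
      have h9 : 0 ≤ ρ * n := by positivity
      linarith
    have h8 : (Θ : ℝ) ≤ (z + ρ) * n := by rw [hΘ]; exact Nat.floor_le hz0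
    have h9 : (2 : ℝ) * Θ ≤ n := by nlinarith
    exact_mod_cast h9
  have hsafe : ∀ t < m + t₀, n - (safeSet Φ t).card ≤ B := by
    intro t ht
    rw [hB]
    refine Nat.le_floor ?_
    have h6 := hS (stZ Φ t) (stZ' Φ t) (hstate t ht.le).1 (hstate t ht.le).2
    have h7 : (safeSet Φ t).card ≤ n := by
      simpa using Finset.card_le_univ (safeSet Φ t)
    rw [Nat.cast_sub h7]
    have h8 : γ * n < (safeSet Φ t).card := h6
    linarith
  have hX : ∀ t ≤ m + t₀, (stX Φ t).card ≤ Θ := by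
    intro t ht
    rw [hΘ]
    refine Nat.le_floor ?_
    have h6 : ((stX Φ t).card : ℝ) ≤ (stZ Φ t).card + (stZ' Φ t).card := by
      exact_mod_cast Finset.card_union_le _ _
    have := hstate t ht
    linarith
  -- A pass adds at most three variables, so a large Z' forces t₀ passes.
  have hmany : 3 * t₀ < (phase2 Φ).card := by
    have h6 : (3 * t₀ : ℝ) < (phase2 Φ).card := by linarith
    exact_mod_cast h6
  obtain ⟨P₁, P₂, P₃, hP₁, hP₂, hP₃, hle⟩ := passes_le hk hΘn hsafe hX
    (fun u hu => nonempty_of_lt_card hmany u hu.le) hb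
  have hP : ∀ P : Finset (Fin n), P.card ≤ ⌊6 * ν * n⌋₊ → (P.card : ℝ) ≤ 6 * ν * n :=
    fun P hP => le_trans (by exact_mod_cast hP) hb'
  have e1 := h4 P₁ (hP P₁ hP₁)
  have e2 := h5 P₂ (hP P₂ hP₂)
  have e3 := h4 P₃ (hP P₃ hP₃)
  have hle' : (t₀ : ℝ) ≤ (clausesWith Close (encode 1 (m + t₀) Φ)).card +
      (clausesWith (Hits Θ P₁) (encode 1 (m + t₀) Φ)).card +
      (clausesWith (Hits Θ P₂) (encode Fin.revPerm (m + t₀) Φ)).card +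
      (clausesWith (Hits Θ P₃) (encode 1 (m + t₀) Φ)).card + ⌊6 * ν * n⌋₊ := by
    exact_mod_cast hle
  -- One `Close` count, three `Hits` counts and the charged clauses total less than (4η + 6ν)n,
  -- whereas t₀ > ρn/3 - 1.
  linarith

/-- The probability that `Z'` is large, in terms of numerical parameters. -/
theorem pr_lt_card_phase2_le (hk : 10 ≤ k) (hn0 : 0 < n) {ρ z γ ν η μ q c κ x : ℝ}
    (hρ : 0 ≤ ρ) (hz : 0 ≤ z) (hν : 0 < ν) (hν1 : ν ≤ 1) (hzρ : z + ρ ≤ 1 / 2) (hγ1 : γ ≤ 1)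
    (hγ : z + ρ ≤ γ) (hn : 1 ≤ n * (ρ / 3 - 4 * η - 6 * ν))
    (hm : (m : ℝ) * (1 / 2) ^ k ≤ μ * n)
    (hq : k * ((1 / 2) ^ k * (1 + ρ) ^ k * (1 / n)) ≤ q) (hr : 0 ≤ 1 - q * (1 + c))
    (hc0 : 0 ≤ c) (hc : c ≤ 1) (hκ : κ ≤ (1 - q * (1 + c)) ^ m)
    (hx : 0 < x) (hx1 : x ≤ 1) :
    pr (fun Φ : Formula k n m => ρ * n < (phase2 Φ).card) ≤
      Real.exp (n * (μ * 1 * Real.exp 1 - z)) +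
      (Real.exp (n * (2 * x - (z + ρ) * Real.log x + (c * γ - c * κ / 2))) +
      (Real.exp (n * (μ * (1 - γ) ^ (k₁ k - 1) * Real.exp 1 - ν)) +
      (Real.exp (n * (μ * (k ^ 3 * 8 * (1 + (z + ρ)) ^ k *
        (1 - γ + (z + ρ)) ^ (k - 5 - k₁ k - 3)) * Real.exp 1 - ν)) +
      (Real.exp (n * (μ * (2 ^ k * (k ^ 2 * 5 / n)) * Real.exp 1 - η)) +
      (Real.exp (n * (ν - 6 * ν * Real.log ν +
        (μ * (k ^ 2 * (4 * (6 * ν)) * (1 + (z + ρ)) ^ k) * Real.exp 1 - η))) +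
      Real.exp (n * (ν - 6 * ν * Real.log ν +
        (μ * (k ^ 2 * (4 * (6 * ν)) * (1 + (z + ρ)) ^ k) * Real.exp 1 - η)))))))) := by
  have hinj : ∀ σ : Equiv.Perm (Fin n), Function.Injective
      (encode σ (m + ⌊ρ * n / 3⌋₊) : Formula k n m → Formula k n m) :=
    fun σ => encode_injective hk σ _
  have hΘ : ((⌊(z + ρ) * n⌋₊ : ℕ) : ℝ) ≤ (z + ρ) * n := Nat.floor_le (by positivity)
  have hB : ((⌊(1 - γ) * n⌋₊ : ℕ) : ℝ) ≤ (1 - γ) * n :=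
    Nat.floor_le (mul_nonneg (by linarith) (Nat.cast_nonneg n))
  have hγ' : 0 ≤ 1 - γ := by linarith
  refine (pr_mono fun Φ h =>
    rare_event_of_lt_card (γ := γ) (by omega) hρ hν.le hzρ hn rfl rfl rfl Φ h).trans ?_
  refine (pr_or_le _ _).trans (add_le_add ?_ ((pr_or_le _ _).trans (add_le_add ?_
    ((pr_or_le _ _).trans (add_le_add ?_ ((pr_or_le _ _).trans (add_le_add ?_
    ((pr_or_le _ _).trans (add_le_add ?_ ((pr_or_le _ _).trans (add_le_add ?_ ?_)))))))))))
  · exact pr_clausesWith_le hn0 hm zero_le_one (by rw [mul_one]; exact pr_allNegative_le hn0)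
  · exact pr_exists_few_safe_le hn0 hρ hzρ hq hr hc0 hc hκ hx hx1
  · refine (pr_comp_of_injective (hinj 1)
      (fun Ψ => ν * n ≤ (clausesWith (NoneLarge _) Ψ).card)).trans_le ?_
    exact pr_clausesWith_le hn0 hm (by positivity) (pr_noneLarge_le hn0 hB)
  · refine (pr_comp_of_injective (hinj 1)
      (fun Ψ => ν * n ≤ (clausesWith (FewLarge _ _) Ψ).card)).trans_le ?_
    exact pr_clausesWith_le hn0 hm (by positivity)
      (pr_fewLarge_le hn0 hΘ (by positivity) hB hγ' (by linarith))
  · refine (pr_comp_of_injective (hinj 1)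
      (fun Ψ => η * n ≤ (clausesWith Close Ψ).card)).trans_le ?_
    refine pr_clausesWith_le hn0 hm (by positivity) ((pr_close_le hn0).trans (le_of_eq ?_))
    rw [← mul_assoc, ← mul_pow]
    norm_num
  · refine (pr_comp_of_injective (hinj 1) (fun Ψ => ∃ P : Finset (Fin n),
      (P.card : ℝ) ≤ 6 * ν * n ∧ η * n ≤ (clausesWith (Hits _ P) Ψ).card)).trans_le ?_
    exact pr_exists_hits_le hn0 hm hΘ (by positivity) (by positivity) hν hν1
  · refine (pr_comp_of_injective (hinj Fin.revPerm) (fun Ψ => ∃ P : Finset (Fin n),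
      (P.card : ℝ) ≤ 6 * ν * n ∧ η * n ≤ (clausesWith (Hits _ P) Ψ).card)).trans_le ?_
    exact pr_exists_hits_le hn0 hm hΘ (by positivity) (by positivity) hν hν1

end Events

/-! ### Choice of the parameters, and the limit in n. -/

section Numerics

open MeasureTheory in
theorem uniformOn_univ_eq_ofReal_pr {α : Type*} [Fintype α] [MeasurableSpace α]
    [MeasurableSingletonClass α] [Nonempty α] (p : α → Prop) :
    ProbabilityTheory.uniformOn (Set.univ : Set α) {a | p a} = ENNReal.ofReal (pr p) := by
  classical
  rw [ProbabilityTheory.uniformOn_univ, pr_eq,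
    ENNReal.ofReal_div_of_pos (by exact_mod_cast Fintype.card_pos), ENNReal.ofReal_natCast,
    ENNReal.ofReal_natCast]
  congr 1
  rw [← Measure.count_apply_finset]
  congr 1
  ext a
  simp

theorem pr_eq_one_sub {α : Type*} [Fintype α] [Nonempty α] (p : α → Prop) :
    pr p = 1 - pr fun a => ¬ p a := by
  classical
  have h0 : (Fintype.card α : ℝ) ≠ 0 := by exact_mod_cast Fintype.card_ne_zero
  rw [pr_eq, pr_eq, eq_sub_iff_add_eq, ← add_div, div_eq_one_iff_eq h0]
  exact_mod_cast Finset.card_filter_add_card_filter_not (s := (Finset.univ : Finset α)) p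

theorem tendsto_exp_mul_of_neg {a : ℝ} (ha : a < 0) :
    Tendsto (fun n : ℕ => Real.exp (n * a)) atTop (𝓝 0) :=
  Real.tendsto_exp_atBot.comp (tendsto_natCast_atTop_atTop.atTop_mul_const_of_neg ha)

/-- `k` is large: the logarithm of `k` is small compared with `W = k ^ (ε / 8)`. -/
structure Large (p K L W : ℝ) : Prop where
  K_ge : 100 ≤ K
  L_ge : 1 ≤ L
  L_le : 100 * L ≤ W
  sq_le : 100 * L ^ 2 ≤ W
  mul_ge : 100 ≤ p * W
  W_le : W ^ 2 ≤ K
  exp_L : Real.exp L = K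
  rpow : Real.exp (p * L) = W

theorem eventually_large {p : ℝ} (hp : 0 < p) (hp' : p ≤ 1 / 2) :
    ∀ᶠ k : ℕ in atTop, Large p k (Real.log k) ((k : ℝ) ^ p) := by
  have h1 : Tendsto (fun k : ℕ => (k : ℝ)) atTop atTop := tendsto_natCast_atTop_atTop
  have hlog : ∀ᶠ x : ℝ in atTop, 1 ≤ Real.log x := Real.tendsto_log_atTop.eventually_ge_atTop 1
  have hL1 : ∀ᶠ x : ℝ in atTop, ‖Real.log x‖ ≤ 1 / 100 * ‖x ^ p‖ :=
    (isLittleO_log_rpow_atTop hp).def (by norm_num)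
  have hL2 : ∀ᶠ x : ℝ in atTop, ‖Real.log x ^ (2 : ℝ)‖ ≤ 1 / 100 * ‖x ^ p‖ :=
    (isLittleO_log_rpow_rpow_atTop 2 hp).def (by norm_num)
  have hW : ∀ᶠ x : ℝ in atTop, 100 / p ≤ x ^ p :=
    (tendsto_rpow_atTop hp).eventually_ge_atTop _
  filter_upwards [h1.eventually (eventually_ge_atTop 100), h1.eventually hlog,
    h1.eventually hL1, h1.eventually hL2, h1.eventually hW] with k e1 e2 e3 e4 e5
  have hK : (0 : ℝ) < k := by linarith
  have hWpos : (0 : ℝ) < (k : ℝ) ^ p := Real.rpow_pos_of_pos hK p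
  rw [Real.norm_of_nonneg (by linarith), Real.norm_of_nonneg hWpos.le] at e3
  rw [Real.rpow_two, Real.norm_of_nonneg (by positivity), Real.norm_of_nonneg hWpos.le] at e4
  refine ⟨e1, e2, by linarith, by linarith, ?_, ?_, Real.exp_log hK, ?_⟩
  · rw [div_le_iff₀ hp] at e5
    linarith
  · rw [← Real.rpow_natCast, ← Real.rpow_mul hK.le]
    calc (k : ℝ) ^ (p * (2 : ℕ)) ≤ (k : ℝ) ^ (1 : ℝ) :=
          Real.rpow_le_rpow_of_exponent_le (by linarith) (by push_cast; linarith)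
      _ = k := Real.rpow_one _
  · rw [Real.rpow_def_of_pos hK, mul_comm]

namespace Large

variable {p L W : ℝ} {k : ℕ}

theorem W_ge (h : Large p k L W) : 100 ≤ W := by
  have := h.L_ge
  have := h.L_le
  linarith

theorem W_le_K (h : Large p k L W) : W ≤ k := by
  have := h.W_le
  have := h.W_ge
  nlinarith

theorem exp_mul_L (h : Large p k L W) (j : ℕ) : Real.exp (j * L) = (k : ℝ) ^ j := by
  rw [Real.exp_nat_mul, h.exp_L]

theorem log_K (h : Large p k L W) : Real.log k = L := by
  rw [← h.exp_L, Real.log_exp]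

/-- The two summands bound |Z|/n and |Z'|/n; their sum is the density θ of low codes. -/
theorem theta_le (h : Large p k L W) : 4 * L / k + 1 / (k : ℝ) ^ 12 ≤ 5 * L / k := by
  have hK := h.K_ge
  have hL := h.L_ge
  have hK0 : (0 : ℝ) < k := by linarith
  have h1 : 1 / (k : ℝ) ^ 12 ≤ L / k := by
    refine div_le_div₀ (by linarith) hL hK0 ?_
    exact le_self_pow₀ (by linarith) (by norm_num)
  have h2 : 5 * L / k = 4 * L / k + L / k := by ring
  linarith

theorem one_add_theta_pow_le (h : Large p k L W) :
    (1 + (4 * L / k + 1 / (k : ℝ) ^ 12)) ^ k ≤ (k : ℝ) ^ 5 := by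
  have hK := h.K_ge
  have hL := h.L_ge
  have hK0 : (0 : ℝ) < k := by linarith
  rw [← h.exp_mul_L 5]
  calc (1 + (4 * L / k + 1 / (k : ℝ) ^ 12)) ^ k
      ≤ (Real.exp (5 * L / k)) ^ k := by
        refine pow_le_pow_left₀ (by positivity) ?_ k
        have := Real.add_one_le_exp (5 * L / (k : ℝ))
        have := h.theta_le
        linarith
    _ = Real.exp ((5 : ℕ) * L) := by
        rw [← Real.exp_nat_mul]
        congr 1
        push_cast
        field_simp

theorem mul_exp_one_le (h : Large p k L W) : L / k * Real.exp 1 ≤ 1 / 8 := by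
  have hK := h.K_ge
  have hL := h.L_ge
  have hK0 : (0 : ℝ) < k := by linarith
  have h1 : L / k ≤ 1 / 100 := by
    rw [div_le_iff₀ hK0]
    have := h.L_le
    have := h.W_le_K
    linarith
  have h2 : 0 ≤ L / k := by positivity
  have h3 := Real.exp_one_lt_d9
  have h4 := Real.exp_pos 1
  nlinarith

/-- The expected number of all-negative clauses is at most nL/k, and e < 4. -/
theorem exponent_allNegative (h : Large p k L W) : L / k * 1 * Real.exp 1 - 4 * L / k < 0 := by
  have hK := h.K_ge
  have hL := h.L_ge
  have h2 : 0 < L / k := by positivity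
  have h3 := Real.exp_one_lt_d9
  have h4 : 4 * L / k = L / k * 4 := by ring
  rw [h4, mul_one]
  nlinarith

/-- The entropy of the pairs (Z, Z') is of order L²/k, while the exponential moment gains pW⁴/(2k);
W exceeds L² by a factor 100, and pW ≥ 100. -/
theorem exponent_safe (h : Large p k L W) : 2 * (1 / (k : ℝ)) -
    (4 * L / k + 1 / (k : ℝ) ^ 12) * Real.log (1 / k) +
      (p * (W ^ 2 / k) - p * (W ^ 4 / k) / 2) < 0 := by
  have hK := h.K_ge
  have hL := h.L_ge
  have hW := h.W_ge
  have hK0 : (0 : ℝ) < k := by linarith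
  have hp : 0 < p := by
    have := h.mul_ge
    by_contra hn
    nlinarith
  rw [one_div, Real.log_inv, h.log_K]
  have h1 : (4 * L / k + 1 / (k : ℝ) ^ 12) * L ≤ 5 * L / k * L :=
    mul_le_mul_of_nonneg_right h.theta_le (by linarith)
  have h2 : 2 + 5 * L ^ 2 + p * W ^ 2 - p * W ^ 4 / 2 < 0 := by
    have e1 := h.sq_le
    have e2 := h.mul_ge
    have e3 : (10000 : ℝ) ≤ W ^ 2 := by nlinarith
    have e4 : p * W ^ 2 * 10000 ≤ p * W ^ 2 * W ^ 2 :=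
      mul_le_mul_of_nonneg_left e3 (by positivity)
    have e5 : 100 * W ≤ p * W * W := mul_le_mul_of_nonneg_right e2 (by linarith)
    nlinarith
  have h3 : 2 * (k : ℝ)⁻¹ + 5 * L / k * L + (p * (W ^ 2 / k) - p * (W ^ 4 / k) / 2) < 0 := by
    have : 2 * (k : ℝ)⁻¹ + 5 * L / k * L + (p * (W ^ 2 / k) - p * (W ^ 4 / k) / 2) =
        (2 + 5 * L ^ 2 + p * W ^ 2 - p * W ^ 4 / 2) / k := by
      field_simp
      ring
    rw [this]
    exact div_neg_of_neg_of_pos h2 hK0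
  rw [mul_neg]
  linarith

theorem gamma_le (h : Large p k L W) : W ^ 2 / k ≤ 1 := by
  rw [div_le_one (by have := h.K_ge; linarith)]
  exact h.W_le

theorem theta_le_gamma (h : Large p k L W) :
    4 * L / k + 1 / (k : ℝ) ^ 12 ≤ W ^ 2 / k / 2 := by
  refine h.theta_le.trans ?_
  rw [div_div, mul_comm (k : ℝ) 2, ← div_div]
  refine div_le_div_of_nonneg_right ?_ (by have := h.K_ge; linarith)
  have := h.L_le
  have := h.W_ge
  nlinarith

/-- A power with exponent at least `k / 4` of a number that is at most `1 - γ / 2` is small. -/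
theorem pow_le_exp (h : Large p k L W) {β : ℝ} (hβ0 : 0 ≤ β) (hβ : β ≤ 1 - W ^ 2 / k / 2) {j : ℕ}
    (hj : k ≤ 4 * j) : β ^ j ≤ Real.exp (-(W ^ 2 / 8)) := by
  have hK := h.K_ge
  have hK0 : (0 : ℝ) < k := by linarith
  have hj' : (k : ℝ) ≤ 4 * j := by exact_mod_cast hj
  calc β ^ j ≤ (Real.exp (-(W ^ 2 / k / 2))) ^ j := by
        refine pow_le_pow_left₀ hβ0 (hβ.trans ?_) j
        have := Real.add_one_le_exp (-(W ^ 2 / (k : ℝ) / 2))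
        linarith
    _ ≤ Real.exp (-(W ^ 2 / 8)) := by
        rw [← Real.exp_nat_mul]
        refine Real.exp_le_exp.mpr ?_
        have h1 : W ^ 2 / 8 = k / 4 * (W ^ 2 / k / 2) := by
          field_simp
          ring
        have h2 : (k : ℝ) / 4 * (W ^ 2 / k / 2) ≤ j * (W ^ 2 / k / 2) :=
          mul_le_mul_of_nonneg_right (by linarith) (by positivity)
        linarith

/-- The power 8 collects k³ for the choice of exceptional positions and k⁵ for (1 + θ)ᵏ. -/
theorem exp_lt (h : Large p k L W) : (k : ℝ) ^ 8 * Real.exp (-(W ^ 2 / 8)) < Real.exp (-W) := by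
  rw [← h.exp_mul_L 8, ← Real.exp_add]
  refine Real.exp_lt_exp.mpr ?_
  have := h.L_le
  have := h.W_ge
  push_cast
  nlinarith

theorem exponent_noneLarge (h : Large p k L W) :
    L / k * (1 - W ^ 2 / k) ^ (k₁ k - 1) * Real.exp 1 - Real.exp (-W) < 0 := by
  have hK := h.K_ge
  have hk : 100 ≤ k := by exact_mod_cast hK
  have h1 := h.pow_le_exp (β := 1 - W ^ 2 / k) (by have := h.gamma_le; linarith)
    (by have : 0 ≤ W ^ 2 / (k : ℝ) := by positivity
        linarith) (j := k₁ k - 1) (by unfold k₁; omega)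
  have h2 := h.mul_exp_one_le
  have h3 := h.exp_lt
  have h4 : (1 : ℝ) ≤ (k : ℝ) ^ 8 := one_le_pow₀ (by linarith)
  have h5 := Real.exp_pos (-(W ^ 2 / 8))
  have h6 : 0 ≤ (1 - W ^ 2 / (k : ℝ)) ^ (k₁ k - 1) :=
    pow_nonneg (by have := h.gamma_le; linarith) _
  have h7 : L / k * Real.exp 1 * (1 - W ^ 2 / k) ^ (k₁ k - 1) ≤
      1 / 8 * Real.exp (-(W ^ 2 / 8)) := mul_le_mul h2 h1 h6 (by norm_num)
  nlinarith

theorem exponent_fewLarge (h : Large p k L W) :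
    L / k * ((k : ℝ) ^ 3 * 8 * (1 + (4 * L / k + 1 / (k : ℝ) ^ 12)) ^ k *
      (1 - W ^ 2 / k + (4 * L / k + 1 / (k : ℝ) ^ 12)) ^ (k - 5 - k₁ k - 3)) * Real.exp 1 -
      Real.exp (-W) < 0 := by
  have hK := h.K_ge
  have hL := h.L_ge
  have hk : 100 ≤ k := by exact_mod_cast hK
  have h0 : 0 ≤ 1 - W ^ 2 / k + (4 * L / k + 1 / (k : ℝ) ^ 12) := by
    have h01 := h.gamma_le
    have h02 : 0 ≤ 4 * L / k + 1 / (k : ℝ) ^ 12 := by positivity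
    linarith
  have h1 := h.pow_le_exp h0 (by have := h.theta_le_gamma; linarith)
    (j := k - 5 - k₁ k - 3) (by unfold k₁; omega)
  have h2 := h.mul_exp_one_le
  have h3 := h.exp_lt
  have h4 := h.one_add_theta_pow_le
  have h5 : (1 + (4 * L / k + 1 / (k : ℝ) ^ 12)) ^ k *
      (1 - W ^ 2 / k + (4 * L / k + 1 / (k : ℝ) ^ 12)) ^ (k - 5 - k₁ k - 3) ≤
      (k : ℝ) ^ 5 * Real.exp (-(W ^ 2 / 8)) :=
    mul_le_mul h4 h1 (pow_nonneg h0 _) (by positivity)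
  have h6 : L / k * Real.exp 1 * ((k : ℝ) ^ 3 * 8 * ((1 + (4 * L / k + 1 / (k : ℝ) ^ 12)) ^ k *
      (1 - W ^ 2 / k + (4 * L / k + 1 / (k : ℝ) ^ 12)) ^ (k - 5 - k₁ k - 3))) ≤
      1 / 8 * ((k : ℝ) ^ 3 * 8 * ((k : ℝ) ^ 5 * Real.exp (-(W ^ 2 / 8)))) := by
    refine mul_le_mul h2 (mul_le_mul_of_nonneg_left h5 (by positivity)) ?_ (by norm_num)
    have := pow_nonneg h0 (k - 5 - k₁ k - 3)
    positivity
  have h7 : 1 / 8 * ((k : ℝ) ^ 3 * 8 * ((k : ℝ) ^ 5 * Real.exp (-(W ^ 2 / 8)))) =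
      (k : ℝ) ^ 8 * Real.exp (-(W ^ 2 / 8)) := by ring
  linarith

/-- W ≥ 100 L makes exp(-W) smaller than k⁻²⁰/8. The power 7 is that of k² · k⁵ in the bound for
`Hits`. -/
theorem mul_exp_neg_lt (h : Large p k L W) :
    8 * (k : ℝ) ^ 7 * Real.exp (-W) < 1 / (k : ℝ) ^ 13 := by
  have hK := h.K_ge
  have hK0 : (0 : ℝ) < k := by linarith
  rw [lt_div_iff₀ (by positivity)]
  have h1 : 8 * (k : ℝ) ^ 7 * Real.exp (-W) * (k : ℝ) ^ 13 =
      8 * ((k : ℝ) ^ 20 * Real.exp (-W)) := by ring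
  have h8 : (8 : ℝ) ≤ Real.exp 3 := by
    have e1 := Real.add_one_le_exp 1
    have e2 : Real.exp 3 = Real.exp 1 ^ 3 := by rw [← Real.exp_nat_mul]; norm_num
    rw [e2]
    calc (8 : ℝ) = 2 ^ 3 := by norm_num
      _ ≤ Real.exp 1 ^ 3 := pow_le_pow_left₀ (by norm_num) (by linarith) 3
  rw [h1, ← h.exp_mul_L 20, ← Real.exp_add]
  calc 8 * Real.exp ((20 : ℕ) * L + -W)
      ≤ Real.exp 3 * Real.exp ((20 : ℕ) * L + -W) :=
        mul_le_mul_of_nonneg_right h8 (Real.exp_nonneg _)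
    _ < 1 := by
        rw [← Real.exp_add, Real.exp_lt_one_iff]
        have := h.L_le
        have := h.W_ge
        push_cast
        linarith

/-- With x = ν the entropy is ν + 6Wν. Both it and the expected density of `Hits` are at most a
constant times k⁷ν, far below η. -/
theorem exponent_hits (h : Large p k L W) :
    Real.exp (-W) - 6 * Real.exp (-W) * Real.log (Real.exp (-W)) +
      (L / k * ((k : ℝ) ^ 2 * (4 * (6 * Real.exp (-W))) *
        (1 + (4 * L / k + 1 / (k : ℝ) ^ 12)) ^ k) * Real.exp 1 - 1 / (k : ℝ) ^ 13) < 0 := by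
  have hK := h.K_ge
  have hL := h.L_ge
  rw [Real.log_exp]
  have h1 := h.mul_exp_neg_lt
  have h2 := h.mul_exp_one_le
  have h3 := h.one_add_theta_pow_le
  have h4 := h.W_le_K
  have hν := Real.exp_pos (-W)
  have h5 : L / k * Real.exp 1 * ((k : ℝ) ^ 2 * (4 * (6 * Real.exp (-W))) *
      (1 + (4 * L / k + 1 / (k : ℝ) ^ 12)) ^ k) ≤
      1 / 8 * ((k : ℝ) ^ 2 * (4 * (6 * Real.exp (-W))) * (k : ℝ) ^ 5) := by
    refine mul_le_mul h2 (mul_le_mul_of_nonneg_left h3 (by positivity)) (by positivity)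
      (by norm_num)
  have h6 : 1 / 8 * ((k : ℝ) ^ 2 * (4 * (6 * Real.exp (-W))) * (k : ℝ) ^ 5) =
      3 * (k : ℝ) ^ 7 * Real.exp (-W) := by ring
  have h7 : 1 + 6 * W ≤ 5 * (k : ℝ) ^ 7 := by
    have e1 : (k : ℝ) ^ 2 ≤ (k : ℝ) ^ 7 := pow_le_pow_right₀ (by linarith) (by norm_num)
    nlinarith
  have h8 : (1 + 6 * W) * Real.exp (-W) ≤ 5 * (k : ℝ) ^ 7 * Real.exp (-W) :=
    mul_le_mul_of_nonneg_right h7 hν.le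
  linarith

/-- Here ρ = kη with k ≥ 100, and ν is smaller than η. -/
theorem margin_pos (h : Large p k L W) :
    0 < 1 / (k : ℝ) ^ 12 / 3 - 4 * (1 / (k : ℝ) ^ 13) - 6 * Real.exp (-W) := by
  have hK := h.K_ge
  have hK0 : (0 : ℝ) < k := by linarith
  have h1 := h.mul_exp_neg_lt
  have hν := Real.exp_pos (-W)
  have h2 : (1 : ℝ) ≤ (k : ℝ) ^ 7 := one_le_pow₀ (by linarith)
  have h3 : 8 * Real.exp (-W) ≤ 8 * (k : ℝ) ^ 7 * Real.exp (-W) := by nlinarith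
  have h4 : 1 / (k : ℝ) ^ 12 = k * (1 / (k : ℝ) ^ 13) := by
    field_simp
  have h5 : 0 < 1 / (k : ℝ) ^ 13 := by positivity
  rw [h4]
  nlinarith

theorem one_add_rho_pow_le (h : Large p k L W) : (1 + 1 / (k : ℝ) ^ 12) ^ k ≤ 1 + p := by
  have hK := h.K_ge
  have hK0 : (0 : ℝ) < k := by linarith
  have hp : 100 ≤ p * k := by
    have h1 := h.mul_ge
    have h2 := h.W_le_K
    have h3 := h.W_ge
    have hp0 : 0 < p := by
      by_contra hn
      nlinarith
    nlinarith
  calc (1 + 1 / (k : ℝ) ^ 12) ^ k ≤ (Real.exp (1 / (k : ℝ) ^ 12)) ^ k := by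
        refine pow_le_pow_left₀ (by positivity) ?_ k
        have := Real.add_one_le_exp (1 / (k : ℝ) ^ 12)
        linarith
    _ = Real.exp (1 / (k : ℝ) ^ 11) := by
        rw [← Real.exp_nat_mul]
        congr 1
        field_simp
    _ ≤ Real.exp (1 / k) := by
        refine Real.exp_le_exp.mpr (one_div_le_one_div_of_le hK0 ?_)
        exact le_self_pow₀ (by linarith) (by norm_num)
    _ ≤ 1 + 2 * (1 / k) := by
        have h1 : 1 / (k : ℝ) ≤ 1 := by
          rw [div_le_one hK0]
          linarith
        have h0 : 0 ≤ 1 / (k : ℝ) := by positivity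
        have := (abs_le.mp (Real.abs_exp_sub_one_sub_id_le
          (by rw [abs_of_nonneg h0]; exact h1))).2
        nlinarith
    _ ≤ 1 + p := by
        have : 1 / (k : ℝ) ≤ p / 2 := by
          rw [div_le_iff₀ hK0]
          linarith
        linarith

/-- From log(1 - y) ≥ -y(1 + p) the right side is at least exp(-my(1 + p)), and the left side is
exp((4p - 1)L). The three factors 1 + p, two in the bound for my and one from the logarithm, cost at
most half of the slack 8p. -/
theorem kappa_le (h : Large p k L W) (hp : 0 < p) (hp' : 8 * p < 1) {y : ℝ} {m : ℕ}
    (hy0 : 0 ≤ y) (hy : y * (1 + p) ≤ p) (hmy : m * y ≤ (1 - 8 * p) * L * (1 + p) ^ 2) :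
    W ^ 4 / k ≤ (1 - y) ^ m := by
  have hL := h.L_ge
  have hy1 : y < 1 := by nlinarith
  have h1 : W ^ 4 / k = Real.exp ((4 * p - 1) * L) := by
    rw [← h.exp_L, ← h.rpow, ← Real.exp_nat_mul, ← Real.exp_sub]
    congr 1
    push_cast
    ring
  have h2 : -(y * (1 + p)) ≤ Real.log (1 - y) := by
    have h3 := Real.one_sub_inv_le_log_of_pos (by linarith : 0 < 1 - y)
    have h4 : (1 - y)⁻¹ ≤ 1 + y * (1 + p) := by
      rw [inv_le_iff_one_le_mul₀ (by linarith)]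
      nlinarith
    linarith
  rw [h1, ← Real.exp_log (pow_pos (by linarith : 0 < 1 - y) m), Real.log_pow]
  refine Real.exp_le_exp.mpr ?_
  have h5 : (m : ℝ) * -(y * (1 + p)) ≤ m * Real.log (1 - y) :=
    mul_le_mul_of_nonneg_left h2 (Nat.cast_nonneg m)
  have h6 : m * y * (1 + p) ≤ (1 - 8 * p) * L * (1 + p) ^ 2 * (1 + p) :=
    mul_le_mul_of_nonneg_right hmy (by linarith)
  have h7 : (1 - 8 * p) * (1 + p) ^ 3 ≤ 1 - 4 * p := by
    have : 0 ≤ p ^ 2 := by positivity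
    have : 0 ≤ p ^ 3 := by positivity
    have : 0 ≤ p ^ 4 := by positivity
    nlinarith
  have h8 : (1 - 8 * p) * (1 + p) ^ 3 * L ≤ (1 - 4 * p) * L :=
    mul_le_mul_of_nonneg_right h7 (by linarith)
  nlinarith

end Large

theorem numClauses_mul_le {ε : ℝ} (hε' : ε ≤ 1) {k : ℕ} (hk : 1 ≤ k) (n : ℕ) :
    (numClauses ε k n : ℝ) * (1 / 2) ^ k ≤ (1 - ε) * (Real.log k / k) * n := by
  have hL : 0 ≤ Real.log k := Real.log_natCast_nonneg k
  have h1 : (numClauses ε k n : ℝ) ≤ (1 - ε) * 2 ^ k * (k : ℝ)⁻¹ * Real.log k * n := by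
    refine Nat.floor_le ?_
    have : 0 ≤ 1 - ε := by linarith
    positivity
  refine (mul_le_mul_of_nonneg_right h1 (by positivity)).trans (le_of_eq ?_)
  have h2 : (2 : ℝ) ^ k * (1 / 2) ^ k = 1 := by
    rw [← mul_pow]
    norm_num
  calc (1 - ε) * 2 ^ k * (k : ℝ)⁻¹ * Real.log k * n * (1 / 2) ^ k
      = (1 - ε) * (Real.log k / k) * n * (2 ^ k * (1 / 2) ^ k) := by ring
    _ = _ := by rw [h2, mul_one]

theorem tendsto_pr_lt_card_phase2 {ε : ℝ} (hε : 0 < ε) (hε' : ε < 0.1) {k : ℕ} {W : ℝ}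
    (h : Large (ε / 8) k (Real.log k) W) :
    Tendsto (fun n : ℕ => pr (fun Φ : Formula k n (numClauses ε k n) =>
      1 / (k : ℝ) ^ 12 * n < (phase2 Φ).card)) atTop (𝓝 0) := by
  have hK := h.K_ge
  have hL := h.L_ge
  have hK0 : (0 : ℝ) < k := by linarith
  have hk : 100 ≤ k := by exact_mod_cast hK
  have hlim : Tendsto (fun n : ℕ => (n : ℝ)) atTop atTop := tendsto_natCast_atTop_atTop
  -- y n = q(1 + c) is the fraction of the safe variables lost per clause in the exponential moment.
  set y : ℕ → ℝ := fun n => k * ((1 / 2) ^ k * (1 + 1 / (k : ℝ) ^ 12) ^ k * (1 / n)) *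
    (1 + ε / 8) with hydef
  have hy : Tendsto y atTop (𝓝 0) := by
    have h1 : Tendsto (fun n : ℕ => (1 : ℝ) / n) atTop (𝓝 0) :=
      tendsto_one_div_atTop_nhds_zero_nat
    have := ((h1.const_mul ((1 / 2) ^ k * (1 + 1 / (k : ℝ) ^ 12) ^ k)).const_mul
      (k : ℝ)).mul_const (1 + ε / 8)
    simpa [hydef] using this
  -- The probability of `Close` is of order 1/n, so its exponent contains this constant instead of a
  -- multiple of n.
  set C : ℝ := Real.log k / k * (2 ^ k * (k ^ 2 * 5)) * Real.exp 1 with hC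
  have hη : 0 < 1 / (k : ℝ) ^ 13 := by positivity
  have hclose : Tendsto (fun n : ℕ => Real.exp (C - n * (1 / (k : ℝ) ^ 13))) atTop (𝓝 0) := by
    have h1 := (tendsto_exp_mul_of_neg (neg_lt_zero.mpr hη)).const_mul (Real.exp C)
    rw [mul_zero] at h1
    refine h1.congr fun n => ?_
    rw [← Real.exp_add]
    congr 1
    ring
  have hsum := (tendsto_exp_mul_of_neg h.exponent_allNegative).add
    ((tendsto_exp_mul_of_neg h.exponent_safe).add
    ((tendsto_exp_mul_of_neg h.exponent_noneLarge).add
    ((tendsto_exp_mul_of_neg h.exponent_fewLarge).add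
    (hclose.add ((tendsto_exp_mul_of_neg h.exponent_hits).add
      (tendsto_exp_mul_of_neg h.exponent_hits))))))
  simp only [add_zero] at hsum
  refine squeeze_zero' (Eventually.of_forall fun n => pr_nonneg _) ?_ hsum
  have hmargin : ∀ᶠ n : ℕ in atTop, 1 ≤ n * (1 / (k : ℝ) ^ 12 / 3 - 4 * (1 / (k : ℝ) ^ 13) -
      6 * Real.exp (-W)) :=
    (hlim.atTop_mul_const h.margin_pos).eventually_ge_atTop 1
  have hysmall : ∀ᶠ n : ℕ in atTop, y n < ε / 16 := hy.eventually_lt_const (by positivity)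
  filter_upwards [eventually_gt_atTop 0, hmargin, hysmall] with n hn hn1 hyn
  have hn' : (0 : ℝ) < n := by exact_mod_cast hn
  have hε1 : ε < 1 / 10 := by norm_num at hε' ⊢; exact hε'
  have hm := numClauses_mul_le (by linarith : ε ≤ 1) (by omega : 1 ≤ k) n
  have hy0 : 0 ≤ y n := by positivity
  have hLK : 0 ≤ Real.log k / k := by positivity
  have hmy : (numClauses ε k n : ℝ) * y n ≤ (1 - 8 * (ε / 8)) * Real.log k * (1 + ε / 8) ^ 2 := by
    have e1 : (numClauses ε k n : ℝ) * y n =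
        (numClauses ε k n : ℝ) * (1 / 2) ^ k *
          (k * (1 / n) * (1 + ε / 8) * (1 + 1 / (k : ℝ) ^ 12) ^ k) := by
      rw [hydef]
      ring
    rw [e1]
    refine (mul_le_mul_of_nonneg_right hm (by positivity)).trans ?_
    have e2 : (1 - ε) * (Real.log k / k) * n *
        (k * (1 / n) * (1 + ε / 8) * (1 + 1 / (k : ℝ) ^ 12) ^ k) =
        (1 - ε) * Real.log k * (1 + ε / 8) * (1 + 1 / (k : ℝ) ^ 12) ^ k := by
      field_simp
    rw [e2]
    have e3 : 0 ≤ (1 - ε) * Real.log k * (1 + ε / 8) :=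
      mul_nonneg (mul_nonneg (by linarith) (by linarith)) (by linarith)
    refine (mul_le_mul_of_nonneg_left h.one_add_rho_pow_le e3).trans (le_of_eq ?_)
    ring
  have hκ := h.kappa_le (by linarith) (by linarith) hy0 (by nlinarith) hmy
  have hm' : (numClauses ε k n : ℝ) * (1 / 2) ^ k ≤ Real.log k / k * n := by
    refine hm.trans (mul_le_mul_of_nonneg_right ?_ hn'.le)
    nlinarith
  have hthg := h.theta_le_gamma
  have hg := h.gamma_le
  have hW0 : 0 ≤ W ^ 2 / (k : ℝ) := by positivity
  -- z exceeds eL/k; γ = W²/k lies well above θ = z + ρ and well below κ = W⁴/k; ν is above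
  -- exp(-W²/8) times the powers of k, and its own multiples stay below η; η = ρ/k.
  have hbound := pr_lt_card_phase2_le (k := k) (m := numClauses ε k n) (by omega) hn
    (ρ := 1 / (k : ℝ) ^ 12) (z := 4 * Real.log k / k) (γ := W ^ 2 / k) (ν := Real.exp (-W))
    (η := 1 / (k : ℝ) ^ 13) (μ := Real.log k / k) (c := ε / 8) (κ := W ^ 4 / k) (x := 1 / k)
    (by positivity) (by positivity) (Real.exp_pos _)
    (Real.exp_le_one_iff.mpr (by have := h.W_ge; linarith)) (by linarith) hg (by linarith) hn1
    hm' le_rfl (by show 0 ≤ 1 - y n; linarith) (by linarith) (by linarith) hκ (by positivity)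
    (by rw [div_le_one hK0]; linarith)
  refine hbound.trans (le_of_eq ?_)
  have hCn : (n : ℝ) * (Real.log k / k * (2 ^ k * (k ^ 2 * 5 / n)) * Real.exp 1 -
      1 / (k : ℝ) ^ 13) = C - n * (1 / (k : ℝ) ^ 13) := by
    rw [hC]
    field_simp
  rw [hCn]

end Numerics

end FixSat

/-- For every `0 < ε < 0.1` and every `k ≥ k₀(ε)`, a uniformly random `k`-SAT formula `Φ` with `n`
variables and `⌊(1 - ε) 2^k k⁻¹ ln k · n⌋` clauses satisfies `|Z'| ≤ n k⁻¹²` with probability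
tending to one as `n → ∞`, where `Z'` is the set built in the second phase of the algorithm. -/
theorem proposition3p2 (ε : ℝ) (hε : 0 < ε) (hε' : ε < 0.1) :
    ∃ k₀ : ℕ, ∀ k : ℕ, k₀ ≤ k →
      Tendsto
        (fun n : ℕ =>
          ProbabilityTheory.uniformOn
            (Set.univ : Set (FixSat.Formula k n (FixSat.numClauses ε k n)))
            {Φ | ((FixSat.phase2 Φ).card : ℝ) ≤ (n : ℝ) * (k : ℝ) ^ (-12 : ℤ)})
        atTop (𝓝 1) := by
  have hε1 : ε < 1 / 10 := by norm_num at hε' ⊢; exact hε'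
  obtain ⟨k₀, hk₀⟩ := eventually_atTop.mp
    (FixSat.eventually_large (p := ε / 8) (by linarith) (by linarith))
  refine ⟨k₀, fun k hk => ?_⟩
  have h := (FixSat.tendsto_pr_lt_card_phase2 hε hε' (hk₀ k hk)).const_sub 1
  rw [sub_zero] at h
  have h' := ENNReal.tendsto_ofReal h
  rw [ENNReal.ofReal_one] at h'
  refine h'.congr' ?_
  filter_upwards [eventually_gt_atTop 0] with n hn
  have : Nonempty (Fin n) := ⟨⟨0, hn⟩⟩
  rw [FixSat.uniformOn_univ_eq_ofReal_pr,
    FixSat.pr_eq_one_sub (fun Φ : FixSat.Formula k n (FixSat.numClauses ε k n) =>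
      ((FixSat.phase2 Φ).card : ℝ) ≤ (n : ℝ) * (k : ℝ) ^ (-12 : ℤ))]
  congr 3
  funext Φ
  rw [not_le, zpow_neg, mul_comm, one_div]
  norm_cast
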